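/- **Setting.** Let $K\ge 2$. A bandit instance is a vector $\nu=(\nu_1,\dots,\nu_K)$ of probability distributions on $\mathbb R$ that are 1-sub-Gaussian, i.e. $\mathbb E_{X\sim\nu_i}[e^{\lambda(X-\mu_i)}]\le e^{\lambda^2/2}$ for all $\lambda\in\mathbb R$, where $\mu_i$ is the mean of $\nu_i$. Let $\mu_\star=\max_i\mu_i$, and for $\epsilon\ge0$ let $\mathcal I_\epsilon(\mu)=\{i:\mu_i\ge\mu_\star-\epsilon\}$ be the set of $\epsilon$-good arms and $i^\star(\mu)=\mathcal I_0(\mu)$ the set of best arms. In each round $n=1,2,\dots$ a learner chooses an arm $I_n$ from the information $\mathcal F_n$ available before round $n$ (the past arms and observations and, possibly, randomness used to break ties) and observes $X_n$, whose conditional law given $\mathcal F_n$ is $\nu_{I_n}$. Let $N_{n,i}=\sum_{t<n}\mathbf 1\{I_t=i\}$ and $\mu_{n,i}=N_{n,i}^{-1}\sum_{t<n}X_t\mathbf 1\{I_t=i\}$, and for $s\ge0$ let $$Z^{s}_n(i,j)=\frac{\mu_{n,i}-\mu_{n,j}+s}{\sqrt{1/N_{n,i}+1/N_{n,j}}}.$$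 **Algorithm EB-TC$_{\epsilon_0}$** ($\epsilon_0>0$). Each arm is sampled once in the first $K$ rounds. In each round $n>K$ the leader, which is also the recommended arm, is $B_n=\hat\imath_n\in\arg\max_i\mu_{n,i}$ and the challenger is $C_n\in\arg\min_{i\ne B_n}Z_n^{\epsilon_0}(B_n,i)$, ties being broken arbitrarily. Let $T_n(i,j)=\#\{K<t<n:(B_t,C_t)=(i,j)\}$ and $N^i_{n,j}=\#\{K<t<n:(B_t,C_t)=(i,j),\,I_t=j\}$. With *fixed* proportions $\beta\in(0,1)$ put $\bar\beta_n(i,j)=\beta$; with *IDS* (information-directed selection) proportions put $$\bar\beta_n(i,j)=\frac1{T_n(i,j)}\sum_{K<t<n,\ (B_t,C_t)=(i,j)}\frac{N_{t,j}}{N_{t,i}+N_{t,j}}.$$ Then $I_n=C_n$ if $N^{B_n}_{n,C_n}\le(1-\bar\beta_{n+1}(B_n,C_n))\,T_{n+1}(B_n,C_n)$, and $I_n=B_n$ otherwise. **GLR$_\epsilon$ stopping rule** ($\epsilon\ge0$, $\delta\in(0,1)$). Stop at $$\tau_{\epsilon,\delta}=\inf\Big\{n>K:\ \min_{i\ne\hat\imath_n}Z^{\epsilon}_n(\hat\imath_n,i)\ge\sqrt{2c(n-1,\delta)}\Big\},$$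 with the threshold $$c(n,\delta)=2\,\mathcal C_G\big(\tfrac12\log\tfrac{K-1}{\delta}\big)+4\log\big(4+\log\tfrac n2\big),$$ where $\mathcal C_G(x)=\min_{\lambda\in(1/2,1]}\frac{g_G(\lambda)+x}{\lambda}$ and $g_G(\lambda)=2\lambda-2\lambda\log(4\lambda)+\log\zeta(2\lambda)-\frac12\log(1-\lambda)$, $\zeta$ being the Riemann zeta function. **Characteristic times.** For $\beta\in(0,1)$ and $i\in\mathcal I_\epsilon(\mu)$, with $\triangle_K$ the probability simplex of $\mathbb R^K$, let $$T_{\epsilon,\beta}(\mu,i)^{-1}=\max_{w\in\triangle_K,\ w_i=\beta}\ \min_{j\ne i}\ \frac12\,\frac{(\mu_i-\mu_j+\epsilon)^2}{1/\beta+1/w_j},$$ $$T_{\epsilon,\beta}(\mu)=\min_{i\in\mathcal I_\epsilon(\mu)}T_{\epsilon,\beta}(\mu,i),\qquad T_\epsilon(\mu)=\min_{i\in\mathcal I_\epsilon(\mu)}\ \min_{\beta\in(0,1)}T_{\epsilon,\beta}(\mu,i).$$ **Theorem 1.** Let $\epsilon\ge0$ and $\epsilon_0>0$, and combine EB-TC$_{\epsilon_0}$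 with the GLR$_\epsilon$ stopping rule. 1. With IDS proportions, and with fixed proportions $\beta$ for every $\beta\in(0,1)$, the algorithm is $(\epsilon,\delta)$-PAC for every $\delta\in(0,1)$: on every 1-sub-Gaussian instance, $\mathbb P_\nu(\tau_{\epsilon,\delta}<\infty,\ \hat\imath_{\tau_{\epsilon,\delta}}\notin\mathcal I_\epsilon(\mu))\le\delta$. 2. For every 1-sub-Gaussian instance $\nu$ with a unique best arm $i^\star$, $$\text{[IDS]}\quad\limsup_{\delta\to0}\frac{\mathbb E_\nu[\tau_{\epsilon,\delta}]}{\log(1/\delta)}\le T_{\epsilon_0}(\mu)\,D_{\epsilon,\epsilon_0}(\mu),\qquad\text{[fixed }\beta\text{]}\quad\limsup_{\delta\to0}\frac{\mathbb E_\nu[\tau_{\epsilon,\delta}]}{\log(1/\delta)}\le T_{\epsilon_0,\beta}(\mu)\,D_{\epsilon,\epsilon_0}(\mu)\quad(\beta\in(0,1)),$$ where $D_{\epsilon,\epsilon_0}(\mu)=\Big(1+\max_{i\ne i^\star}\frac{\epsilon_0-\epsilon}{\mu_\star-\mu_i+\epsilon}\Big)^2$. 3. In particular, if $\epsilon=\epsilon_0$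 and $\nu_i=\mathcal N(\mu_i,1)$ for all $i$, with a unique best arm, then the algorithm is asymptotically optimal with IDS proportions, i.e. $\limsup_{\delta\to0}\mathbb E_\nu[\tau_{\epsilon_0,\delta}]/\log(1/\delta)\le T_{\epsilon_0}(\mu)$, and asymptotically $\beta$-optimal with fixed proportions $\beta\in(0,1)$, i.e. $\limsup_{\delta\to0}\mathbb E_\nu[\tau_{\epsilon_0,\delta}]/\log(1/\delta)\le T_{\epsilon_0,\beta}(\mu)$. -/

import Mathlib

open MeasureTheory ProbabilityTheory Filter Topology
open scoped ENNReal

universe u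

noncomputable section

namespace EBTC

/-! ### Bandit instances and characteristic times -/

/-- A real probability distribution is 1-sub-Gaussian: its moment generating function, centred at
the mean, is finite and at most `exp (l ^ 2 / 2)` for every real `l`. -/
def IsOneSubGaussian (ν₀ : Measure ℝ) : Prop :=
  IsProbabilityMeasure ν₀ ∧ HasSubgaussianMGF (fun x => x - ∫ y, y ∂ν₀) 1 ν₀

/-- The vector of means of a bandit instance. -/
def means {K : ℕ} (ν : Fin K → Measure ℝ) (i : Fin K) : ℝ := ∫ x, x ∂(ν i)

/-- The largest mean. -/
def bestMean {K : ℕ} (μ : Fin K → ℝ) : ℝ := ⨆ i, μ i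

/-- The set of `ε`-good arms. -/
def goodArms {K : ℕ} (ε : ℝ) (μ : Fin K → ℝ) : Set (Fin K) := {i | bestMean μ - ε ≤ μ i}

/-- The set of best arms. -/
def bestArms {K : ℕ} (μ : Fin K → ℝ) : Set (Fin K) := goodArms 0 μ

/-- `T_{ε,β}(μ, i)`. It is computed in `[0, ∞]`, so that `1 / 0 = ∞`: an allocation with
`w j = 0` for some `j ≠ i` has value `0`, and the time is `∞` when the maximum vanishes. -/
def charTimeArm {K : ℕ} (ε β : ℝ) (μ : Fin K → ℝ) (i : Fin K) : ℝ≥0∞ :=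
  (⨆ w ∈ {w : Fin K → ℝ | w ∈ stdSimplex ℝ (Fin K) ∧ w i = β},
    ⨅ j ∈ {j : Fin K | j ≠ i},
      (1 / 2) * (ENNReal.ofReal ((μ i - μ j + ε) ^ 2) /
        (1 / ENNReal.ofReal β + 1 / ENNReal.ofReal (w j))))⁻¹

/-- `T_{ε,β}(μ)`, the minimum of `T_{ε,β}(μ, i)` over the `ε`-good arms `i`. -/
def charTimeBeta {K : ℕ} (ε β : ℝ) (μ : Fin K → ℝ) : ℝ≥0∞ :=
  ⨅ i ∈ goodArms ε μ, charTimeArm ε β μ i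

/-- `T_ε(μ)`, the minimum of `T_{ε,β}(μ, i)` over the `ε`-good arms `i` and `β ∈ (0, 1)`. -/
def charTime {K : ℕ} (ε : ℝ) (μ : Fin K → ℝ) : ℝ≥0∞ :=
  ⨅ i ∈ goodArms ε μ, ⨅ β ∈ Set.Ioo (0 : ℝ) 1, charTimeArm ε β μ i

/-- `D_{ε,ε₀}(μ)`, for an instance whose unique best arm is `iStar`. -/
def slackFactor {K : ℕ} (ε ε₀ : ℝ) (μ : Fin K → ℝ) (iStar : Fin K) : ℝ :=
  (1 + ⨆ i : {i : Fin K // i ≠ iStar}, (ε₀ - ε) / (bestMean μ - μ i + ε)) ^ 2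

/-! ### The stopping threshold -/

/-- The function `g_G`. For a real number `s > 1`, `ζ(s)` is a positive real number. -/
def gaussG (l : ℝ) : ℝ :=
  2 * l - 2 * l * Real.log (4 * l) + Real.log (riemannZeta ((2 * l : ℝ) : ℂ)).re
    - 1 / 2 * Real.log (1 - l)

/-- The function `C_G(x) = min_{1/2 < l ≤ 1} (g_G(l) + x) / l`. The end point `l = 1`, where `g_G`
is `+∞`, is left out because `Real.log 0 = 0`. -/
def gaussC (x : ℝ) : ℝ := ⨅ l : Set.Ioo (1 / 2 : ℝ) 1, (gaussG l + x) / l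

/-- The threshold `c(n, δ)` for `K` arms. -/
def threshold (K : ℕ) (n : ℝ) (δ : ℝ) : ℝ :=
  2 * gaussC (Real.log (((K : ℝ) - 1) / δ) / 2) + 4 * Real.log (4 + Real.log (n / 2))

/-! ### Trajectories and the EB-TC algorithm

Rounds are numbered `1, 2, 3, …`; the values at round `0` play no role. -/

/-- A trajectory of a top two algorithm: in round `n`, the leader `B n` (which is also the arm
recommended before round `n`), the challenger `C n`, the sampled arm `I n` and the observation
`X n`. Leaders and challengers only matter in rounds `n > K`. -/
structure Trajectory (K : ℕ) where
  B : ℕ → Fin K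
  C : ℕ → Fin K
  I : ℕ → Fin K
  X : ℕ → ℝ

/-- How the target proportions are set: a fixed `β`, or information-directed selection. -/
inductive Proportions where
  | fixed (β : ℝ)
  | ids

namespace Trajectory

variable {K : ℕ} (p : Trajectory K)

/-- `N_{n,i}`: number of pulls of arm `i` before round `n`. -/
def pulls (n : ℕ) (i : Fin K) : ℕ := {t ∈ Finset.Ico 1 n | p.I t = i}.card

/-- `μ_{n,i}`: empirical mean of arm `i` before round `n`. -/
def empMean (n : ℕ) (i : Fin K) : ℝ :=
  (∑ t ∈ Finset.Ico 1 n with p.I t = i, p.X t) / p.pulls n i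

/-- The rounds before `n`, after the initialization, in which the leader/challenger pair is
`(i, j)`. -/
def pairRounds (n : ℕ) (i j : Fin K) : Finset ℕ :=
  {t ∈ Finset.Ico (K + 1) n | p.B t = i ∧ p.C t = j}

/-- `T_n(i, j)`. -/
def pairCount (n : ℕ) (i j : Fin K) : ℕ := (p.pairRounds n i j).card

/-- `N^i_{n,j}`: number of pulls of the challenger `j` in the rounds before `n` in which the
leader/challenger pair is `(i, j)`. -/
def challengerPulls (n : ℕ) (i j : Fin K) : ℕ := {t ∈ p.pairRounds n i j | p.I t = j}.card

/-- The averaged target proportion `\bar β_n(i, j)` of pulls of the leader `i`. -/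
def avgProportion (n : ℕ) (i j : Fin K) : Proportions → ℝ
  | .fixed β => β
  | .ids => (∑ t ∈ p.pairRounds n i j,
      (p.pulls t j : ℝ) / ((p.pulls t i : ℝ) + (p.pulls t j : ℝ))) / p.pairCount n i j

/-- The empirical transportation cost, with slack `ε`, between arms `i` and `j` before round `n`. -/
def transportCost (ε : ℝ) (n : ℕ) (i j : Fin K) : ℝ :=
  (p.empMean n i - p.empMean n j + ε) / √(1 / (p.pulls n i : ℝ) + 1 / (p.pulls n j : ℝ))

/-- `p` follows the EB-TC algorithm with slack `ε₀`: each arm is sampled once in the first `K`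
rounds; in every later round the leader maximizes the empirical mean, the challenger minimizes the
transportation cost among the other arms (ties are broken arbitrarily in both cases), and the
tracking procedure of the pair chooses between them. -/
structure FollowsEBTC (ε₀ : ℝ) (rule : Proportions) : Prop where
  init : ∀ i, p.pulls (K + 1) i = 1
  leader : ∀ n > K, ∀ i, p.empMean n i ≤ p.empMean n (p.B n)
  challenger_ne : ∀ n > K, p.C n ≠ p.B n
  challenger : ∀ n > K, ∀ i ≠ p.B n,
    p.transportCost ε₀ n (p.B n) (p.C n) ≤ p.transportCost ε₀ n (p.B n) i
  arm : ∀ n > K, p.I n =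
    if (p.challengerPulls n (p.B n) (p.C n) : ℝ) ≤
        (1 - p.avgProportion (n + 1) (p.B n) (p.C n) rule) * p.pairCount (n + 1) (p.B n) (p.C n)
    then p.C n else p.B n

/-- The condition tested by the GLR stopping rule at time `n`. -/
def GLRCondition (ε δ : ℝ) (n : ℕ) : Prop :=
  K < n ∧ ∀ i ≠ p.B n, √(2 * threshold K ((n : ℝ) - 1) δ) ≤ p.transportCost ε n (p.B n) i

/-- The GLR stopping time `τ_{ε,δ}`, the first `n` at which the condition holds (`⊤` if none). -/
def glrTime (ε δ : ℝ) : ℕ∞ := ⨅ n ∈ {n : ℕ | p.GLRCondition ε δ n}, (n : ℕ∞)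

end Trajectory

/-- The trajectories that the EB-TC algorithm may generate. -/
def ebtc (K : ℕ) (ε₀ : ℝ) (rule : Proportions) : Set (Trajectory K) :=
  {p | p.FollowsEBTC ε₀ rule}

/-! ### Interaction with a bandit instance -/

/-- `p` is a random trajectory of a learner facing the bandit instance `ν`: `ℱ n` is the
information available before round `n` (the history, and possibly the randomness used for breaking
ties), on which the decisions of round `n` are based, and given `ℱ n` the observation of round `n`
has law `ν_{I_n}`. -/
structure IsInteraction {Ω : Type*} [mΩ : MeasurableSpace Ω] {K : ℕ} (P : Measure Ω)
    (ν : Fin K → Measure ℝ) (ℱ : Filtration ℕ mΩ) (p : Ω → Trajectory K) : Prop where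
  leader_meas : ∀ n > K, Measurable[ℱ n] fun ω => (p ω).B n
  challenger_meas : ∀ n > K, Measurable[ℱ n] fun ω => (p ω).C n
  arm_meas : ∀ n ≥ 1, Measurable[ℱ n] fun ω => (p ω).I n
  obs_meas : ∀ n ≥ 1, Measurable[ℱ (n + 1)] fun ω => (p ω).X n
  cond_law : ∀ n ≥ 1, ∀ s : Set ℝ, MeasurableSet s →
    P⟦(fun ω => (p ω).X n) ⁻¹' s | ℱ n⟧ =ᵐ[P] fun ω => (ν ((p ω).I n)).real s

/-- The algorithm generating the trajectories in `A`, stopped at `τ`, is `(ε, δ)`-PAC for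
1-sub-Gaussian arms: on every instance, the probability that it stops and that the arm recommended
at the stopping time is not `ε`-good is at most `δ`. -/
def IsPAC {K : ℕ} (A : Set (Trajectory K)) (τ : Trajectory K → ℕ∞) (ε δ : ℝ) : Prop :=
  ∀ (ν : Fin K → Measure ℝ), (∀ i, IsOneSubGaussian (ν i)) →
  ∀ (Ω : Type u) [mΩ : MeasurableSpace Ω] (P : Measure Ω) [IsProbabilityMeasure P]
    (ℱ : Filtration ℕ mΩ) (p : Ω → Trajectory K),
    IsInteraction P ν ℱ p → (∀ ω, p ω ∈ A) →
    P {ω | ∃ n : ℕ, τ (p ω) = n ∧ (p ω).B n ∉ goodArms ε (means ν)} ≤ ENNReal.ofReal δ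

/-- On the instance `ν`, the algorithm generating the trajectories in `A`, stopped at `τ δ`,
satisfies `limsup_{δ → 0} E[τ δ] / log (1 / δ) ≤ b`. All quantities are in `[0, ∞]`. -/
def AsymptoticBound {K : ℕ} (A : Set (Trajectory K)) (τ : ℝ → Trajectory K → ℕ∞)
    (ν : Fin K → Measure ℝ) (b : ℝ≥0∞) : Prop :=
  ∀ (Ω : Type u) [mΩ : MeasurableSpace Ω] (P : Measure Ω) [IsProbabilityMeasure P]
    (ℱ : Filtration ℕ mΩ) (p : Ω → Trajectory K),
    IsInteraction P ν ℱ p → (∀ ω, p ω ∈ A) →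
    limsup (fun δ : ℝ => (∫⁻ ω, (τ δ (p ω) : ℝ≥0∞) ∂P) / ENNReal.ofReal (Real.log (1 / δ)))
      (𝓝[>] 0) ≤ b

/-- The Gaussian instance with means `μ` and unit variances. -/
def gaussianInstance {K : ℕ} (μ : Fin K → ℝ) (i : Fin K) : Measure ℝ := gaussianReal (μ i) 1

/-- Asymptotic optimality for `ε`-best-arm identification on the Gaussian instance with means `μ`. -/
def AsymptoticallyOptimal {K : ℕ} (A : Set (Trajectory K)) (τ : ℝ → Trajectory K → ℕ∞) (ε : ℝ)
    (μ : Fin K → ℝ) : Prop :=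
  AsymptoticBound.{u} A τ (gaussianInstance μ) (charTime ε μ)

/-- Asymptotic `β`-optimality for `ε`-best-arm identification on the Gaussian instance with means
`μ`. -/
def AsymptoticallyBetaOptimal {K : ℕ} (A : Set (Trajectory K)) (τ : ℝ → Trajectory K → ℕ∞)
    (ε β : ℝ) (μ : Fin K → ℝ) : Prop :=
  AsymptoticBound.{u} A τ (gaussianInstance μ) (charTimeBeta ε β μ)

end EBTC

end

/-!
The proof has a probabilistic and a deterministic half.

*Deviations.* For sub-Gaussian arms, `exp (x S - x² N / 2)` is a supermartingale for each arm and
each real `x`, where `S` is the centred sum of the `N` observations of the arm. Mixing over `x` with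
a countable mixture of centred Gaussian priors, whose variances form a geometric grid
(`exists_mixture_prior`), and multiplying the mixtures of two arms, Ville's inequality (`ville`)
gives a bound on the sum of the self-normalized deviations of the two arms that is uniform in time
(`IsInteraction.pair_deviation`). The mixture is designed so that its cost is exactly `gaussG`, and
optimizing the parameter gives `gaussC`. If the rule stops and recommends an arm that is not
`ε`-good, then the deviations of that arm and of a best arm exceed this bound, so a union bound over
the other arms shows that the rule is PAC (`isPAC_glrTime`).

*Trajectories.* Let all self-normalized deviations before round `n` be at most `n ^ (1 / 8)`. Up to
a constant, the challenger minimizes `min (N_B, N_i)`, because the slack `ε₀` bounds its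
transportation cost from below; hence in every round the leader or the challenger is among the least
sampled arms, and since the tracking procedure serves both arms of a pair, every arm is sampled
often (`FollowsEBTC.le_pulls`). So from round `√n` on the empirical means are accurate and the
leader is the best arm `s`. Then tracking keeps a balance: `(1 - β) N_s = β ∑ N_j` for fixed
proportions and `N_s² = ∑ N_j²` for IDS, up to lower order terms (`FollowsEBTC.abs_balance_le`);
the latter is the discrete form of the conservation law `N_s dN_s = ∑ N_j dN_j`. If some ratio
`N_k / N_s` were beyond its optimal value at time `n`, then, when `k` was last the challenger, its
minimal transportation cost would put every ratio beyond its optimal value, which contradicts the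
balance (`eventually_pulls_le`). Hence the allocation converges to the one that equalizes the costs
and satisfies the balance equation (`eventually_ratio_mem`), and no allocation has a larger value:
for IDS, the balance equation is the first order condition for the optimal `β`
(`IsOptimalRatio.exists_cost_le_ids`).

*Conclusion.* The GLR rule therefore stops at the latest at the first `n` beyond a multiple of
`log (1 / δ)` at which the trajectory is concentrated, and the probabilities that it is not are
summable in `n`, with a sum that does not depend on `δ` (`limsup_lintegral_glrTime_le`).
-/

namespace EBTC

/-! ### A mixture of centred Gaussian priors -/

/-- The exponential `exp (x S - x² N / 2)` integrated against a centred Gaussian prior on `x`. -/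
lemma lintegral_exp_gaussianReal {v : NNReal} (hv : v ≠ 0) {N : ℝ} (hN : 0 ≤ N) (S : ℝ) :
    ∫⁻ x, ENNReal.ofReal (Real.exp (x * S - x ^ 2 * N / 2)) ∂(gaussianReal 0 v) =
      ENNReal.ofReal ((√(1 + v * N))⁻¹ * Real.exp (v * S ^ 2 / (2 * (1 + v * N)))) := by
  have hv0 : (0 : ℝ) < v := by positivity
  have h1 : (0 : ℝ) < 1 + v * N := by positivity
  set v' : NNReal := ⟨v / (1 + v * N), by positivity⟩ with hv'
  have hv'c : (v' : ℝ) = v / (1 + v * N) := rfl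
  have hv'0 : v' ≠ 0 := by
    have : (0 : ℝ) < v' := by rw [hv'c]; positivity
    exact_mod_cast this.ne'
  rw [gaussianReal_of_var_ne_zero 0 hv,
    lintegral_withDensity_eq_lintegral_mul _ (measurable_gaussianPDF 0 v) (by fun_prop)]
  have key : ∀ x : ℝ, (gaussianPDF 0 v * fun x => ENNReal.ofReal
      (Real.exp (x * S - x ^ 2 * N / 2))) x =
      ENNReal.ofReal ((√(1 + v * N))⁻¹ * Real.exp (v * S ^ 2 / (2 * (1 + v * N)))) *
        gaussianPDF (v' * S) v' x := by
    intro x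
    simp only [Pi.mul_apply, gaussianPDF]
    rw [← ENNReal.ofReal_mul (gaussianPDFReal_nonneg _ _ _), ← ENNReal.ofReal_mul (by positivity)]
    congr 1
    simp only [gaussianPDFReal_def]
    rw [mul_assoc, ← Real.exp_add, mul_mul_mul_comm, ← Real.exp_add]
    congr 1
    · rw [hv'c, mul_div_assoc', Real.sqrt_div (by positivity)]
      have : (√(1 + v * N)) ≠ 0 := by positivity
      field_simp
    · congr 1
      rw [hv'c]
      field_simp
      ring
  rw [lintegral_congr key, lintegral_const_mul _ (measurable_gaussianPDF _ _),
    lintegral_gaussianPDF_eq_one _ hv'0, mul_one]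

lemma summable_zeta_real {s : ℝ} (hs : 1 < s) :
    Summable fun n : ℕ => 1 / ((n : ℝ) + 1) ^ s := by
  have := (summable_nat_add_iff (f := fun n : ℕ => 1 / (n : ℝ) ^ s) 1).2
    (Real.summable_one_div_nat_rpow.2 hs)
  simpa using this

lemma riemannZeta_re_eq_tsum {s : ℝ} (hs : 1 < s) :
    (riemannZeta ((s : ℝ) : ℂ)).re = ∑' n : ℕ, 1 / ((n : ℝ) + 1) ^ s := by
  rw [zeta_eq_tsum_one_div_nat_add_one_cpow (by simpa using hs)]
  have : ∀ n : ℕ, 1 / ((n : ℂ) + 1) ^ (s : ℂ) = ((1 / ((n : ℝ) + 1) ^ s : ℝ) : ℂ) := by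
    intro n
    push_cast
    rw [Complex.ofReal_cpow (by positivity)]
    push_cast
    rfl
  simp_rw [this]
  rw [← Complex.ofReal_tsum, Complex.ofReal_re]

lemma one_le_riemannZeta_re {s : ℝ} (hs : 1 < s) : 1 ≤ (riemannZeta ((s : ℝ) : ℂ)).re := by
  rw [riemannZeta_re_eq_tsum hs]
  have := (summable_zeta_real hs).le_tsum 0 (fun n _ => by positivity)
  simpa using this

/-- The prior behind `gaussG`. It mixes the laws `N(0, σ_k²)`, `k ≥ 0`, with weights proportional
to `(k + 1) ^ (-2l)`, where `σ_k² exp (4lk) = l / (1 - l)`: the `k`-th component is efficient for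
sample sizes between `exp (4lk)` and `exp (4l(k+1))`. The ratio `exp (4l)` of the grid is the one
that minimizes the total loss. -/
lemma exists_mixture_prior {l : ℝ} (hl : l ∈ Set.Ioo (1 / 2 : ℝ) 1) :
    ∃ γ : Measure ℝ, IsProbabilityMeasure γ ∧ ∀ N S : ℝ, 1 ≤ N →
      ENNReal.ofReal (Real.exp
        (l * (S ^ 2 / (2 * N) - 2 * Real.log (4 + Real.log N)) - gaussG l)) ≤
      ∫⁻ x, ENNReal.ofReal (Real.exp (x * S - x ^ 2 * N / 2)) ∂γ := by
  obtain ⟨hl1, hl2⟩ := hl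
  have hl0 : 0 < l := by linarith
  have hs : 1 < 2 * l := by linarith
  set z := (riemannZeta ((2 * l : ℝ) : ℂ)).re with hz
  have hz1 : 1 ≤ z := one_le_riemannZeta_re hs
  have hz0 : 0 < z := by linarith
  set w : ℕ → ℝ := fun k => 1 / ((k : ℝ) + 1) ^ (2 * l) / z with hw
  have hwpos : ∀ k, 0 < w k := fun k => by simp only [hw]; positivity
  have hwsum : Summable w := (summable_zeta_real hs).div_const z
  have hwone : ∑' k, w k = 1 := by
    simp only [hw]
    rw [tsum_div_const, ← riemannZeta_re_eq_tsum hs, div_self hz0.ne']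
  set v : ℕ → NNReal := fun k => ⟨l / (1 - l) * Real.exp (-(4 * l * k)), by
    have : 0 < 1 - l := by linarith
    positivity⟩ with hv
  have hvc : ∀ k, (v k : ℝ) = l / (1 - l) * Real.exp (-(4 * l * k)) := fun k => rfl
  have h1l : 0 < 1 - l := by linarith
  have hv0 : ∀ k, v k ≠ 0 := fun k => by
    have : (0 : ℝ) < v k := by rw [hvc]; positivity
    exact_mod_cast this.ne'
  refine ⟨Measure.sum fun k => ENNReal.ofReal (w k) • gaussianReal 0 (v k), ⟨?_⟩, ?_⟩
  · rw [Measure.sum_apply _ MeasurableSet.univ]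
    simp only [Measure.smul_apply, measure_univ, smul_eq_mul, mul_one]
    rw [← ENNReal.ofReal_tsum_of_nonneg (fun k => (hwpos k).le) hwsum, hwone, ENNReal.ofReal_one]
  · intro N S hN
    have hlogN : 0 ≤ Real.log N := Real.log_nonneg hN
    have hN0 : 0 < N := by linarith
    set k := ⌊Real.log N / (4 * l)⌋₊ with hk
    have hk1 : (k : ℝ) * (4 * l) ≤ Real.log N := by
      have := Nat.floor_le (show 0 ≤ Real.log N / (4 * l) by positivity)
      rwa [le_div_iff₀ (by positivity)] at this
    have hk2 : Real.log N < (k + 1 : ℝ) * (4 * l) := by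
      have := Nat.lt_floor_add_one (Real.log N / (4 * l))
      rwa [div_lt_iff₀ (by positivity)] at this
    refine le_trans ?_ (lintegral_mono' (Measure.le_sum _ k) le_rfl)
    rw [lintegral_smul_measure, lintegral_exp_gaussianReal (hv0 k) hN0.le, smul_eq_mul,
      ← ENNReal.ofReal_mul (hwpos k).le]
    refine ENNReal.ofReal_le_ofReal ?_
    -- the matched size of the component is at most `N`, and at least `N / exp (4l)`
    have hvN : (v k : ℝ) * N = l / (1 - l) * Real.exp (Real.log N - 4 * l * k) := by
      rw [hvc, Real.exp_sub, Real.exp_log hN0, Real.exp_neg]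
      field_simp
    have hlow : l / (1 - l) ≤ v k * N := by
      rw [hvN]
      refine le_mul_of_one_le_right (by positivity) (Real.one_le_exp (by linarith))
    have hhigh : 1 + v k * N ≤ Real.exp (4 * l) / (1 - l) := by
      have h1 : Real.exp (Real.log N - 4 * l * k) ≤ Real.exp (4 * l) :=
        Real.exp_le_exp.2 (by linarith)
      have h2 : 1 ≤ Real.exp (4 * l) := Real.one_le_exp (by positivity)
      rw [hvN, le_div_iff₀ h1l]
      have : (1 + l / (1 - l) * Real.exp (Real.log N - 4 * l * k)) * (1 - l) =
          (1 - l) + l * Real.exp (Real.log N - 4 * l * k) := by field_simp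
      rw [this]
      nlinarith
    have hpos : 0 < 1 + (v k : ℝ) * N := by positivity
    have hquad : l * (S ^ 2 / (2 * N)) ≤ v k * S ^ 2 / (2 * (1 + v k * N)) := by
      rw [div_le_iff₀ h1l] at hlow
      have : (v k : ℝ) * S ^ 2 / (2 * (1 + v k * N)) =
          (v k * N) / (1 + v k * N) * (S ^ 2 / (2 * N)) := by field_simp
      rw [this]
      refine mul_le_mul_of_nonneg_right ?_ (by positivity)
      rw [le_div_iff₀ hpos]
      linarith
    have hsqrt : Real.exp (-(2 * l) + Real.log (1 - l) / 2) ≤ (√(1 + v k * N))⁻¹ := by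
      rw [Real.sqrt_eq_rpow, ← Real.rpow_neg hpos.le, Real.rpow_def_of_pos hpos]
      refine Real.exp_le_exp.2 ?_
      have := Real.log_le_log hpos hhigh
      rw [Real.log_div (Real.exp_pos _).ne' h1l.ne', Real.log_exp] at this
      linarith
    have hwk : Real.exp (-(2 * l) * (Real.log (4 + Real.log N) - Real.log (4 * l)) - Real.log z)
        ≤ w k := by
      have hk0 : (0 : ℝ) < (k : ℝ) + 1 := by positivity
      have hwe : w k = Real.exp (-(2 * l) * Real.log ((k : ℝ) + 1) - Real.log z) := by
        simp only [hw]
        rw [Real.exp_sub, Real.exp_log hz0, Real.rpow_def_of_pos hk0, one_div, ← Real.exp_neg]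
        ring_nf
      rw [hwe, ← Real.log_div (by positivity) (by positivity)]
      refine Real.exp_le_exp.2 ?_
      have : Real.log ((k : ℝ) + 1) ≤ Real.log ((4 + Real.log N) / (4 * l)) := by
        refine Real.log_le_log hk0 ?_
        rw [le_div_iff₀ (by positivity)]
        nlinarith
      nlinarith
    have hfinal : l * (S ^ 2 / (2 * N) - 2 * Real.log (4 + Real.log N)) - gaussG l =
        (-(2 * l) * (Real.log (4 + Real.log N) - Real.log (4 * l)) - Real.log z) +
        ((-(2 * l) + Real.log (1 - l) / 2) + l * (S ^ 2 / (2 * N))) := by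
      simp only [gaussG, ← hz]
      ring
    rw [hfinal, Real.exp_add, Real.exp_add]
    gcongr

/-! ### Ville's inequality -/

/-- Ville's inequality for a nonnegative supermartingale started at time `1`; the supermartingale
property is stated in integrated form. -/
lemma ville {Ω : Type*} {mΩ : MeasurableSpace Ω} {P : Measure Ω} {ℱ : Filtration ℕ mΩ}
    {M : ℕ → Ω → ℝ≥0∞} (hM : ∀ n ≥ 1, Measurable[ℱ n] (M n))
    (hsup : ∀ n ≥ 1, ∀ A, MeasurableSet[ℱ n] A → ∫⁻ ω in A, M (n + 1) ω ∂P ≤ ∫⁻ ω in A, M n ω ∂P)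
    (c : ℝ≥0∞) : c * P {ω | ∃ n ≥ 1, c ≤ M n ω} ≤ ∫⁻ ω, M 1 ω ∂P := by
  let A : ℕ → Set Ω := fun n => {ω | ∀ k ≥ 1, k < n → M k ω < c}
  have hA : ∀ n ≥ 1, MeasurableSet[ℱ n] (A n) := by
    intro n _
    have : A n = ⋂ k, ⋂ (_ : k ≥ 1), ⋂ (_ : k < n), {ω | M k ω < c} := by
      ext ω; simp [A]
    rw [this]
    refine MeasurableSet.iInter fun k => MeasurableSet.iInter fun hk => MeasurableSet.iInter
      fun hkn => ?_
    exact ℱ.mono hkn.le _ (measurableSet_lt (hM k hk) measurable_const)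
  have key : ∀ n ≥ 1, c * P {ω | ∃ k ≥ 1, k < n ∧ c ≤ M k ω} + ∫⁻ ω in A n, M n ω ∂P ≤
      ∫⁻ ω, M 1 ω ∂P := by
    intro n hn
    induction n, hn using Nat.le_induction with
    | base =>
      have h1 : {ω : Ω | ∃ k ≥ 1, k < 1 ∧ c ≤ M k ω} = ∅ := by
        ext ω; simp only [Set.mem_ofPred_eq, Set.mem_empty_iff_false, iff_false]
        rintro ⟨k, h1, h2, _⟩; omega
      rw [h1]
      simpa using setLIntegral_le_lintegral (μ := P) (A 1) (M 1)
    | succ n hn ih =>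
      refine le_trans ?_ ih
      have hmeas : MeasurableSet[ℱ n] {ω | c ≤ M n ω} := measurableSet_le measurable_const (hM n hn)
      have hsplit := lintegral_inter_add_sdiff (μ := P) (M n) (A n) (ℱ.le n _ hmeas)
      have hAsucc : A n \ {ω | c ≤ M n ω} = A (n + 1) := by
        ext ω
        simp only [A, Set.mem_sdiff, Set.mem_ofPred_eq, not_le]
        refine ⟨fun ⟨h1, h2⟩ k hk hkn => ?_, fun h => ⟨fun k hk hkn => h k hk (by omega),
          h n hn (by omega)⟩⟩
        rcases Nat.lt_succ_iff_lt_or_eq.1 hkn with h | rfl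
        exacts [h1 k hk h, h2]
      have hcov : {ω | ∃ k ≥ 1, k < n + 1 ∧ c ≤ M k ω} ⊆
          {ω | ∃ k ≥ 1, k < n ∧ c ≤ M k ω} ∪ (A n ∩ {ω | c ≤ M n ω}) := by
        rintro ω ⟨k, hk, hkn, h⟩
        by_cases h' : ∃ k ≥ 1, k < n ∧ c ≤ M k ω
        · exact Or.inl h'
        · push Not at h'
          have : k = n := by
            by_contra hne
            exact absurd h (not_le.2 (h' k hk (by omega)))
          subst this
          exact Or.inr ⟨h', h⟩
      have hcheb : c * P (A n ∩ {ω | c ≤ M n ω}) ≤ ∫⁻ ω in A n ∩ {ω | c ≤ M n ω}, M n ω ∂P := by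
        rw [← setLIntegral_const]
        exact setLIntegral_mono' ((ℱ.le n _ (hA n hn)).inter (ℱ.le n _ hmeas)) fun ω hω => hω.2
      have hstep := hsup n hn (A (n + 1)) (hAsucc ▸ (hA n hn).diff hmeas)
      calc c * P {ω | ∃ k ≥ 1, k < n + 1 ∧ c ≤ M k ω} + ∫⁻ ω in A (n + 1), M (n + 1) ω ∂P
          ≤ (c * P {ω | ∃ k ≥ 1, k < n ∧ c ≤ M k ω} + c * P (A n ∩ {ω | c ≤ M n ω})) +
            ∫⁻ ω in A (n + 1), M n ω ∂P := by
            refine add_le_add ?_ hstep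
            rw [← mul_add]
            gcongr
            exact (measure_mono hcov).trans (measure_union_le _ _)
        _ ≤ c * P {ω | ∃ k ≥ 1, k < n ∧ c ≤ M k ω} + ∫⁻ ω in A n, M n ω ∂P := by
            rw [← hsplit, hAsucc, add_assoc]
            gcongr
  have hunion : {ω | ∃ n ≥ 1, c ≤ M n ω} = ⋃ n, {ω | ∃ k ≥ 1, k < n ∧ c ≤ M k ω} := by
    ext ω
    simp only [Set.mem_ofPred_eq, Set.mem_iUnion]
    exact ⟨fun ⟨k, h1, h2⟩ => ⟨k + 1, k, h1, by omega, h2⟩, fun ⟨_, k, h1, _, h2⟩ => ⟨k, h1, h2⟩⟩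
  have hmono : Monotone fun n => {ω | ∃ k ≥ 1, k < n ∧ c ≤ M k ω} := by
    intro a b hab ω ⟨k, h1, h2, h3⟩
    exact ⟨k, h1, h2.trans_le hab, h3⟩
  rw [hunion, hmono.measure_iUnion, ENNReal.mul_iSup]
  refine iSup_le fun n => ?_
  rcases Nat.eq_zero_or_pos n with rfl | hn
  · simp
  · exact le_self_add.trans (key n hn)

/-! ### Exponential supermartingales of the interaction -/

section Interaction

variable {Ω : Type*} {mΩ : MeasurableSpace Ω} {K : ℕ} {P : Measure Ω}
  {ν : Fin K → Measure ℝ} {ℱ : Filtration ℕ mΩ} {p : Ω → Trajectory K}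

/-- On an event of `ℱ n` that fixes the arm of round `n`, the observation of that round is
independent of the past, with the law of the arm. -/
lemma IsInteraction.lintegral_mul_obs [IsProbabilityMeasure P] (h : IsInteraction P ν ℱ p)
    (hν : ∀ i, IsProbabilityMeasure (ν i)) {n : ℕ} (hn : 1 ≤ n)
    {i : Fin K} {B : Set Ω} (hB : MeasurableSet[ℱ n] B) (hBi : ∀ ω ∈ B, (p ω).I n = i)
    {G : Ω → ℝ≥0∞} (hG : Measurable[ℱ n] G) {φ : ℝ → ℝ≥0∞} (hφ : Measurable φ) :
    ∫⁻ ω in B, G ω * φ ((p ω).X n) ∂P = (∫⁻ ω in B, G ω ∂P) * ∫⁻ x, φ x ∂(ν i) := by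
  have hX : Measurable fun ω => (p ω).X n := (h.obs_meas n hn).mono (ℱ.le _) le_rfl
  have hφX : Measurable fun ω => φ ((p ω).X n) := hφ.comp hX
  have hmap : ∀ A, MeasurableSet[ℱ n] A → (∀ ω ∈ A, (p ω).I n = i) →
      (P.restrict A).map (fun ω => (p ω).X n) = P A • ν i := by
    intro A hA hAi
    ext s hs
    have hA' := ℱ.le n _ hA
    rw [Measure.map_apply hX hs, Measure.restrict_apply (hX hs), Measure.smul_apply, smul_eq_mul]
    have hint := setIntegral_condExp (μ := P) (ℱ.le n) (f := ((fun ω => (p ω).X n) ⁻¹' s).indicator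
      (fun _ => (1 : ℝ))) ((integrable_const 1).indicator (hX hs)) hA
    have hcond : ∫ ω in A, (P⟦(fun ω => (p ω).X n) ⁻¹' s | ℱ n⟧) ω ∂P =
        ∫ ω in A, (ν i).real s ∂P := by
      refine setIntegral_congr_ae hA' ?_
      filter_upwards [h.cond_law n hn s hs] with ω hω hωA
      rw [hω, hAi ω hωA]
    rw [hcond, setIntegral_const, setIntegral_indicator (hX hs), setIntegral_const, smul_eq_mul,
      smul_eq_mul, mul_one] at hint
    rw [← ENNReal.toReal_eq_toReal_iff' (measure_ne_top _ _)
      (ENNReal.mul_ne_top (measure_ne_top _ _) (measure_ne_top _ _)), ENNReal.toReal_mul,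
      Set.inter_comm]
    exact hint.symm
  refine @Measurable.ennreal_induction Ω (ℱ n) (fun G => ∫⁻ ω in B, G ω * φ ((p ω).X n) ∂P =
    (∫⁻ ω in B, G ω ∂P) * ∫⁻ x, φ x ∂(ν i)) ?_ ?_ ?_ G hG
  · intro c s hs
    have h1 : (fun ω => s.indicator (fun _ => c) ω * φ ((p ω).X n)) =
        s.indicator fun ω => c * φ ((p ω).X n) := by
      ext ω; by_cases hω : ω ∈ s <;> simp [hω]
    have hs' := ℱ.le n _ hs
    rw [h1, lintegral_indicator hs', lintegral_indicator hs', Measure.restrict_restrict hs',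
      lintegral_const_mul _ hφX, setLIntegral_const]
    have := hmap (s ∩ B) (hs.inter hB) fun ω hω => hBi ω hω.2
    rw [← lintegral_map hφ hX, this, lintegral_smul_measure, smul_eq_mul, mul_assoc]
  · intro f g _ hf hg ihf ihg
    have hf' := hf.mono (ℱ.le n) le_rfl
    have hg' := hg.mono (ℱ.le n) le_rfl
    simp only [Pi.add_apply, add_mul]
    rw [lintegral_add_left (f := fun ω => f ω * φ ((p ω).X n)) (hf'.mul hφX),
      lintegral_add_left hf', ihf, ihg, add_mul]
  · intro f hf hmono ih
    have hf' := fun k => (hf k).mono (ℱ.le n) le_rfl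
    simp only [ENNReal.iSup_mul]
    rw [lintegral_iSup (f := fun k ω => f k ω * φ ((p ω).X n)) (fun k => (hf' k).mul hφX), lintegral_iSup hf' hmono, ENNReal.iSup_mul]
    · simp only [ih]
    · intro a b hab ω
      exact mul_le_mul_left (hmono hab ω) _

/-- The exponential supermartingale with exponent `θ i` on arm `i`. -/
noncomputable def expMart (μ θ : Fin K → ℝ) (q : Trajectory K) (n : ℕ) : ℝ≥0∞ :=
  ENNReal.ofReal (Real.exp (∑ t ∈ Finset.Ico 1 n,
    (θ (q.I t) * (q.X t - μ (q.I t)) - θ (q.I t) ^ 2 / 2)))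

lemma IsInteraction.measurable_arm_comp (h : IsInteraction P ν ℱ p) {n t : ℕ} (ht : 1 ≤ t)
    (htn : t < n) {β : Type*} [MeasurableSpace β] (f : Fin K → β) :
    Measurable[ℱ n] fun ω => f ((p ω).I t) :=
  (measurable_of_finite f).comp ((h.arm_meas t ht).mono (ℱ.mono htn.le) le_rfl)

lemma IsInteraction.measurable_obs (h : IsInteraction P ν ℱ p) {n t : ℕ} (ht : 1 ≤ t)
    (htn : t < n) : Measurable[ℱ n] fun ω => (p ω).X t :=
  (h.obs_meas t ht).mono (ℱ.mono htn) le_rfl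

/-- Joint measurability of the exponential process in the parameter and the outcome. -/
lemma IsInteraction.measurable_expMart (h : IsInteraction P ν ℱ p) {Θ : Type*}
    [MeasurableSpace Θ] {θ : Θ → Fin K → ℝ} (hθ : Measurable θ) (μ : Fin K → ℝ) (n : ℕ) :
    Measurable[(ℱ n).prod inferInstance] fun x : Ω × Θ => expMart μ (θ x.2) (p x.1) n := by
  let _ : MeasurableSpace Ω := ℱ n
  unfold expMart
  refine ENNReal.measurable_ofReal.comp (Real.measurable_exp.comp ?_)
  refine Finset.measurable_sum _ fun t ht => ?_
  rw [Finset.mem_Ico] at ht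
  have hI : Measurable fun ω => (p ω).I t := h.measurable_arm_comp ht.1 ht.2 id
  have hX : Measurable fun ω => (p ω).X t := h.measurable_obs ht.1 ht.2
  have hμ : Measurable fun ω => μ ((p ω).I t) := h.measurable_arm_comp ht.1 ht.2 μ
  have hev : Measurable fun y : (Fin K → ℝ) × Fin K => y.1 y.2 :=
    measurable_from_prod_countable_left fun i => measurable_pi_apply i
  have hθI : Measurable fun x : Ω × Θ => θ x.2 ((p x.1).I t) :=
    hev.comp ((hθ.comp measurable_snd).prodMk (hI.comp measurable_fst))
  exact (hθI.mul ((hX.comp measurable_fst).sub (hμ.comp measurable_fst))).sub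
    ((hθI.pow_const 2).div_const 2)

lemma IsInteraction.measurable_expMart_const (h : IsInteraction P ν ℱ p) (θ μ : Fin K → ℝ)
    (n : ℕ) : Measurable[ℱ n] fun ω => expMart μ θ (p ω) n := by
  have hj := h.measurable_expMart (Θ := Unit) (θ := fun _ => θ) measurable_const μ n
  let _ : MeasurableSpace Ω := ℱ n
  exact Measurable.of_uncurry_right (f := fun ω (_ : Unit) => expMart μ θ (p ω) n) hj (y := ())

lemma lintegral_exp_le_one {ν₀ : Measure ℝ} (h : IsOneSubGaussian ν₀) (x : ℝ) :
    ∫⁻ y, ENNReal.ofReal (Real.exp (x * (y - ∫ z, z ∂ν₀) - x ^ 2 / 2)) ∂ν₀ ≤ 1 := by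
  have h1 := h.2.integrable_exp_mul x
  have h2 := h.2.mgf_le x
  have h3 : ∀ y : ℝ, Real.exp (x * (y - ∫ z, z ∂ν₀) - x ^ 2 / 2) =
      Real.exp (x * (y - ∫ z, z ∂ν₀)) * Real.exp (-(x ^ 2 / 2)) := fun y => by
    rw [← Real.exp_add, sub_eq_add_neg]
  rw [← ofReal_integral_eq_lintegral_ofReal (by simpa only [h3] using h1.mul_const _)
    (ae_of_all _ fun y => (Real.exp_pos _).le)]
  rw [← ENNReal.ofReal_one]
  refine ENNReal.ofReal_le_ofReal ?_
  simp only [h3]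
  rw [integral_mul_const]
  simp only [mgf] at h2
  calc _ ≤ Real.exp ((1 : NNReal) * x ^ 2 / 2) * Real.exp (-(x ^ 2 / 2)) := by gcongr
    _ = 1 := by rw [← Real.exp_add]; simp

lemma IsInteraction.expMart_step [IsProbabilityMeasure P] (h : IsInteraction P ν ℱ p)
    (hν : ∀ i, IsOneSubGaussian (ν i)) (θ : Fin K → ℝ) {n : ℕ} (hn : 1 ≤ n)
    {A : Set Ω} (hA : MeasurableSet[ℱ n] A) :
    ∫⁻ ω in A, expMart (means ν) θ (p ω) (n + 1) ∂P ≤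
      ∫⁻ ω in A, expMart (means ν) θ (p ω) n ∂P := by
  have hIn : Measurable[ℱ n] fun ω => (p ω).I n := h.arm_meas n hn
  have hpart : A = ⋃ i, A ∩ {ω | (p ω).I n = i} := by
    ext ω; simp
  have hBm : ∀ i, MeasurableSet[ℱ n] (A ∩ {ω | (p ω).I n = i}) := fun i =>
    hA.inter (hIn (measurableSet_singleton i))
  have hdisj : Pairwise (Function.onFun Disjoint fun i => A ∩ {ω | (p ω).I n = i}) := by
    intro i j hij
    refine Set.disjoint_left.2 fun ω h1 h2 => hij (h1.2.symm.trans h2.2)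
  rw [hpart, lintegral_iUnion (fun i => ℱ.le n _ (hBm i)) hdisj,
    lintegral_iUnion (fun i => ℱ.le n _ (hBm i)) hdisj]
  refine ENNReal.tsum_le_tsum fun i => ?_
  have hsucc : ∀ ω ∈ A ∩ {ω | (p ω).I n = i}, expMart (means ν) θ (p ω) (n + 1) =
      expMart (means ν) θ (p ω) n *
        ENNReal.ofReal (Real.exp (θ i * ((p ω).X n - means ν i) - θ i ^ 2 / 2)) := by
    rintro ω ⟨_, hω⟩
    simp only [Set.mem_ofPred_eq] at hω
    unfold expMart
    rw [Finset.sum_Ico_succ_top hn, Real.exp_add, ENNReal.ofReal_mul (Real.exp_pos _).le, hω]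
  rw [setLIntegral_congr_fun (ℱ.le n _ (hBm i)) hsucc]
  have hG : Measurable[ℱ n] fun ω => expMart (means ν) θ (p ω) n :=
    h.measurable_expMart_const θ (means ν) n
  rw [h.lintegral_mul_obs (fun i => (hν i).1) hn (hBm i) (fun ω hω => hω.2) hG
    (φ := fun x => ENNReal.ofReal (Real.exp (θ i * (x - means ν i) - θ i ^ 2 / 2)))
    (by fun_prop)]
  exact mul_le_of_le_one_right' (lintegral_exp_le_one (hν i) (θ i))

/-- Ville's inequality for a mixture of exponential supermartingales. -/
lemma IsInteraction.ville_mixture [IsProbabilityMeasure P] (h : IsInteraction P ν ℱ p)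
    (hν : ∀ i, IsOneSubGaussian (ν i)) {Θ : Type*} [MeasurableSpace Θ] (π : Measure Θ)
    [IsProbabilityMeasure π] {θ : Θ → Fin K → ℝ} (hθ : Measurable θ) (c : ℝ≥0∞) :
    c * P {ω | ∃ n ≥ 1, c ≤ ∫⁻ a, expMart (means ν) (θ a) (p ω) n ∂π} ≤ 1 := by
  refine (ville (ℱ := ℱ) (M := fun n ω => ∫⁻ a, expMart (means ν) (θ a) (p ω) n ∂π)
    (fun n hn => ?_) (fun n hn A hA => ?_) c).trans ?_
  · have hj := h.measurable_expMart hθ (means ν) n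
    let _ : MeasurableSpace Ω := ℱ n
    exact hj.lintegral_prod_right'
  · have hm : ∀ n, Measurable fun x : Ω × Θ => expMart (means ν) (θ x.2) (p x.1) n := fun n =>
      (h.measurable_expMart hθ (means ν) n).mono
        (sup_le_sup (MeasurableSpace.comap_mono (ℱ.le n)) le_rfl) le_rfl
    rw [lintegral_lintegral_swap (f := fun ω a => expMart (means ν) (θ a) (p ω) (n + 1))
        (hm _).aemeasurable,
      lintegral_lintegral_swap (f := fun ω a => expMart (means ν) (θ a) (p ω) n)
        (hm _).aemeasurable]
    exact lintegral_mono fun a => h.expMart_step hν (θ a) hn hA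
  · simp [expMart]

end Interaction

/-! ### Counts along a trajectory -/

namespace Trajectory

variable {K : ℕ} (p : Trajectory K)

lemma pulls_mono (i : Fin K) : Monotone fun n => p.pulls n i := fun _ _ hab =>
  Finset.card_le_card (Finset.filter_subset_filter _ (Finset.Ico_subset_Ico_right hab))

lemma pulls_succ {n : ℕ} (hn : 1 ≤ n) (i : Fin K) :
    p.pulls (n + 1) i = p.pulls n i + if p.I n = i then 1 else 0 := by
  unfold pulls
  rw [← Finset.insert_Ico_right_eq_Ico_add_one hn, Finset.filter_insert]
  split_ifs with h
  · rw [Finset.card_insert_of_notMem (by simp)]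
  · rfl

lemma sum_pulls (n : ℕ) : ∑ i, p.pulls n i = n - 1 := by
  unfold pulls
  rw [← Finset.card_eq_sum_card_fiberwise (f := p.I) (t := Finset.univ) (by simp [Set.MapsTo])]
  simp

lemma pulls_add_pulls_le (n : ℕ) {i j : Fin K} (hij : i ≠ j) :
    p.pulls n i + p.pulls n j ≤ n - 1 := by
  rw [← p.sum_pulls n, ← Finset.sum_pair (f := p.pulls n) hij]
  exact Finset.sum_le_sum_of_subset (Finset.subset_univ _)

lemma pulls_le (n : ℕ) (i : Fin K) : p.pulls n i ≤ n - 1 := by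
  rw [← p.sum_pulls n]
  exact Finset.single_le_sum (f := p.pulls n) (fun _ _ => Nat.zero_le _) (Finset.mem_univ i)

variable {p}

lemma FollowsEBTC.one_le_pulls {ε₀ : ℝ} {rule : Proportions} (h : p.FollowsEBTC ε₀ rule) {n : ℕ}
    (hn : K < n) (i : Fin K) : 1 ≤ p.pulls n i :=
  (h.init i).symm.le.trans (p.pulls_mono i hn)

lemma glrCondition_of_glrTime_eq {ε δ : ℝ} {n : ℕ} (h : p.glrTime ε δ = n) :
    p.GLRCondition ε δ n := by
  unfold glrTime at h
  by_cases hne : {n : ℕ | p.GLRCondition ε δ n}.Nonempty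
  · have hmem := Nat.sInf_mem hne
    have : (⨅ n ∈ {n : ℕ | p.GLRCondition ε δ n}, (n : ℕ∞)) =
        (sInf {n : ℕ | p.GLRCondition ε δ n} : ℕ) :=
      le_antisymm (iInf₂_le _ hmem)
        (le_iInf₂ fun k hk => Nat.cast_le.2 (Nat.sInf_le hk))
    rw [this, Nat.cast_inj] at h
    exact h ▸ hmem
  · rw [Set.not_nonempty_iff_eq_empty] at hne
    simp [hne] at h

variable (p)

/-- The self-normalized deviation `N (μ̂ - μ)² / 2` of an arm. -/
noncomputable def selfNorm (μ : Fin K → ℝ) (n : ℕ) (i : Fin K) : ℝ :=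
  p.pulls n i * (p.empMean n i - μ i) ^ 2 / 2

lemma selfNorm_nonneg (μ : Fin K → ℝ) (n : ℕ) (i : Fin K) : 0 ≤ p.selfNorm μ n i := by
  unfold selfNorm; positivity

lemma selfNorm_eq (μ : Fin K → ℝ) {n : ℕ} {i : Fin K} (h : 1 ≤ p.pulls n i) :
    p.selfNorm μ n i =
      (∑ t ∈ Finset.Ico 1 n with p.I t = i, (p.X t - μ i)) ^ 2 / (2 * p.pulls n i) := by
  have h0 : (p.pulls n i : ℝ) ≠ 0 := by positivity
  rw [Finset.sum_sub_distrib, Finset.sum_const, nsmul_eq_mul]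
  change _ = ((∑ t ∈ Finset.Ico 1 n with p.I t = i, p.X t) - (p.pulls n i : ℝ) * μ i) ^ 2 / _
  unfold selfNorm empMean
  field_simp

end Trajectory

lemma expMart_eq {K : ℕ} (μ θ : Fin K → ℝ) (q : Trajectory K) (n : ℕ) :
    expMart μ θ q n = ENNReal.ofReal (Real.exp (∑ i,
      (θ i * (∑ t ∈ Finset.Ico 1 n with q.I t = i, (q.X t - μ i)) -
        θ i ^ 2 * q.pulls n i / 2))) := by
  unfold expMart
  rw [← Finset.sum_fiberwise (Finset.Ico 1 n) q.I fun t =>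
    θ (q.I t) * (q.X t - μ (q.I t)) - θ (q.I t) ^ 2 / 2]
  congr 2
  refine Finset.sum_congr rfl fun i _ => ?_
  rw [Finset.sum_congr rfl (g := fun t => θ i * (q.X t - μ i) - θ i ^ 2 / 2)
    (fun t ht => by rw [(Finset.mem_filter.1 ht).2]), Finset.sum_sub_distrib, ← Finset.mul_sum,
    Finset.sum_const, nsmul_eq_mul]
  unfold Trajectory.pulls
  ring

/-! ### Time-uniform deviations of two arms -/

section Deviations

variable {Ω : Type*} {mΩ : MeasurableSpace Ω} {K : ℕ} {P : Measure Ω} [IsProbabilityMeasure P]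
  {ν : Fin K → Measure ℝ} {ℱ : Filtration ℕ mΩ} {p : Ω → Trajectory K}

/-- Time-uniform deviation inequality for two arms, at a fixed value `l` of the parameter over
which `gaussC` is an infimum. -/
lemma IsInteraction.pair_deviation (h : IsInteraction P ν ℱ p)
    (hν : ∀ i, IsOneSubGaussian (ν i)) {i j : Fin K} (hij : i ≠ j) {l : ℝ}
    (hl : l ∈ Set.Ioo (1 / 2 : ℝ) 1) (x : ℝ) :
    P {ω | ∃ n ≥ 1, 1 ≤ (p ω).pulls n i ∧ 1 ≤ (p ω).pulls n j ∧
      2 * Real.log (4 + Real.log ((p ω).pulls n i)) +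
        2 * Real.log (4 + Real.log ((p ω).pulls n j)) + (2 * gaussG l + x) / l ≤
      (p ω).selfNorm (means ν) n i + (p ω).selfNorm (means ν) n j} ≤
    ENNReal.ofReal (Real.exp (-x)) := by
  obtain ⟨γ, hγ, hγle⟩ := exists_mixture_prior hl
  have hl0 : 0 < l := by linarith [hl.1]
  set θ : ℝ × ℝ → Fin K → ℝ := fun a k => if k = i then a.1 else if k = j then a.2 else 0 with hθ
  have hθm : Measurable θ := by
    refine measurable_pi_lambda _ fun k => ?_
    simp only [hθ]
    split_ifs <;> fun_prop
  have hV := h.ville_mixture hν (γ.prod γ) hθm (ENNReal.ofReal (Real.exp x))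
  have hsub : {ω | ∃ n ≥ 1, 1 ≤ (p ω).pulls n i ∧ 1 ≤ (p ω).pulls n j ∧
      2 * Real.log (4 + Real.log ((p ω).pulls n i)) +
        2 * Real.log (4 + Real.log ((p ω).pulls n j)) + (2 * gaussG l + x) / l ≤
      (p ω).selfNorm (means ν) n i + (p ω).selfNorm (means ν) n j} ⊆
      {ω | ∃ n ≥ 1, ENNReal.ofReal (Real.exp x) ≤
        ∫⁻ a, expMart (means ν) (θ a) (p ω) n ∂(γ.prod γ)} := by
    rintro ω ⟨n, hn, hi, hj, hle⟩
    refine ⟨n, hn, ?_⟩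
    set Ni : ℝ := ((p ω).pulls n i : ℝ) with hNi
    set Nj : ℝ := ((p ω).pulls n j : ℝ) with hNj
    have hNi1 : 1 ≤ Ni := by rw [hNi]; exact_mod_cast hi
    have hNj1 : 1 ≤ Nj := by rw [hNj]; exact_mod_cast hj
    set Si := ∑ t ∈ Finset.Ico 1 n with (p ω).I t = i, ((p ω).X t - means ν i) with hSi
    set Sj := ∑ t ∈ Finset.Ico 1 n with (p ω).I t = j, ((p ω).X t - means ν j) with hSj
    have hprod : ∀ a : ℝ × ℝ, expMart (means ν) (θ a) (p ω) n =
        ENNReal.ofReal (Real.exp (a.1 * Si - a.1 ^ 2 * Ni / 2)) *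
          ENNReal.ofReal (Real.exp (a.2 * Sj - a.2 ^ 2 * Nj / 2)) := by
      intro a
      rw [expMart_eq, ← ENNReal.ofReal_mul (Real.exp_pos _).le, ← Real.exp_add,
        Finset.sum_eq_add i j hij]
      · simp [hθ, hij.symm, hSi, hSj, hNi, hNj]
      · rintro k - ⟨hki, hkj⟩
        simp [hθ, hki, hkj]
      · simp
      · simp
    simp only [hprod]
    rw [lintegral_prod_mul
      (f := fun y : ℝ => ENNReal.ofReal (Real.exp (y * Si - y ^ 2 * Ni / 2)))
      (g := fun y : ℝ => ENNReal.ofReal (Real.exp (y * Sj - y ^ 2 * Nj / 2)))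
      (by fun_prop) (by fun_prop)]
    refine le_trans ?_ (mul_le_mul' (hγle Ni Si hNi1) (hγle Nj Sj hNj1))
    rw [← ENNReal.ofReal_mul (Real.exp_pos _).le, ← Real.exp_add]
    refine ENNReal.ofReal_le_ofReal (Real.exp_le_exp.2 ?_)
    rw [(p ω).selfNorm_eq _ hi, (p ω).selfNorm_eq _ hj, ← hNi, ← hNj, ← hSi, ← hSj] at hle
    have h2 := mul_le_mul_of_nonneg_left hle hl0.le
    have h3 : l * ((2 * gaussG l + x) / l) = 2 * gaussG l + x := mul_div_cancel₀ _ hl0.ne'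
    nlinarith
  have hexp : ENNReal.ofReal (Real.exp (-x)) * ENNReal.ofReal (Real.exp x) = 1 := by
    rw [← ENNReal.ofReal_mul (Real.exp_pos _).le, ← Real.exp_add]; simp
  calc _ ≤ P {ω | ∃ n ≥ 1, ENNReal.ofReal (Real.exp x) ≤
        ∫⁻ a, expMart (means ν) (θ a) (p ω) n ∂(γ.prod γ)} := measure_mono hsub
    _ = ENNReal.ofReal (Real.exp (-x)) * (ENNReal.ofReal (Real.exp x) *
        P {ω | ∃ n ≥ 1, ENNReal.ofReal (Real.exp x) ≤
        ∫⁻ a, expMart (means ν) (θ a) (p ω) n ∂(γ.prod γ)}) := by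
      rw [← mul_assoc, hexp, one_mul]
    _ ≤ _ := mul_le_of_le_one_right' hV

/-- The deviation inequality with the threshold `gaussC`. The inequality defining the event is
strict, so that the infimum in `gaussC` need not be attained: the event is an increasing union of
events to which `pair_deviation` applies. -/
lemma IsInteraction.pair_deviation_gaussC (h : IsInteraction P ν ℱ p)
    (hν : ∀ i, IsOneSubGaussian (ν i)) {i j : Fin K} (hij : i ≠ j) (x : ℝ) :
    P {ω | ∃ n ≥ 1, 1 ≤ (p ω).pulls n i ∧ 1 ≤ (p ω).pulls n j ∧
      2 * Real.log (4 + Real.log ((p ω).pulls n i)) +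
        2 * Real.log (4 + Real.log ((p ω).pulls n j)) + 2 * gaussC (x / 2) <
      (p ω).selfNorm (means ν) n i + (p ω).selfNorm (means ν) n j} ≤
    ENNReal.ofReal (Real.exp (-x)) := by
  set U : ℕ → Set Ω := fun k => {ω | ∃ n ≥ 1, 1 ≤ (p ω).pulls n i ∧ 1 ≤ (p ω).pulls n j ∧
      2 * Real.log (4 + Real.log ((p ω).pulls n i)) +
        2 * Real.log (4 + Real.log ((p ω).pulls n j)) + 2 * (gaussC (x / 2) + 1 / (k + 1 : ℝ)) ≤
      (p ω).selfNorm (means ν) n i + (p ω).selfNorm (means ν) n j} with hU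
  have hmono : Monotone U := by
    rintro a b hab ω ⟨n, h1, h2, h3, h4⟩
    refine ⟨n, h1, h2, h3, le_trans ?_ h4⟩
    have := Nat.one_div_le_one_div (α := ℝ) hab
    linarith
  have hsub : {ω | ∃ n ≥ 1, 1 ≤ (p ω).pulls n i ∧ 1 ≤ (p ω).pulls n j ∧
      2 * Real.log (4 + Real.log ((p ω).pulls n i)) +
        2 * Real.log (4 + Real.log ((p ω).pulls n j)) + 2 * gaussC (x / 2) <
      (p ω).selfNorm (means ν) n i + (p ω).selfNorm (means ν) n j} ⊆ ⋃ k, U k := by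
    rintro ω ⟨n, h1, h2, h3, h4⟩
    obtain ⟨k, hk⟩ := exists_nat_one_div_lt (half_pos (sub_pos.2 h4))
    exact Set.mem_iUnion.2 ⟨k, n, h1, h2, h3, by linarith⟩
  refine (measure_mono hsub).trans ?_
  rw [hmono.measure_iUnion]
  refine iSup_le fun k => ?_
  have : Nonempty (Set.Ioo (1 / 2 : ℝ) 1) := ⟨⟨3 / 4, by norm_num, by norm_num⟩⟩
  obtain ⟨⟨l, hl⟩, hlk⟩ := exists_lt_of_ciInf_lt
    (show gaussC (x / 2) < gaussC (x / 2) + 1 / (k + 1 : ℝ) from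
      lt_add_of_pos_right _ (by positivity))
  refine le_trans (measure_mono ?_) (h.pair_deviation hν hij hl x)
  rintro ω ⟨n, h1, h2, h3, h4⟩
  refine ⟨n, h1, h2, h3, le_trans ?_ h4⟩
  have : (2 * gaussG l + x) / l = 2 * ((gaussG l + x / 2) / l) := by ring
  rw [this]
  simp only at hlk
  linarith

end Deviations

/-! ### Correctness of the stopping rule -/

lemma two_log_four_add_log_le {a b m : ℝ} (ha : 1 ≤ a) (hb : 1 ≤ b) (hab : a + b ≤ m) :
    2 * Real.log (4 + Real.log a) + 2 * Real.log (4 + Real.log b) ≤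
      4 * Real.log (4 + Real.log (m / 2)) := by
  have hla := Real.log_nonneg ha
  have hlb := Real.log_nonneg hb
  have h1 : Real.log a + Real.log b ≤ 2 * Real.log (m / 2) := by
    rw [← Real.log_mul (by positivity) (by positivity), ← Real.log_rpow (by linarith)]
    refine Real.log_le_log (by positivity) ?_
    norm_num
    nlinarith [sq_nonneg (a - b)]
  have h2 : Real.log (4 + Real.log a) + Real.log (4 + Real.log b) ≤
      2 * Real.log (4 + Real.log (m / 2)) := by
    rw [← Real.log_mul (by positivity) (by positivity), ← Real.log_rpow (by linarith)]
    refine Real.log_le_log (by positivity) ?_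
    norm_num
    nlinarith [sq_nonneg (Real.log a - Real.log b)]
  linarith

lemma sq_sub_div_le {a b x y : ℝ} (ha : 0 < a) (hb : 0 < b) :
    (x - y) ^ 2 / (1 / a + 1 / b) ≤ a * x ^ 2 + b * y ^ 2 := by
  rw [div_le_iff₀ (by positivity)]
  have : (a * x ^ 2 + b * y ^ 2) * (1 / a + 1 / b) - (x - y) ^ 2 = (a * x + b * y) ^ 2 / (a * b) := by
    field_simp
    ring
  have h2 : 0 ≤ (a * x + b * y) ^ 2 / (a * b) := by positivity
  linarith

lemma exists_eq_bestMean {K : ℕ} (hK : 2 ≤ K) (μ : Fin K → ℝ) : ∃ i, μ i = bestMean μ := by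
  have : Nonempty (Fin K) := ⟨⟨0, by omega⟩⟩
  exact exists_eq_ciSup_of_finite

/-- The GLR stopping rule is PAC for any EB-TC trajectories: an error at time `n` forces a large
joint deviation of the recommended arm and of a best arm. -/
theorem isPAC_glrTime {K : ℕ} (hK : 2 ≤ K) {ε ε₀ δ : ℝ} (hε : 0 ≤ ε) (hδ : 0 < δ)
    (rule : Proportions) : IsPAC.{u} (ebtc K ε₀ rule) (fun p => p.glrTime ε δ) ε δ := by
  intro ν hν Ω mΩ P _ ℱ p h hA
  obtain ⟨s, hs⟩ := exists_eq_bestMean hK (means ν)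
  have hK1 : (0 : ℝ) < (K : ℝ) - 1 := by
    have : (2 : ℝ) ≤ K := by exact_mod_cast hK
    linarith
  set x := Real.log (((K : ℝ) - 1) / δ) with hx
  set U : Fin K → Set Ω := fun i => {ω | ∃ n ≥ 1, 1 ≤ (p ω).pulls n i ∧ 1 ≤ (p ω).pulls n s ∧
      2 * Real.log (4 + Real.log ((p ω).pulls n i)) +
        2 * Real.log (4 + Real.log ((p ω).pulls n s)) + 2 * gaussC (x / 2) <
      (p ω).selfNorm (means ν) n i + (p ω).selfNorm (means ν) n s} with hU
  have hsub : {ω | ∃ n : ℕ, (p ω).glrTime ε δ = n ∧ (p ω).B n ∉ goodArms ε (means ν)} ⊆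
      ⋃ i ∈ Finset.univ.erase s, U i := by
    rintro ω ⟨n, hτ, hB⟩
    obtain ⟨hn, hglr⟩ := Trajectory.glrCondition_of_glrTime_eq hτ
    set i := (p ω).B n with hi
    have hbad : means ν i < means ν s - ε := by
      rw [hs]
      exact not_le.1 hB
    have his : i ≠ s := by
      intro hc; rw [hc] at hbad; linarith
    have hNi := (hA ω).one_le_pulls hn i
    have hNs := (hA ω).one_le_pulls hn s
    refine Set.mem_biUnion (x := i) (by simp [his]) ⟨n, by omega, hNi, hNs, ?_⟩
    have hZ := hglr s his.symm
    have hNi' : (1 : ℝ) ≤ (p ω).pulls n i := by exact_mod_cast hNi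
    have hNs' : (1 : ℝ) ≤ (p ω).pulls n s := by exact_mod_cast hNs
    have hsum : ((p ω).pulls n i : ℝ) + (p ω).pulls n s ≤ (n : ℝ) - 1 := by
      have h1 := (p ω).pulls_add_pulls_le n his
      have h2 : (p ω).pulls n i + (p ω).pulls n s + 1 ≤ n := by omega
      have h3 : ((p ω).pulls n i : ℝ) + (p ω).pulls n s + 1 ≤ n := by exact_mod_cast h2
      linarith
    set y := (p ω).empMean n i - means ν i with hy
    set z := (p ω).empMean n s - means ν s with hz
    have hden : 0 < √(1 / ((p ω).pulls n i : ℝ) + 1 / ((p ω).pulls n s : ℝ)) := by positivity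
    have hlt : √(2 * threshold K ((n : ℝ) - 1) δ) <
        (y - z) / √(1 / ((p ω).pulls n i : ℝ) + 1 / ((p ω).pulls n s : ℝ)) := by
      refine hZ.trans_lt ?_
      unfold Trajectory.transportCost
      rw [div_lt_div_iff_of_pos_right hden]
      linarith
    have hlt2 := Real.lt_sq_of_sqrt_lt hlt
    rw [div_pow, Real.sq_sqrt (by positivity)] at hlt2
    have hcs := sq_sub_div_le (x := y) (y := z) (show (0 : ℝ) < (p ω).pulls n i by linarith)
      (show (0 : ℝ) < (p ω).pulls n s by linarith)
    have hlog := two_log_four_add_log_le hNi' hNs' hsum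
    have hthr : threshold K ((n : ℝ) - 1) δ = 2 * gaussC (x / 2) +
        4 * Real.log (4 + Real.log (((n : ℝ) - 1) / 2)) := rfl
    unfold Trajectory.selfNorm
    rw [← hy, ← hz]
    linarith
  calc P {ω | ∃ n : ℕ, (p ω).glrTime ε δ = n ∧ (p ω).B n ∉ goodArms ε (means ν)}
      ≤ ∑ i ∈ Finset.univ.erase s, P (U i) :=
        (measure_mono hsub).trans (measure_biUnion_finset_le _ _)
    _ ≤ ∑ i ∈ Finset.univ.erase s, ENNReal.ofReal (Real.exp (-x)) :=
        Finset.sum_le_sum fun i hi => h.pair_deviation_gaussC hν (Finset.ne_of_mem_erase hi) x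
    _ = ENNReal.ofReal δ := by
        rw [Finset.sum_const, Finset.card_erase_of_mem (Finset.mem_univ s), Finset.card_univ,
          Fintype.card_fin, hx, Real.exp_neg, Real.exp_log (by positivity), nsmul_eq_mul,
          ← ENNReal.ofReal_natCast, ← ENNReal.ofReal_mul (by positivity)]
        congr 1
        rw [Nat.cast_sub (by omega)]
        push_cast
        field_simp

/-! ### The tracking procedure -/

/-- The fixed proportion lies in `(0, 1)`. -/
def Proportions.Valid : Proportions → Prop
  | .fixed β => β ∈ Set.Ioo (0 : ℝ) 1
  | .ids => True

/-- A lower bound on the target rate of the less sampled arm of a leader/challenger pair. -/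
noncomputable def Proportions.minRate : Proportions → ℝ
  | .fixed β => min β (1 - β)
  | .ids => 1 / 2

lemma Proportions.Valid.minRate_pos {rule : Proportions} (h : rule.Valid) : 0 < rule.minRate := by
  cases rule with
  | fixed β => exact lt_min h.1 (sub_pos.2 h.2)
  | ids => norm_num [Proportions.minRate]

lemma Proportions.minRate_le_one {rule : Proportions} (h : rule.Valid) : rule.minRate ≤ 1 := by
  cases rule with
  | fixed β => exact (min_le_left _ _).trans h.2.le
  | ids => norm_num [Proportions.minRate]

namespace Trajectory

variable {K : ℕ} (p : Trajectory K) (rule : Proportions)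

/-- The target rate, in round `t`, at which the challenger `j` of the leader `i` is pulled. -/
noncomputable def rate (t : ℕ) (i j : Fin K) : ℝ :=
  match rule with
  | .fixed β => 1 - β
  | .ids => (p.pulls t i : ℝ) / ((p.pulls t i : ℝ) + (p.pulls t j : ℝ))

/-- The number of pulls of the challenger in the rounds of a pair, minus its target. -/
noncomputable def trackingError (n : ℕ) (i j : Fin K) : ℝ :=
  p.challengerPulls n i j - ∑ t ∈ p.pairRounds n i j, p.rate rule t i j

lemma mem_pairRounds {n t : ℕ} {i j : Fin K} :
    t ∈ p.pairRounds n i j ↔ (K < t ∧ t < n) ∧ p.B t = i ∧ p.C t = j := by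
  simp [pairRounds]

lemma pairRounds_succ_of_eq {n : ℕ} (hn : K < n) {i j : Fin K} (h : p.B n = i ∧ p.C n = j) :
    p.pairRounds (n + 1) i j = insert n (p.pairRounds n i j) := by
  ext t
  simp only [mem_pairRounds, Finset.mem_insert]
  constructor
  · rintro ⟨⟨h1, h2⟩, h3⟩
    rcases Nat.lt_succ_iff_lt_or_eq.1 h2 with h4 | h4
    exacts [Or.inr ⟨⟨h1, h4⟩, h3⟩, Or.inl h4]
  · rintro (rfl | ⟨⟨h1, h2⟩, h3⟩)
    exacts [⟨⟨hn, by omega⟩, h⟩, ⟨⟨h1, by omega⟩, h3⟩]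

lemma pairRounds_succ_of_ne {n : ℕ} {i j : Fin K} (h : ¬(p.B n = i ∧ p.C n = j)) :
    p.pairRounds (n + 1) i j = p.pairRounds n i j := by
  ext t
  simp only [mem_pairRounds]
  constructor
  · rintro ⟨⟨h1, h2⟩, h3⟩
    rcases Nat.lt_succ_iff_lt_or_eq.1 h2 with h4 | rfl
    exacts [⟨⟨h1, h4⟩, h3⟩, absurd h3 h]
  · rintro ⟨⟨h1, h2⟩, h3⟩
    exact ⟨⟨h1, by omega⟩, h3⟩

lemma pairRounds_init (i j : Fin K) : p.pairRounds (K + 1) i j = ∅ := by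
  simp [pairRounds]

lemma notMem_pairRounds (n : ℕ) (i j : Fin K) : n ∉ p.pairRounds n i j := by
  simp [mem_pairRounds]

lemma challengerPulls_succ_of_eq {n : ℕ} (hn : K < n) {i j : Fin K} (h : p.B n = i ∧ p.C n = j) :
    p.challengerPulls (n + 1) i j = p.challengerPulls n i j + if p.I n = j then 1 else 0 := by
  unfold challengerPulls
  rw [p.pairRounds_succ_of_eq hn h, Finset.filter_insert]
  split_ifs
  · rw [Finset.card_insert_of_notMem]
    exact fun hc => p.notMem_pairRounds n i j (Finset.mem_of_mem_filter _ hc)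
  · rfl

lemma challengerPulls_le (n : ℕ) (i j : Fin K) :
    p.challengerPulls n i j ≤ p.pulls n j := by
  refine Finset.card_le_card fun t ht => ?_
  simp only [Finset.mem_filter, mem_pairRounds, Finset.mem_Ico] at ht ⊢
  exact ⟨⟨by omega, ht.1.1.2⟩, ht.2⟩

lemma trackingError_init (i j : Fin K) : p.trackingError rule (K + 1) i j = 0 := by
  simp [trackingError, challengerPulls, pairRounds_init]

lemma trackingError_succ_of_eq {n : ℕ} (hn : K < n) {i j : Fin K} (h : p.B n = i ∧ p.C n = j) :
    p.trackingError rule (n + 1) i j = p.trackingError rule n i j +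
      ((if p.I n = j then 1 else 0) - p.rate rule n i j) := by
  unfold trackingError
  rw [p.challengerPulls_succ_of_eq hn h, p.pairRounds_succ_of_eq hn h,
    Finset.sum_insert (p.notMem_pairRounds n i j)]
  push_cast
  ring

lemma trackingError_succ_of_ne {n : ℕ} {i j : Fin K} (h : ¬(p.B n = i ∧ p.C n = j)) :
    p.trackingError rule (n + 1) i j = p.trackingError rule n i j := by
  unfold trackingError challengerPulls
  rw [p.pairRounds_succ_of_ne h]

variable {p rule}

lemma rate_mem (hv : rule.Valid) (t : ℕ) (i j : Fin K) : p.rate rule t i j ∈ Set.Icc (0 : ℝ) 1 := by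
  cases rule with
  | fixed β => exact ⟨sub_nonneg.2 hv.2.le, sub_le_self _ hv.1.le⟩
  | ids => exact ⟨by unfold rate; positivity, div_le_one_of_le₀ (by simp) (by positivity)⟩

section Follows

variable {ε₀ : ℝ} (h : p.FollowsEBTC ε₀ rule)
include h

lemma FollowsEBTC.one_sub_avgProportion_mul (n : ℕ) (i j : Fin K) :
    (1 - p.avgProportion n i j rule) * p.pairCount n i j =
      ∑ t ∈ p.pairRounds n i j, p.rate rule t i j := by
  cases rule with
  | fixed β =>
    simp only [avgProportion, rate, pairCount, Finset.sum_const, nsmul_eq_mul]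
    exact mul_comm _ _
  | ids =>
    unfold avgProportion
    rw [sub_mul, one_mul]
    have hdiv : (∑ t ∈ p.pairRounds n i j, (p.pulls t j : ℝ) /
        ((p.pulls t i : ℝ) + (p.pulls t j : ℝ))) / p.pairCount n i j * p.pairCount n i j =
        ∑ t ∈ p.pairRounds n i j, (p.pulls t j : ℝ) /
        ((p.pulls t i : ℝ) + (p.pulls t j : ℝ)) := by
      rcases Nat.eq_zero_or_pos (p.pairCount n i j) with h0 | h0
      · have : p.pairRounds n i j = ∅ := Finset.card_eq_zero.1 h0
        simp [this]
      · exact div_mul_cancel₀ _ (by positivity)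
    rw [hdiv, pairCount, Finset.card_eq_sum_ones, Nat.cast_sum, ← Finset.sum_sub_distrib]
    refine Finset.sum_congr rfl fun t ht => ?_
    have h1 := h.one_le_pulls ((p.mem_pairRounds.1 ht).1.1) i
    have h2 : (1 : ℝ) ≤ p.pulls t i := by exact_mod_cast h1
    unfold rate
    field_simp
    push_cast
    ring

lemma FollowsEBTC.arm_eq {n : ℕ} (hn : K < n) : p.I n =
    if (p.challengerPulls n (p.B n) (p.C n) : ℝ) ≤
      ∑ t ∈ p.pairRounds n (p.B n) (p.C n), p.rate rule t (p.B n) (p.C n) +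
        p.rate rule n (p.B n) (p.C n) then p.C n else p.B n := by
  rw [h.arm n hn, h.one_sub_avgProportion_mul, p.pairRounds_succ_of_eq hn ⟨rfl, rfl⟩,
    Finset.sum_insert (p.notMem_pairRounds n _ _), add_comm]

lemma FollowsEBTC.arm_eq_or {n : ℕ} (hn : K < n) : p.I n = p.C n ∨ p.I n = p.B n := by
  rw [h.arm_eq hn]
  split_ifs <;> simp

/-- The tracking procedure keeps the number of pulls of each challenger within one of its target. -/
lemma FollowsEBTC.trackingError_mem (hv : rule.Valid) {n : ℕ} (hn : K < n) (i j : Fin K) :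
    p.trackingError rule n i j ∈ Set.Icc (0 : ℝ) 1 := by
  induction n, hn using Nat.le_induction with
  | base => rw [p.trackingError_init]; simp
  | succ n hn ih =>
    by_cases hij : p.B n = i ∧ p.C n = j
    · have hr := rate_mem (p := p) hv n i j
      rw [p.trackingError_succ_of_eq rule hn hij]
      have harm := h.arm_eq hn
      have hne := h.challenger_ne n hn
      rw [hij.1, hij.2] at harm hne
      unfold trackingError at ih ⊢
      split_ifs at harm with hc
      · rw [if_pos harm]
        exact ⟨by linarith [ih.1, hr.2], by linarith⟩
      · rw [if_neg (by rw [harm]; exact hne.symm)]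
        exact ⟨by linarith, by linarith [ih.2, hr.1]⟩
    · rwa [p.trackingError_succ_of_ne rule hij]

/-- The rounds of a pair in which the challenger is not pulled are pulls of the leader. -/
lemma FollowsEBTC.pairCount_sub_challengerPulls_le (n : ℕ) (i j : Fin K) :
    p.pairCount n i j ≤ p.challengerPulls n i j + p.pulls n i := by
  unfold pairCount challengerPulls
  rw [← Finset.card_filter_add_card_filter_not (s := p.pairRounds n i j) (fun t => p.I t = j)]
  refine Nat.add_le_add_left (Finset.card_le_card fun t ht => ?_) _
  simp only [Finset.mem_filter, mem_pairRounds, Finset.mem_Ico] at ht ⊢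
  refine ⟨⟨by omega, ht.1.1.2⟩, ?_⟩
  rcases h.arm_eq_or ht.1.1.1 with h1 | h1
  · exact absurd (h1.trans ht.1.2.2) ht.2
  · exact h1.trans ht.1.2.1

lemma FollowsEBTC.minRate_le (hv : rule.Valid) {t : ℕ} (ht : K < t) (i j : Fin K) :
    (p.pulls t i ≤ p.pulls t j → rule.minRate ≤ 1 - p.rate rule t i j) ∧
      (p.pulls t j ≤ p.pulls t i → rule.minRate ≤ p.rate rule t i j) := by
  cases rule with
  | fixed β =>
    simp only [Proportions.minRate, rate]
    exact ⟨fun _ => by linarith [min_le_left β (1 - β)], fun _ => min_le_right _ _⟩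
  | ids =>
    have h1 : (1 : ℝ) ≤ p.pulls t i := by exact_mod_cast h.one_le_pulls ht i
    have h2 : (1 : ℝ) ≤ p.pulls t j := by exact_mod_cast h.one_le_pulls ht j
    simp only [Proportions.minRate, rate]
    constructor <;> intro h3
    · have h4 : (p.pulls t i : ℝ) ≤ p.pulls t j := by exact_mod_cast h3
      rw [le_sub_comm, div_le_iff₀ (by positivity)]
      linarith
    · have h4 : (p.pulls t j : ℝ) ≤ p.pulls t i := by exact_mod_cast h3
      rw [le_div_iff₀ (by positivity)]
      linarith

/-- Both arms of a pair are pulled in proportion to the number of rounds of the pair. In each round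
of the pair the less sampled arm has a target rate at least `minRate`; the rounds in which it is the
leader, and those in which it is the challenger, are counted separately. -/
lemma FollowsEBTC.minRate_mul_pairCount_le (hv : rule.Valid) {n : ℕ} (hn : K < n) (i j : Fin K) :
    rule.minRate * p.pairCount n i j ≤ 2 * p.pulls n i + 2 ∧
      rule.minRate * p.pairCount n i j ≤ 2 * p.pulls n j + 2 := by
  set b := rule.minRate with hb
  have hb0 := hv.minRate_pos
  have hb1 := Proportions.minRate_le_one hv
  rw [← hb] at hb0 hb1
  let TL : ℕ → ℕ := fun m => {t ∈ p.pairRounds m i j | p.pulls t i ≤ p.pulls t j}.card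
  let TR : ℕ → ℕ := fun m => {t ∈ p.pairRounds m i j | ¬ p.pulls t i ≤ p.pulls t j}.card
  have hsum : ∀ m, p.pairCount m i j = TL m + TR m := fun m =>
    (Finset.card_filter_add_card_filter_not _).symm
  have hcard : ∀ (s : Finset ℕ) (q : ℕ → Prop) [DecidablePred q] (g : ℕ → ℝ),
      (∀ t ∈ s, 0 ≤ g t) → (∀ t ∈ s, q t → b ≤ g t) →
      b * ({t ∈ s | q t}.card : ℝ) ≤ ∑ t ∈ s, g t := by
    intro s q _ g h1 h2
    calc b * ({t ∈ s | q t}.card : ℝ) = ∑ t ∈ s with q t, b := by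
          rw [Finset.sum_const, nsmul_eq_mul, mul_comm]
      _ ≤ ∑ t ∈ s with q t, g t := Finset.sum_le_sum fun t ht =>
          h2 t (Finset.mem_of_mem_filter t ht) (Finset.mem_filter.1 ht).2
      _ ≤ ∑ t ∈ s, g t := Finset.sum_le_sum_of_subset_of_nonneg (Finset.filter_subset _ _)
          fun t ht _ => h1 t ht
  have hTL : ∀ m, K < m → b * (TL m : ℝ) ≤ p.pulls m i + 1 := by
    intro m hm
    have h1 := hcard (p.pairRounds m i j) (fun t => p.pulls t i ≤ p.pulls t j)
      (fun t => 1 - p.rate rule t i j) (fun t _ => sub_nonneg.2 (rate_mem hv t i j).2)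
      (fun t ht => (h.minRate_le hv (p.mem_pairRounds.1 ht).1.1 i j).1)
    have h2 := (h.trackingError_mem hv hm i j).2
    have h3 : (p.pairCount m i j : ℝ) ≤ p.challengerPulls m i j + p.pulls m i := by
      exact_mod_cast h.pairCount_sub_challengerPulls_le m i j
    rw [Finset.sum_sub_distrib, Finset.sum_const, nsmul_eq_mul, mul_one] at h1
    unfold trackingError at h2
    unfold pairCount at h3
    simp only [TL]
    linarith
  have hTR : ∀ m, K < m → b * (TR m : ℝ) ≤ p.pulls m j := by
    intro m hm
    have h1 := hcard (p.pairRounds m i j) (fun t => ¬ p.pulls t i ≤ p.pulls t j)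
      (fun t => p.rate rule t i j) (fun t _ => (rate_mem hv t i j).1)
      (fun t ht hq => (h.minRate_le hv (p.mem_pairRounds.1 ht).1.1 i j).2 (not_le.1 hq).le)
    have h2 := (h.trackingError_mem hv hm i j).1
    have h3 : (p.challengerPulls m i j : ℝ) ≤ p.pulls m j := by
      exact_mod_cast p.challengerPulls_le m i j
    unfold trackingError at h2
    simp only [TR]
    linarith
  have hmono : ∀ (m : ℕ) (k : Fin K), (p.pulls m k : ℝ) ≤ p.pulls (m + 1) k := fun m k => by
    exact_mod_cast p.pulls_mono k (Nat.le_succ m)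
  have hcross : b * (TL n : ℝ) ≤ p.pulls n j + 2 ∧ b * (TR n : ℝ) ≤ p.pulls n i + 1 := by
    clear hsum
    induction n, hn using Nat.le_induction with
    | base =>
      simp only [TL, TR, pairRounds_init, Finset.filter_empty, Finset.card_empty]
      constructor <;> · push_cast; nlinarith [Nat.cast_nonneg (α := ℝ) (p.pulls (K + 1) i),
          Nat.cast_nonneg (α := ℝ) (p.pulls (K + 1) j)]
    | succ n hn ih =>
      have hi := hmono n i
      have hj := hmono n j
      by_cases hij : p.B n = i ∧ p.C n = j
      · have hnot : ∀ (q : ℕ → Prop) [DecidablePred q], n ∉ {t ∈ p.pairRounds n i j | q t} :=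
          fun q _ hc => p.notMem_pairRounds n i j (Finset.mem_of_mem_filter _ hc)
        by_cases hle : p.pulls n i ≤ p.pulls n j
        · have hL : TL (n + 1) = TL n + 1 := by
            simp only [TL]
            rw [p.pairRounds_succ_of_eq hn hij, Finset.filter_insert, if_pos hle,
              Finset.card_insert_of_notMem (hnot _)]
          have hR : TR (n + 1) = TR n := by
            simp only [TR]
            rw [p.pairRounds_succ_of_eq hn hij, Finset.filter_insert, if_neg (not_not.2 hle)]
          have hle' : (p.pulls n i : ℝ) ≤ p.pulls n j := by exact_mod_cast hle
          have := hTL n hn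
          rw [hL, hR]
          push_cast
          exact ⟨by linarith, by linarith [ih.2]⟩
        · have hL : TL (n + 1) = TL n := by
            simp only [TL]
            rw [p.pairRounds_succ_of_eq hn hij, Finset.filter_insert, if_neg hle]
          have hR : TR (n + 1) = TR n + 1 := by
            simp only [TR]
            rw [p.pairRounds_succ_of_eq hn hij, Finset.filter_insert, if_pos hle,
              Finset.card_insert_of_notMem (hnot _)]
          have hle' : (p.pulls n j : ℝ) < p.pulls n i := by exact_mod_cast not_le.1 hle
          have := hTR n hn
          rw [hL, hR]
          push_cast
          exact ⟨by linarith [ih.1], by linarith⟩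
      · have hL : TL (n + 1) = TL n := by simp only [TL]; rw [p.pairRounds_succ_of_ne hij]
        have hR : TR (n + 1) = TR n := by simp only [TR]; rw [p.pairRounds_succ_of_ne hij]
        rw [hL, hR]
        exact ⟨by linarith [ih.1], by linarith [ih.2]⟩
  have h1 := hTL n hn
  have h2 := hTR n hn
  rw [hsum n]
  push_cast
  rw [mul_add]
  exact ⟨by linarith [hcross.2], by linarith [hcross.1]⟩

/-! ### Sufficient exploration -/

/-- The choice of the challenger, in terms of squared transportation costs. -/
lemma FollowsEBTC.challenger_sq (hε₀ : 0 < ε₀) {n : ℕ} (hn : K < n) {i : Fin K}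
    (hi : i ≠ p.B n) :
    (p.empMean n (p.B n) - p.empMean n (p.C n) + ε₀) ^ 2 /
        (1 / (p.pulls n (p.B n) : ℝ) + 1 / (p.pulls n (p.C n) : ℝ)) ≤
      (p.empMean n (p.B n) - p.empMean n i + ε₀) ^ 2 /
        (1 / (p.pulls n (p.B n) : ℝ) + 1 / (p.pulls n i : ℝ)) := by
  have h1 := h.challenger n hn i hi
  have h2 := h.leader n hn (p.C n)
  unfold transportCost at h1
  have h3 := pow_le_pow_left₀ (div_nonneg (by linarith) (Real.sqrt_nonneg _)) h1 2
  rwa [div_pow, div_pow, Real.sq_sqrt (by positivity), Real.sq_sqrt (by positivity)] at h3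

/-- The leader or the challenger is among the least sampled arms, up to a constant: the slack `ε₀`
bounds the transportation cost of the challenger from below. -/
lemma FollowsEBTC.min_pulls_le (hε₀ : 0 < ε₀) {n : ℕ} (hn : K < n) {μ : Fin K → ℝ} {Δ r : ℝ}
    (hΔ : ∀ i j, μ i - μ j ≤ Δ) (hr : ∀ i, |p.empMean n i - μ i| ≤ r) (k : Fin K) :
    (min (p.pulls n (p.B n)) (p.pulls n (p.C n)) : ℝ) ≤
      2 * (Δ + 2 * r + ε₀) ^ 2 / ε₀ ^ 2 * p.pulls n k := by
  have hΔ0 : 0 ≤ Δ := by simpa using hΔ k k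
  have hr0 : 0 ≤ r := (abs_nonneg _).trans (hr k)
  have hNB : (1 : ℝ) ≤ p.pulls n (p.B n) := by exact_mod_cast h.one_le_pulls hn _
  have hNC : (1 : ℝ) ≤ p.pulls n (p.C n) := by exact_mod_cast h.one_le_pulls hn _
  have hNk : (1 : ℝ) ≤ p.pulls n k := by exact_mod_cast h.one_le_pulls hn _
  set NB : ℝ := (p.pulls n (p.B n) : ℝ)
  set NC : ℝ := (p.pulls n (p.C n) : ℝ)
  set Nk : ℝ := (p.pulls n k : ℝ)
  set R := Δ + 2 * r + ε₀ with hR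
  rw [div_mul_eq_mul_div, le_div_iff₀ (by positivity)]
  have hRε : ε₀ ^ 2 ≤ R ^ 2 := by
    refine pow_le_pow_left₀ hε₀.le (by linarith) 2
  by_cases hk : k = p.B n
  · have : min NB NC ≤ Nk := by
      rw [show Nk = NB by simp only [Nk, NB, hk]]; exact min_le_left _ _
    have h0 : 0 ≤ min NB NC := le_min (by linarith) (by linarith)
    nlinarith [sq_nonneg R]
  · have h1 := h.challenger_sq hε₀ hn hk
    have h2 := h.leader n hn (p.C n)
    have h2' := h.leader n hn k
    have h3 : ε₀ ^ 2 ≤ (p.empMean n (p.B n) - p.empMean n (p.C n) + ε₀) ^ 2 :=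
      pow_le_pow_left₀ hε₀.le (by linarith) 2
    have h4 : (p.empMean n (p.B n) - p.empMean n k + ε₀) ^ 2 ≤ R ^ 2 := by
      refine pow_le_pow_left₀ (by linarith) ?_ 2
      have := abs_le.1 (hr (p.B n))
      have := abs_le.1 (hr k)
      have := hΔ (p.B n) k
      linarith
    have h5 : ε₀ ^ 2 / (1 / NB + 1 / NC) ≤ R ^ 2 / (1 / NB + 1 / Nk) := by
      refine le_trans ?_ (h1.trans ?_)
      · gcongr
      · gcongr
    have h6 : R ^ 2 / (1 / NB + 1 / Nk) ≤ R ^ 2 * Nk := by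
      rw [div_le_iff₀ (by positivity), mul_assoc]
      refine le_mul_of_one_le_right (sq_nonneg _) ?_
      have : Nk * (1 / NB + 1 / Nk) = Nk / NB + 1 := by field_simp
      rw [this]
      have : 0 ≤ Nk / NB := by positivity
      linarith
    have h7 : min NB NC * ε₀ ^ 2 / 2 ≤ ε₀ ^ 2 / (1 / NB + 1 / NC) := by
      rw [le_div_iff₀ (by positivity)]
      have ha : min NB NC * (1 / NB) ≤ 1 := by
        rw [mul_one_div]; exact div_le_one_of_le₀ (min_le_left _ _) (by linarith)
      have hb : min NB NC * (1 / NC) ≤ 1 := by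
        rw [mul_one_div]; exact div_le_one_of_le₀ (min_le_right _ _) (by linarith)
      have : min NB NC * ε₀ ^ 2 / 2 * (1 / NB + 1 / NC) =
          ε₀ ^ 2 / 2 * (min NB NC * (1 / NB) + min NB NC * (1 / NC)) := by ring
      rw [this]
      nlinarith [sq_nonneg ε₀]
    linarith

/-- Linear exploration: as long as the empirical means stay within `r` of the means, every arm is
sampled a constant fraction of the time. -/
lemma FollowsEBTC.le_pulls (hv : rule.Valid) (hε₀ : 0 < ε₀) {n : ℕ} (hn : K < n)
    {μ : Fin K → ℝ} {Δ r : ℝ} (hΔ : ∀ i j, μ i - μ j ≤ Δ)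
    (hr : ∀ t, K < t → t ≤ n → ∀ i, |p.empMean t i - μ i| ≤ r) (k : Fin K) :
    rule.minRate * (n - 1 - K) ≤
      (K : ℝ) ^ 2 * (2 * (2 * (Δ + 2 * r + ε₀) ^ 2 / ε₀ ^ 2) * p.pulls n k + 3) := by
  set κ := 2 * (Δ + 2 * r + ε₀) ^ 2 / ε₀ ^ 2 with hκ
  have hκ0 : 0 ≤ κ := by positivity
  have hb0 := hv.minRate_pos
  have hb1 := Proportions.minRate_le_one hv
  have hpair : ∀ m, K < m → m ≤ n → ∀ i j : Fin K,
      rule.minRate * p.pairCount m i j ≤ 2 * κ * p.pulls m k + 3 := by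
    intro m hm
    induction m, hm using Nat.le_induction with
    | base =>
      intro _ i j
      simp only [pairCount, pairRounds_init, Finset.card_empty, Nat.cast_zero, mul_zero]
      positivity
    | succ m hm ih =>
      intro hmn i j
      have hmono : (p.pulls m k : ℝ) ≤ p.pulls (m + 1) k := by
        exact_mod_cast p.pulls_mono k (Nat.le_succ m)
      have hmono' : 2 * κ * p.pulls m k ≤ 2 * κ * p.pulls (m + 1) k :=
        mul_le_mul_of_nonneg_left hmono (by positivity)
      by_cases hij : p.B m = i ∧ p.C m = j
      · have h1 := h.minRate_mul_pairCount_le hv hm i j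
        have h2 := h.min_pulls_le hε₀ hm hΔ (hr m hm (by omega)) k
        rw [hij.1, hij.2, ← hκ] at h2
        have h3 : rule.minRate * p.pairCount m i j ≤ 2 * κ * p.pulls m k + 2 := by
          rcases min_le_iff.1 h2 with h2 | h2
          · linarith [h1.1]
          · linarith [h1.2]
        have h4 : p.pairCount (m + 1) i j = p.pairCount m i j + 1 := by
          unfold pairCount
          rw [p.pairRounds_succ_of_eq hm hij, Finset.card_insert_of_notMem
            (p.notMem_pairRounds m i j)]
        rw [h4]
        push_cast
        linarith
      · have h4 : p.pairCount (m + 1) i j = p.pairCount m i j := by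
          unfold pairCount
          rw [p.pairRounds_succ_of_ne hij]
        rw [h4]
        linarith [ih (by omega) i j]
  have hcount : ∑ ij : Fin K × Fin K, p.pairCount n ij.1 ij.2 = n - (K + 1) := by
    have := Finset.card_eq_sum_card_fiberwise (s := Finset.Ico (K + 1) n)
      (t := (Finset.univ : Finset (Fin K × Fin K))) (f := fun t => (p.B t, p.C t))
      (by simp [Set.MapsTo])
    rw [Nat.card_Ico] at this
    rw [this]
    simp only [pairCount, pairRounds, Prod.ext_iff]
  have hcount' : (n : ℝ) - 1 - K = ∑ ij : Fin K × Fin K, (p.pairCount n ij.1 ij.2 : ℝ) := by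
    rw [← Nat.cast_sum, hcount, Nat.cast_sub (by omega)]
    push_cast
    ring
  rw [hcount', Finset.mul_sum]
  refine (Finset.sum_le_sum fun ij _ => hpair n hn le_rfl ij.1 ij.2).trans ?_
  rw [Finset.sum_const, nsmul_eq_mul, Finset.card_univ, Fintype.card_prod, Fintype.card_fin]
  push_cast
  rw [sq]

end Follows

end Trajectory

/-! ### The balance equation and the optimal ratios -/

/-- The exponent of the balance equation `c N_s ^ q = ∑ N_j ^ q` that the tracking procedure
maintains between the leader `s` and its challengers. -/
def Proportions.exponent : Proportions → ℕ
  | .fixed _ => 1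
  | .ids => 2

/-- The constant of the balance equation. -/
noncomputable def Proportions.balance : Proportions → ℝ
  | .fixed β => (1 - β) / β
  | .ids => 1

/-- A bound at time `t` on the error in the balance equation, when the leader is constant from time
`t₀` on. -/
noncomputable def Proportions.balanceError (K t₀ t : ℕ) : Proportions → ℝ
  | .fixed β => (t₀ + 2 * K) / β
  | .ids => (t₀ : ℝ) ^ 2 + 2 * K * t₀ + (4 * K + 3) * t

lemma Proportions.Valid.balance_pos {rule : Proportions} (h : rule.Valid) :
    0 < rule.balance := by
  cases rule with
  | fixed β => exact div_pos (sub_pos.2 h.2) h.1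
  | ids => exact one_pos

lemma Proportions.exponent_ne_zero (rule : Proportions) : rule.exponent ≠ 0 := by
  cases rule <;> simp [Proportions.exponent]

/-- `r` lists the ratios `w_j / w_s` of the optimal allocation: they equalize the transportation
costs and satisfy the balance equation. -/
structure IsOptimalRatio {K : ℕ} (rule : Proportions) (ε₀ : ℝ) (μ : Fin K → ℝ)
    (s : Fin K) (r : Fin K → ℝ) (v₀ : ℝ) : Prop where
  pos : ∀ j ≠ s, 0 < r j
  value_pos : 0 < v₀
  equal : ∀ j ≠ s, (μ s - μ j + ε₀) ^ 2 * (r j / (1 + r j)) = v₀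
  balance : ∑ j ∈ Finset.univ.erase s, r j ^ rule.exponent = rule.balance

namespace Trajectory

variable {K : ℕ} {p : Trajectory K} {rule : Proportions} {ε₀ : ℝ}

/-- All the empirical means before round `n` are close to the means, up to a self-normalized
deviation of `n ^ (1 / 8)`. A small power of `n` dominates the logarithmic
deviations that occur with high probability, and is negligible against the number
of pulls of each arm. -/
def Concentrated (p : Trajectory K) (μ : Fin K → ℝ) (n : ℕ) : Prop :=
  ∀ t, K < t → t ≤ n → ∀ i, p.selfNorm μ t i ≤ (n : ℝ) ^ (1 / 8 : ℝ)

/-- On concentrated trajectories, the empirical means are uniformly close to the means in all rounds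
between `√n` and `n`. -/
lemma eventually_abs_empMean_sub_le (hv : rule.Valid) (hε₀ : 0 < ε₀) (μ : Fin K → ℝ)
    {ξ : ℝ} (hξ : 0 < ξ) : ∀ᶠ n : ℕ in atTop, ∀ p : Trajectory K, p.FollowsEBTC ε₀ rule →
      p.Concentrated μ n → ∀ t : ℕ, K < t → √(n : ℝ) ≤ t → t ≤ n → ∀ i,
        |p.empMean t i - μ i| ≤ ξ := by
  obtain ⟨Δ, hΔ⟩ : ∃ Δ, ∀ i j, μ i - μ j ≤ Δ := by
    obtain ⟨Δ, hΔ⟩ := Finite.bddAbove_range fun ij : Fin K × Fin K => μ ij.1 - μ ij.2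
    exact ⟨Δ, fun i j => hΔ ⟨(i, j), rfl⟩⟩
  have hb0 := hv.minRate_pos
  set b := rule.minRate with hb
  set A := 2 * (Δ + 2 * 2 + ε₀) ^ 2 / ε₀ ^ 2 with hA
  set Y := ((K : ℝ) ^ 2 * (4 * A / ξ ^ 2 + 3) + b * (1 + K)) / b with hY
  have hlim : Tendsto (fun n : ℕ => (n : ℝ) ^ (1 / 16 : ℝ)) atTop atTop :=
    (tendsto_rpow_atTop (by norm_num)).comp tendsto_natCast_atTop_atTop
  filter_upwards [hlim.eventually_gt_atTop Y, hlim.eventually_ge_atTop 1] with n hyY hy1 p h hc t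
    hKt htn1 htn2 i
  set y := (n : ℝ) ^ (1 / 16 : ℝ) with hy
  have hn0 : (0 : ℝ) ≤ n := Nat.cast_nonneg n
  have hΔ0 : 0 ≤ Δ := by simpa using hΔ i i
  have hy2 : (n : ℝ) ^ (1 / 8 : ℝ) = y ^ 2 := by
    rw [hy, ← Real.rpow_natCast, ← Real.rpow_mul hn0]; norm_num
  have hy8 : √(n : ℝ) = y ^ 8 := by
    rw [hy, ← Real.rpow_natCast, ← Real.rpow_mul hn0, Real.sqrt_eq_rpow]; norm_num
  have hcrude : ∀ m, K < m → m ≤ t → ∀ k, |p.empMean m k - μ k| ≤ 2 * y := by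
    intro m hm hmt k
    have h1 := hc m hm (hmt.trans htn2) k
    have h2 : (1 : ℝ) ≤ p.pulls m k := by exact_mod_cast h.one_le_pulls hm k
    rw [hy2] at h1
    unfold selfNorm at h1
    refine abs_le_of_sq_le_sq ?_ (by positivity)
    nlinarith [sq_nonneg (p.empMean m k - μ k)]
  have hN := h.le_pulls hv hε₀ hKt hΔ hcrude i
  have hN1 : (1 : ℝ) ≤ p.pulls t i := by exact_mod_cast h.one_le_pulls hKt i
  set N : ℝ := (p.pulls t i : ℝ) with hNdef
  rw [← hb] at hN
  have hκ : 2 * (Δ + 2 * (2 * y) + ε₀) ^ 2 / ε₀ ^ 2 ≤ A * y ^ 2 := by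
    rw [hA, div_mul_eq_mul_div, mul_assoc 2, ← mul_pow]
    gcongr
    nlinarith
  -- the arm is sampled often enough for its deviation to be below `ξ`
  have hNbig : 2 * y ^ 2 ≤ ξ ^ 2 * N := by
    by_contra hlt
    push Not at hlt
    have h1 : N ≤ 2 * y ^ 2 / ξ ^ 2 := by
      rw [le_div_iff₀ (by positivity)]; linarith
    have h2 : b * (y ^ 8 - 1 - K) ≤ (K : ℝ) ^ 2 * (2 * (A * y ^ 2) * (2 * y ^ 2 / ξ ^ 2) + 3) := by
      rw [← hy8]
      calc b * (√(n : ℝ) - 1 - K) ≤ b * (t - 1 - K) := by gcongr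
        _ ≤ _ := hN
        _ ≤ _ := by gcongr
    have h3 : (K : ℝ) ^ 2 * (2 * (A * y ^ 2) * (2 * y ^ 2 / ξ ^ 2) + 3) ≤
        (K : ℝ) ^ 2 * (4 * A / ξ ^ 2 + 3) * y ^ 4 := by
      have : 1 ≤ y ^ 4 := one_le_pow₀ hy1
      have h4 : (K : ℝ) ^ 2 * (4 * A / ξ ^ 2 + 3) * y ^ 4 =
        (K : ℝ) ^ 2 * (2 * (A * y ^ 2) * (2 * y ^ 2 / ξ ^ 2) + 3 * y ^ 4) := by ring
      rw [h4]
      gcongr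
      linarith
    have h5 : b * Y * y ^ 4 < b * y ^ 8 := by
      have : y ^ 8 = y * (y ^ 3 * y ^ 4) := by ring
      rw [this, mul_assoc]
      have h6 : 1 ≤ y ^ 3 := one_le_pow₀ hy1
      have h7 : 0 < y ^ 4 := by positivity
      have h8 : Y * y ^ 4 < y * y ^ 4 := by gcongr
      have h9 : y * y ^ 4 ≤ y * (y ^ 3 * y ^ 4) := by
        gcongr; exact le_mul_of_one_le_left h7.le h6
      exact mul_lt_mul_of_pos_left (h8.trans_le h9) hb0
    have h6 : b * Y = (K : ℝ) ^ 2 * (4 * A / ξ ^ 2 + 3) + b * (1 + K) := by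
      rw [hY]; field_simp
    rw [h6] at h5
    have h7 : b * (1 + K) ≤ b * (1 + K) * y ^ 4 :=
      le_mul_of_one_le_right (by positivity) (one_le_pow₀ hy1)
    linarith
  have h1 := hc t hKt htn2 i
  rw [hy2] at h1
  unfold selfNorm at h1
  rw [← hNdef] at h1
  refine abs_le_of_sq_le_sq ?_ hξ.le
  by_contra hlt
  push Not at hlt
  nlinarith [sq_nonneg (p.empMean t i - μ i)]

/-- The leader is the best arm once the empirical means are close enough to the means. -/
lemma FollowsEBTC.leader_eq (h : p.FollowsEBTC ε₀ rule) {n : ℕ} (hn : K < n) {μ : Fin K → ℝ}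
    {s : Fin K} {ξ : ℝ} (hs : ∀ j ≠ s, 2 * ξ < μ s - μ j)
    (hξ : ∀ i, |p.empMean n i - μ i| ≤ ξ) : p.B n = s := by
  by_contra hne
  have h1 := h.leader n hn s
  have h2 := abs_le.1 (hξ s)
  have h3 := abs_le.1 (hξ (p.B n))
  have h4 := hs _ hne
  linarith

/-! ### The balance between the best arm and its challengers -/

lemma sum_pulls_erase (p : Trajectory K) {n : ℕ} (hn : 1 ≤ n) (s : Fin K) :
    ∑ j ∈ Finset.univ.erase s, (p.pulls n j : ℝ) = n - 1 - p.pulls n s := by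
  have h1 := Finset.add_sum_erase Finset.univ (fun j => (p.pulls n j : ℝ)) (Finset.mem_univ s)
  have h2 : ∑ j, (p.pulls n j : ℝ) = n - 1 := by
    rw [← Nat.cast_sum, p.sum_pulls, Nat.cast_sub hn, Nat.cast_one]
  linarith

lemma sum_trackingError_le (h : p.FollowsEBTC ε₀ rule) (hv : rule.Valid) {n : ℕ} (hn : K < n)
    (i : Fin K) (S : Finset (Fin K)) (f : Fin K → ℝ) {M : ℝ} (hf : ∀ k, f k ∈ Set.Icc 0 M) :
    ∑ k ∈ S, p.trackingError rule n i k * f k ∈ Set.Icc 0 (K * M) := by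
  refine ⟨Finset.sum_nonneg fun k _ => mul_nonneg (h.trackingError_mem hv hn i k).1 (hf k).1, ?_⟩
  have hM : 0 ≤ M := (hf i).1.trans (hf i).2
  calc ∑ k ∈ S, p.trackingError rule n i k * f k ≤ ∑ k ∈ S, M :=
        Finset.sum_le_sum fun k _ =>
          (mul_le_of_le_one_left (hf k).1 (h.trackingError_mem hv hn i k).2).trans (hf k).2
    _ = S.card * M := by rw [Finset.sum_const, nsmul_eq_mul]
    _ ≤ K * M := by
        gcongr
        simpa using Finset.card_le_univ S

/-- With fixed proportions, `(1 - β) N_s - β ∑ N_j = N_s - β (n - 1)`, corrected by the tracking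
errors, does not change in the rounds in which `s` is the leader. -/
lemma FollowsEBTC.fixed_balance_succ {β : ℝ} (h : p.FollowsEBTC ε₀ (.fixed β)) {n : ℕ} (hn : K < n)
    {s : Fin K} (hB : p.B n = s) :
    ((p.pulls (n + 1) s : ℝ) - β * n + ∑ k ∈ Finset.univ.erase s, p.trackingError (.fixed β) (n + 1) s k)
      = (p.pulls n s : ℝ) - β * (n - 1 : ℝ) +
        ∑ k ∈ Finset.univ.erase s, p.trackingError (.fixed β) n s k := by
  have hC : p.C n ≠ s := hB ▸ h.challenger_ne n hn
  have hmem : p.C n ∈ Finset.univ.erase s := by simp [hC]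
  rw [← Finset.add_sum_erase _ _ hmem, ← Finset.add_sum_erase _ _ hmem,
    p.trackingError_succ_of_eq _ hn ⟨hB, rfl⟩, p.pulls_succ (by omega) s,
    Finset.sum_congr rfl (g := fun k => p.trackingError (.fixed β) n s k) fun k hk =>
      p.trackingError_succ_of_ne _ fun hc => (Finset.ne_of_mem_erase hk) hc.2.symm]
  simp only [rate]
  rcases h.arm_eq_or hn with hI | hI
  · rw [if_neg (by rw [hI]; exact hC), if_pos hI]; push_cast; ring
  · rw [hB] at hI
    rw [if_pos hI, if_neg (by rw [hI]; exact hC.symm)]; push_cast; ring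

/-- With IDS proportions, `N_s² - ∑ N_j²`, corrected by the tracking errors, changes by a bounded
amount in the rounds in which `s` is the leader: given the pair `(s, j)`, the expected increment
`2 N_s · N_j / (N_s + N_j) - 2 N_j · N_s / (N_s + N_j)` vanishes. -/
lemma FollowsEBTC.ids_balance_succ (h : p.FollowsEBTC ε₀ .ids) {n : ℕ} (hn : K < n)
    {s : Fin K} (hB : p.B n = s) :
    |((p.pulls (n + 1) s : ℝ) ^ 2 - ∑ k ∈ Finset.univ.erase s, (p.pulls (n + 1) k : ℝ) ^ 2 +
        2 * ∑ k ∈ Finset.univ.erase s, p.trackingError .ids (n + 1) s k *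
          (p.pulls (n + 1) s + p.pulls (n + 1) k)) -
      ((p.pulls n s : ℝ) ^ 2 - ∑ k ∈ Finset.univ.erase s, (p.pulls n k : ℝ) ^ 2 +
        2 * ∑ k ∈ Finset.univ.erase s, p.trackingError .ids n s k *
          (p.pulls n s + p.pulls n k))| ≤ 2 * (K : ℝ) + 3 := by
  have hC : p.C n ≠ s := hB ▸ h.challenger_ne n hn
  have hmem : p.C n ∈ Finset.univ.erase s := by simp [hC]
  have hD1 := h.trackingError_mem (rule := .ids) trivial (Nat.lt_succ_of_lt hn) s (p.C n)
  have hDrest := sum_trackingError_le h (rule := .ids) trivial hn s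
    ((Finset.univ.erase s).erase (p.C n)) (fun _ => 1) (M := 1) (by simp)
  have hNs : (1 : ℝ) ≤ p.pulls n s := by exact_mod_cast h.one_le_pulls hn s
  have hrest : ∀ k ∈ (Finset.univ.erase s).erase (p.C n), p.I n ≠ k := by
    intro k hk
    have h1 := Finset.ne_of_mem_erase hk
    have h2 := Finset.ne_of_mem_erase (Finset.mem_of_mem_erase hk)
    rcases h.arm_eq_or hn with hI | hI <;> rw [hI]
    exacts [h1.symm, hB ▸ h2.symm]
  simp only [← Finset.add_sum_erase _ _ hmem]
  rw [Finset.sum_congr rfl (g := fun k => p.trackingError .ids n s k *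
      (p.pulls n s + p.pulls n k) + p.trackingError .ids n s k * (if p.I n = s then 1 else 0))
      (s₁ := (Finset.univ.erase s).erase (p.C n))
      (f := fun k => p.trackingError .ids (n + 1) s k * (p.pulls (n + 1) s + p.pulls (n + 1) k))
      fun k hk => by
        rw [p.trackingError_succ_of_ne _ fun hc => (Finset.ne_of_mem_erase hk) hc.2.symm,
          p.pulls_succ (by omega) k, p.pulls_succ (by omega) s, if_neg (hrest k hk)]
        push_cast
        ring,
    Finset.sum_congr rfl (s₁ := (Finset.univ.erase s).erase (p.C n))
      (f := fun k => (p.pulls (n + 1) k : ℝ) ^ 2) (g := fun k => (p.pulls n k : ℝ) ^ 2)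
      fun k hk => by rw [p.pulls_succ (by omega) k, if_neg (hrest k hk), add_zero],
    Finset.sum_add_distrib]
  have hsucc := p.trackingError_succ_of_eq .ids hn ⟨hB, rfl⟩
  have hrate : p.rate .ids n s (p.C n) * (p.pulls n s + p.pulls n (p.C n)) = p.pulls n s := by
    unfold rate
    exact div_mul_cancel₀ _ (by positivity)
  simp only [mul_one] at hDrest
  rw [p.pulls_succ (by omega) s, p.pulls_succ (by omega) (p.C n)]
  rcases h.arm_eq_or hn with hI | hI
  · have hs' : p.I n ≠ s := by rw [hI]; exact hC
    rw [if_neg hs', if_pos hI]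
    rw [if_pos hI] at hsucc
    have hD0 : p.trackingError .ids n s (p.C n) =
      p.trackingError .ids (n + 1) s (p.C n) - 1 + p.rate .ids n s (p.C n) := by linarith
    rw [hD0]
    simp only [if_neg hs', mul_zero, Finset.sum_const_zero]
    push_cast
    rw [abs_le]
    constructor <;> nlinarith [hD1.1, hD1.2]
  · rw [hB] at hI
    rw [if_pos hI, if_neg (by rw [hI]; exact hC.symm)]
    rw [if_neg (by rw [hI]; exact hC.symm)] at hsucc
    have hD0 : p.trackingError .ids n s (p.C n) =
      p.trackingError .ids (n + 1) s (p.C n) + p.rate .ids n s (p.C n) := by linarith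
    rw [hD0]
    simp only [if_pos hI, mul_one]
    push_cast
    rw [abs_le]
    constructor <;> nlinarith [hD1.1, hD1.2, hDrest.1, hDrest.2]

/-- The balance equation in the rounds `t` up to which `s` has been the leader since round `t₀`: the
initial imbalance is at most the one accumulated before `t₀`, and it drifts by a bounded amount per
round. -/
lemma FollowsEBTC.abs_balance_le (h : p.FollowsEBTC ε₀ rule) (hv : rule.Valid) {t₀ n : ℕ}
    (ht₀ : K < t₀) {s : Fin K} (hB : ∀ t, t₀ ≤ t → t < n → p.B t = s) {t : ℕ} (ht : t₀ ≤ t)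
    (htn : t ≤ n) :
    |rule.balance * (p.pulls t s : ℝ) ^ rule.exponent -
        ∑ k ∈ Finset.univ.erase s, (p.pulls t k : ℝ) ^ rule.exponent| ≤
      rule.balanceError K t₀ t := by
  cases rule with
  | fixed β =>
    have hβ : 0 < β := hv.1
    have hconst : ((p.pulls t s : ℝ) - β * (t - 1 : ℝ) +
        ∑ k ∈ Finset.univ.erase s, p.trackingError (.fixed β) t s k) =
        ((p.pulls t₀ s : ℝ) - β * (t₀ - 1 : ℝ) +
        ∑ k ∈ Finset.univ.erase s, p.trackingError (.fixed β) t₀ s k) := by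
      induction t, ht using Nat.le_induction with
      | base => rfl
      | succ m hm ih =>
        rw [← ih (by omega), ← h.fixed_balance_succ (by omega) (hB m hm (by omega))]
        push_cast
        ring
    have h1 := sum_trackingError_le h hv (ht₀.trans_le ht) s (Finset.univ.erase s) (fun _ => 1)
      (M := 1) (by simp)
    have h2 := sum_trackingError_le h hv ht₀ s (Finset.univ.erase s) (fun _ => 1)
      (M := 1) (by simp)
    simp only [mul_one] at h1 h2
    have h3 : (p.pulls t₀ s : ℝ) ≤ t₀ - 1 := by
      rw [← Nat.cast_one, ← Nat.cast_sub (by omega)]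
      exact_mod_cast p.pulls_le t₀ s
    have h3' : (0 : ℝ) ≤ p.pulls t₀ s := Nat.cast_nonneg _
    simp only [Proportions.exponent, Proportions.balance, Proportions.balanceError, pow_one]
    rw [p.sum_pulls_erase (by omega)]
    have h4 : (1 - β) / β * (p.pulls t s : ℝ) - (t - 1 - p.pulls t s) =
        (p.pulls t s - β * (t - 1)) / β := by field_simp; ring
    rw [h4, abs_div, abs_of_pos hβ, div_le_div_iff_of_pos_right hβ, abs_le]
    have h5 : 0 ≤ β * (t₀ - 1 : ℝ) := mul_nonneg hβ.le (by linarith)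
    have h6 : β * (t₀ - 1 : ℝ) ≤ t₀ - 1 := mul_le_of_le_one_left (by linarith) hv.2.le
    constructor <;> linarith [h1.1, h1.2, h2.1, h2.2]
  | ids =>
    set Φ : ℕ → ℝ := fun m => (p.pulls m s : ℝ) ^ 2 -
        ∑ k ∈ Finset.univ.erase s, (p.pulls m k : ℝ) ^ 2 +
        2 * ∑ k ∈ Finset.univ.erase s, p.trackingError .ids m s k * (p.pulls m s + p.pulls m k)
      with hΦ
    have hdrift : |Φ t - Φ t₀| ≤ (2 * K + 3) * (t - t₀) := by
      induction t, ht using Nat.le_induction with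
      | base => simp
      | succ m hm ih =>
        have h1 := h.ids_balance_succ (by omega) (hB m hm (by omega))
        have h2 := ih (by omega)
        calc |Φ (m + 1) - Φ t₀| ≤ |Φ (m + 1) - Φ m| + |Φ m - Φ t₀| := abs_sub_le _ _ _
          _ ≤ (2 * K + 3) + (2 * K + 3) * (m - t₀) := add_le_add h1 h2
          _ = _ := by push_cast; ring
    have hpl : ∀ m, 1 ≤ m → ∀ k ≠ s, (p.pulls m s : ℝ) + p.pulls m k ≤ m := by
      intro m hm k hk
      have := p.pulls_add_pulls_le m hk.symm
      have : p.pulls m s + p.pulls m k ≤ m := by omega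
      exact_mod_cast this
    have hH : ∀ m, K < m → ∑ k ∈ Finset.univ.erase s, p.trackingError .ids m s k *
        (p.pulls m s + p.pulls m k) ∈ Set.Icc 0 ((K : ℝ) * m) := by
      intro m hm
      have := sum_trackingError_le h hv hm s (Finset.univ.erase s)
        (fun k => if k = s then 0 else (p.pulls m s : ℝ) + p.pulls m k) (M := m) (by
          intro k
          split_ifs with hk
          · simp
          · exact ⟨by positivity, hpl m (by omega) k hk⟩)
      rwa [Finset.sum_congr rfl (g := fun k => p.trackingError .ids m s k *
        (p.pulls m s + p.pulls m k)) fun k hk => by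
          rw [if_neg (Finset.ne_of_mem_erase hk)]] at this
    have hstart : |(p.pulls t₀ s : ℝ) ^ 2 - ∑ k ∈ Finset.univ.erase s, (p.pulls t₀ k : ℝ) ^ 2| ≤
        (t₀ : ℝ) ^ 2 := by
      have h1 := Finset.sum_sq_le_sq_sum_of_nonneg (s := Finset.univ.erase s)
        (f := fun k => (p.pulls t₀ k : ℝ)) (fun k _ => Nat.cast_nonneg _)
      rw [p.sum_pulls_erase (by omega)] at h1
      have h3 : (p.pulls t₀ s : ℝ) ≤ t₀ - 1 := by
        rw [← Nat.cast_one, ← Nat.cast_sub (by omega)]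
        exact_mod_cast p.pulls_le t₀ s
      have h3' : (0 : ℝ) ≤ p.pulls t₀ s := Nat.cast_nonneg _
      have h4 : 0 ≤ ∑ k ∈ Finset.univ.erase s, (p.pulls t₀ k : ℝ) ^ 2 :=
        Finset.sum_nonneg fun k _ => sq_nonneg _
      rw [abs_le]
      constructor <;> nlinarith
    have h1 := hH t (ht₀.trans_le ht)
    have h2 := hH t₀ ht₀
    simp only [Proportions.exponent, Proportions.balance, Proportions.balanceError, one_mul]
    simp only [hΦ] at hdrift
    have h3 : (0 : ℝ) ≤ t₀ := Nat.cast_nonneg _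
    have h4 : (0 : ℝ) ≤ K := Nat.cast_nonneg _
    have h5 : 0 ≤ (K : ℝ) * t₀ := by positivity
    rw [abs_le] at hdrift hstart ⊢
    constructor <;> nlinarith [h1.1, h1.2, h2.1, h2.2]

/-! ### Convergence of the allocation -/

/-- On concentrated trajectories, the best arm is the leader and the balance equation holds, up to
an error of lower order, in all rounds between `√n` and `n`. -/
lemma eventually_leader_and_balance (hv : rule.Valid) (hε₀ : 0 < ε₀) {μ : Fin K → ℝ} {s : Fin K}
    (hs : ∀ j ≠ s, μ j < μ s) {ρ : ℝ} (hρ : 0 < ρ) :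
    ∀ᶠ n : ℕ in atTop, ∀ p : Trajectory K, p.FollowsEBTC ε₀ rule → p.Concentrated μ n →
      ∀ t : ℕ, √(n : ℝ) ≤ t → t ≤ n → K < t ∧ p.B t = s ∧
        |rule.balance * (p.pulls t s : ℝ) ^ rule.exponent -
          ∑ k ∈ Finset.univ.erase s, (p.pulls t k : ℝ) ^ rule.exponent| ≤
          ρ * (n : ℝ) ^ rule.exponent := by
  obtain ⟨ξ, hξ, hξs⟩ : ∃ ξ > 0, ∀ j ≠ s, 2 * ξ < μ s - μ j := by
    have : ∀ᶠ ξ in 𝓝[>] (0 : ℝ), ∀ j, j ≠ s → 2 * ξ < μ s - μ j := by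
      refine eventually_all.2 fun j => ?_
      by_cases hj : j = s
      · simp [hj]
      · have h1 : Tendsto (fun ξ : ℝ => 2 * ξ) (𝓝[>] 0) (𝓝 (2 * 0)) :=
          (tendsto_id.const_mul 2).mono_left nhdsWithin_le_nhds
        filter_upwards [h1.eventually_lt_const (show 2 * 0 < μ s - μ j by linarith [hs j hj])]
          with ξ hξ _ using hξ
    obtain ⟨ξ, h1, h2⟩ := (this.and self_mem_nhdsWithin).exists
    exact ⟨ξ, h2, h1⟩
  have hsq : Tendsto (fun n : ℕ => √(n : ℝ)) atTop atTop :=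
    Real.tendsto_sqrt_atTop.comp tendsto_natCast_atTop_atTop
  have herr : ∀ᶠ n : ℕ in atTop, ∀ t : ℕ, t ≤ n →
      rule.balanceError K ⌈√(n : ℝ)⌉₊ t ≤ ρ * (n : ℝ) ^ rule.exponent := by
    cases rule with
    | fixed β =>
      have hβ : 0 < β := hv.1
      filter_upwards [hsq.eventually_ge_atTop 1,
        hsq.eventually_ge_atTop ((2 + 2 * K) / (ρ * β))] with n h1 h2 t _
      have h3 := (Nat.ceil_lt_add_one (Real.sqrt_nonneg (n : ℝ))).le
      rw [div_le_iff₀ (by positivity)] at h2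
      simp only [Proportions.exponent, Proportions.balanceError, pow_one]
      rw [div_le_iff₀ hβ]
      have h4 : (n : ℝ) = √n * √n := (Real.mul_self_sqrt (Nat.cast_nonneg n)).symm
      calc (⌈√(n : ℝ)⌉₊ : ℝ) + 2 * K ≤ √n * 2 + 2 * K * √n := by
            have : (K : ℝ) ≤ K * √n := le_mul_of_one_le_right (Nat.cast_nonneg K) h1
            linarith
        _ = (2 + 2 * K) * √n := by ring
        _ ≤ √n * (ρ * β) * √n := by gcongr
        _ = ρ * n * β := by rw [h4]; simp only [Real.sqrt_mul_self (Real.sqrt_nonneg _)]; ring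
    | ids =>
      filter_upwards [hsq.eventually_ge_atTop 1, tendsto_natCast_atTop_atTop.eventually_ge_atTop
        ((7 + 8 * K) / ρ)] with n h1 h2 t ht
      have h3 := (Nat.ceil_lt_add_one (Real.sqrt_nonneg (n : ℝ))).le
      have h3' : (0 : ℝ) ≤ ⌈√(n : ℝ)⌉₊ := Nat.cast_nonneg _
      rw [div_le_iff₀ (by positivity)] at h2
      simp only [Proportions.exponent, Proportions.balanceError]
      have h4 : √(n : ℝ) * √n = n := Real.mul_self_sqrt (Nat.cast_nonneg n)
      have h5 : (t : ℝ) ≤ n := by exact_mod_cast ht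
      have h6 : (⌈√(n : ℝ)⌉₊ : ℝ) ≤ 2 * √n := by linarith
      have h7 : (⌈√(n : ℝ)⌉₊ : ℝ) ^ 2 ≤ 4 * n := by nlinarith
      have h8 : √(n : ℝ) ≤ n := by nlinarith
      calc (⌈√(n : ℝ)⌉₊ : ℝ) ^ 2 + 2 * K * ⌈√(n : ℝ)⌉₊ + (4 * K + 3) * t
          ≤ 4 * n + 2 * K * (2 * n) + (4 * K + 3) * n := by gcongr; linarith
        _ = (7 + 8 * K) * n := by ring
        _ ≤ n * ρ * n := by gcongr
        _ = ρ * (n : ℝ) ^ 2 := by ring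
  filter_upwards [eventually_abs_empMean_sub_le hv hε₀ μ hξ, hsq.eventually_ge_atTop (K + 1),
    herr] with n hn hnK herr p h hc
  have ht₀ : K < ⌈√(n : ℝ)⌉₊ := by
    refine Nat.lt_ceil.2 ?_
    linarith
  have hlead : ∀ t : ℕ, √(n : ℝ) ≤ t → t ≤ n → K < t ∧ p.B t = s := by
    intro t h1 h2
    have hK : K < t := ht₀.trans_le (Nat.ceil_le.2 h1)
    exact ⟨hK, h.leader_eq hK hξs (hn p h hc t hK h1 h2)⟩
  intro t h1 h2
  refine ⟨(hlead t h1 h2).1, (hlead t h1 h2).2, ?_⟩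
  refine (h.abs_balance_le hv ht₀ (fun m h3 h4 => (hlead m (Nat.ceil_le.1 h3) h4.le).2)
    (Nat.ceil_le.2 h1) h2).trans (herr t h2)

/-- The balance equation forces the leader to get a constant fraction of the pulls. -/
lemma exists_le_pulls_of_balance (hv : rule.Valid) (s : Fin K) : ∃ c > (0 : ℝ), ∃ ρ > (0 : ℝ),
    ∀ (p : Trajectory K) (t : ℕ), 4 ≤ t →
      |rule.balance * (p.pulls t s : ℝ) ^ rule.exponent -
        ∑ k ∈ Finset.univ.erase s, (p.pulls t k : ℝ) ^ rule.exponent| ≤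
        ρ * (t : ℝ) ^ rule.exponent →
      c * t ≤ (p.pulls t s : ℝ) := by
  have hK : (0 : ℝ) < K := by exact_mod_cast s.pos
  have hbal := hv.balance_pos
  set q := rule.exponent with hq
  have hq0 : q ≠ 0 := rule.exponent_ne_zero
  set e : ℝ := (1 / (2 * K)) ^ q with he
  have he0 : 0 < e := by positivity
  refine ⟨min (1 / 4) (e / (4 * rule.balance)), by positivity, e / 4, by positivity, ?_⟩
  intro p t ht hle
  set c := min (1 / 4) (e / (4 * rule.balance)) with hc
  have hc0 : 0 < c := by positivity
  have ht' : (4 : ℝ) ≤ t := by exact_mod_cast ht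
  by_contra hlt
  push Not at hlt
  have hc4 : c ≤ 1 / 4 := min_le_left _ _
  have hce : rule.balance * c ≤ e / 4 := by
    have := min_le_right (1 / 4) (e / (4 * rule.balance))
    rw [← hc, le_div_iff₀ (by positivity)] at this
    linarith
  obtain ⟨j, hj, hjt⟩ : ∃ j ∈ Finset.univ.erase s, 1 / (2 * K) * (t : ℝ) ≤ p.pulls t j := by
    by_contra hall
    push Not at hall
    have h1 := Finset.sum_le_sum fun j hj => (hall j hj).le
    rw [p.sum_pulls_erase (by omega), Finset.sum_const, nsmul_eq_mul] at h1
    have h2 : ((Finset.univ.erase s).card : ℝ) ≤ K := by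
      exact_mod_cast (Finset.card_le_univ _).trans (by simp)
    have h3 : ((Finset.univ.erase s).card : ℝ) * (1 / (2 * K) * t) ≤ K * (1 / (2 * K) * t) := by
      gcongr
    have h4 : K * (1 / (2 * K) * (t : ℝ)) = t / 2 := by field_simp
    nlinarith
  have h1 : e * (t : ℝ) ^ q ≤ ∑ k ∈ Finset.univ.erase s, (p.pulls t k : ℝ) ^ q := by
    rw [he, ← mul_pow]
    refine le_trans (pow_le_pow_left₀ (by positivity) hjt q) ?_
    exact Finset.single_le_sum (f := fun k => (p.pulls t k : ℝ) ^ q)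
      (fun k _ => by positivity) hj
  have h2 : rule.balance * (p.pulls t s : ℝ) ^ q ≤ e / 4 * (t : ℝ) ^ q := by
    calc rule.balance * (p.pulls t s : ℝ) ^ q ≤ rule.balance * (c * t) ^ q := by gcongr
      _ = rule.balance * c ^ q * (t : ℝ) ^ q := by rw [mul_pow]; ring
      _ ≤ rule.balance * c * (t : ℝ) ^ q := by
          gcongr
          exact pow_le_of_le_one hc0.le (by linarith) hq0
      _ ≤ e / 4 * (t : ℝ) ^ q := by gcongr
  have h3 := (abs_le.1 hle).1
  have h4 : 0 < e * (t : ℝ) ^ q := by positivity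
  linarith

lemma exists_last_pull (p : Trajectory K) {n : ℕ} {k : Fin K} (h : 1 ≤ p.pulls n k) :
    ∃ t, 1 ≤ t ∧ t < n ∧ p.I t = k ∧ p.pulls t k + 1 = p.pulls n k := by
  have hn : 1 ≤ n := by
    have := p.pulls_le n k; omega
  induction n, hn using Nat.le_induction with
  | base => simp [pulls] at h
  | succ n hn ih =>
    by_cases hI : p.I n = k
    · exact ⟨n, hn, by omega, hI, by rw [p.pulls_succ hn, if_pos hI]⟩
    · have h0 : p.pulls (n + 1) k = p.pulls n k := by rw [p.pulls_succ hn, if_neg hI, add_zero]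
      rw [h0] at h ⊢
      obtain ⟨t, h1, h2, h3⟩ := ih h
      exact ⟨t, h1, by omega, h3⟩

lemma div_one_add_le_div_one_add {x y : ℝ} (hx : 0 ≤ x) (hxy : x ≤ y) :
    x / (1 + x) ≤ y / (1 + y) := by
  rw [div_le_div_iff₀ (by linarith) (by linarith)]
  nlinarith

/-- If the normalized cost of `k` at a ratio beyond its target `a` does not exceed the cost of `j`,
then the ratio of `j` is beyond its target `b`, uniformly over small perturbations of the gaps. -/
lemma eventually_ratio_gt {d d' a b η : ℝ} (hd : 0 < d) (ha : 0 < a) (hb : 0 < b)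
    (hη : 0 < η) (heq : d ^ 2 * (a / (1 + a)) = d' ^ 2 * (b / (1 + b))) (hd' : 0 < d') :
    ∀ᶠ u in 𝓝[>] (0 : ℝ), ∀ x y e f : ℝ, 0 ≤ y → |e - d| ≤ 2 * u → |f - d'| ≤ 2 * u →
      (1 + η) * a ≤ x → e ^ 2 * (x / (1 + x)) ≤ f ^ 2 * (y / (1 + y)) → (1 + u) * b ≤ y := by
  have h1 : Tendsto (fun u : ℝ => (d' + 2 * u) ^ 2 * ((1 + u) * b / (1 + (1 + u) * b)))
      (𝓝[>] 0) (𝓝 (d' ^ 2 * (b / (1 + b)))) := by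
    have : ContinuousAt (fun u : ℝ => (d' + 2 * u) ^ 2 * ((1 + u) * b / (1 + (1 + u) * b))) 0 := by
      refine ContinuousAt.mul (by fun_prop) (ContinuousAt.div (by fun_prop) (by fun_prop) ?_)
      simp; positivity
    have h := this.tendsto.mono_left (nhdsWithin_le_nhds (s := Set.Ioi 0))
    simpa using h
  have h2 : Tendsto (fun u : ℝ => (d - 2 * u) ^ 2 * ((1 + η) * a / (1 + (1 + η) * a)))
      (𝓝[>] 0) (𝓝 (d ^ 2 * ((1 + η) * a / (1 + (1 + η) * a)))) := by
    have : ContinuousAt (fun u : ℝ => (d - 2 * u) ^ 2 * ((1 + η) * a / (1 + (1 + η) * a))) 0 := by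
      fun_prop
    have h := this.tendsto.mono_left (nhdsWithin_le_nhds (s := Set.Ioi 0))
    simpa using h
  have hlt : d' ^ 2 * (b / (1 + b)) < d ^ 2 * ((1 + η) * a / (1 + (1 + η) * a)) := by
    rw [← heq]
    refine mul_lt_mul_of_pos_left ?_ (by positivity)
    rw [div_lt_div_iff₀ (by positivity) (by positivity)]
    nlinarith [mul_pos hη ha]
  have h3 : Tendsto (fun u : ℝ => d - 2 * u) (𝓝[>] 0) (𝓝 d) := by
    have : ContinuousAt (fun u : ℝ => d - 2 * u) 0 := by fun_prop
    have h := this.tendsto.mono_left (nhdsWithin_le_nhds (s := Set.Ioi 0))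
    simpa using h
  filter_upwards [h1.eventually_lt h2 hlt, h3.eventually_const_lt hd, self_mem_nhdsWithin]
    with u hu hdu hu0 x y e f hy he hf hx hle
  have hu0' : 0 < u := hu0
  by_contra hlt'
  push Not at hlt'
  rw [abs_le] at he hf
  have h4 : f ^ 2 ≤ (d' + 2 * u) ^ 2 := sq_le_sq' (by linarith) (by linarith)
  have h5 : (d - 2 * u) ^ 2 ≤ e ^ 2 := pow_le_pow_left₀ hdu.le (by linarith) 2
  have h6 := div_one_add_le_div_one_add hy hlt'.le
  have h7 := div_one_add_le_div_one_add (show 0 ≤ (1 + η) * a by positivity) hx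
  have h8 : 0 ≤ y / (1 + y) := by positivity
  have h9 : 0 ≤ (1 + η) * a / (1 + (1 + η) * a) := by positivity
  have h10 : f ^ 2 * (y / (1 + y)) ≤
    (d' + 2 * u) ^ 2 * ((1 + u) * b / (1 + (1 + u) * b)) := by gcongr
  have h11 : (d - 2 * u) ^ 2 * ((1 + η) * a / (1 + (1 + η) * a)) ≤ e ^ 2 * (x / (1 + x)) := by
    gcongr
  linarith

lemma sq_div_inv_add_inv {N M e : ℝ} (hN : 0 < N) (hM : 0 < M) :
    e ^ 2 / (1 / N + 1 / M) = N * (e ^ 2 * (M / N / (1 + M / N))) := by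
  field_simp
  ring

/-- No arm is sampled much beyond its optimal ratio: when such an arm was last a challenger, it
minimized the transportation cost, so that all the arms were beyond their optimal ratios, which the
balance equation excludes. -/
lemma eventually_pulls_le (hv : rule.Valid) (hε₀ : 0 < ε₀) {μ : Fin K → ℝ} {s : Fin K}
    (hs : ∀ j ≠ s, μ j < μ s) {r : Fin K → ℝ} {v₀ : ℝ} (hr : IsOptimalRatio rule ε₀ μ s r v₀)
    {η : ℝ} (hη : 0 < η) {k : Fin K} (hk : k ≠ s) :
    ∀ᶠ n : ℕ in atTop, ∀ p : Trajectory K, p.FollowsEBTC ε₀ rule → p.Concentrated μ n →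
      (p.pulls n k : ℝ) ≤ (1 + η) * r k * p.pulls n s := by
  have hd : ∀ j ≠ s, 0 < μ s - μ j + ε₀ := fun j hj => by linarith [hs j hj]
  obtain ⟨u, hu, hu0⟩ : ∃ u, (∀ j, j ≠ s → ∀ x y e f : ℝ, 0 ≤ y →
      |e - (μ s - μ k + ε₀)| ≤ 2 * u → |f - (μ s - μ j + ε₀)| ≤ 2 * u →
      (1 + η / 2) * r k ≤ x → e ^ 2 * (x / (1 + x)) ≤ f ^ 2 * (y / (1 + y)) →
      (1 + u) * r j ≤ y) ∧ 0 < u := by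
    refine ((eventually_all.2 fun j => ?_).and self_mem_nhdsWithin).exists (f := 𝓝[>] (0 : ℝ))
    by_cases hj : j = s
    · simp [hj]
    · filter_upwards [eventually_ratio_gt (hd k hk) (hr.pos k hk) (hr.pos j hj) (half_pos hη)
        ((hr.equal k hk).trans (hr.equal j hj).symm) (hd j hj)] with u hu _ using hu
  obtain ⟨c, hc, ρ₁, hρ₁, hbal⟩ := exists_le_pulls_of_balance hv s
  set q := rule.exponent with hq
  have hq0 : q ≠ 0 := rule.exponent_ne_zero
  have hb0 := hv.balance_pos
  have hrk := hr.pos k hk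
  set c₂ := c * r k with hc₂
  have hc₂0 : 0 < c₂ := by positivity
  set ρ := min ρ₁ (min (ρ₁ * c₂ ^ q) (u * rule.balance * (c * c₂) ^ q / 2)) with hρ
  have hρ0 : 0 < ρ := by positivity
  have hcast : Tendsto (fun n : ℕ => (n : ℝ)) atTop atTop := tendsto_natCast_atTop_atTop
  have hsq : Tendsto (fun n : ℕ => √(n : ℝ)) atTop atTop :=
    Real.tendsto_sqrt_atTop.comp hcast
  filter_upwards [eventually_leader_and_balance hv hε₀ hs hρ0,
    eventually_abs_empMean_sub_le hv hε₀ μ hu0, hsq.eventually_ge_atTop (1 / c₂),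
    hsq.eventually_ge_atTop 4, hcast.eventually_ge_atTop (1 / (η / 2 * c₂)),
    hcast.eventually_ge_atTop 4] with n hn1 hn2 hn3 hn4' hn5 hn4 p h hcon
  have hsqn : √(n : ℝ) * √n = n := Real.mul_self_sqrt (Nat.cast_nonneg n)
  have hsqle : √(n : ℝ) ≤ n := by nlinarith
  have hNs : c * n ≤ (p.pulls n s : ℝ) := by
    refine hbal p n (by exact_mod_cast hn4) ((hn1 p h hcon n hsqle le_rfl).2.2.trans ?_)
    gcongr
    exact min_le_left _ _
  by_contra hlt
  push Not at hlt
  have hNk : c₂ * n ≤ p.pulls n k := by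
    refine le_trans ?_ hlt.le
    calc c₂ * n = r k * (c * n) := by rw [hc₂]; ring
      _ ≤ r k * p.pulls n s := by gcongr
      _ ≤ (1 + η) * r k * p.pulls n s := by
        refine mul_le_mul_of_nonneg_right ?_ (Nat.cast_nonneg _)
        nlinarith
  have hone : 1 ≤ p.pulls n k := by
    have : (0 : ℝ) < p.pulls n k := lt_of_lt_of_le (by positivity) hNk
    exact_mod_cast this
  obtain ⟨t, ht1, htn, hIt, hpt⟩ := p.exists_last_pull hone
  have hpt' : (p.pulls t k : ℝ) + 1 = p.pulls n k := by exact_mod_cast hpt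
  have htge : c₂ * n ≤ t := by
    have h1 := p.pulls_le t k
    have h2 : p.pulls t k + 1 ≤ t := by omega
    have h3 : (p.pulls t k : ℝ) + 1 ≤ t := by exact_mod_cast h2
    linarith
  have htsq : √(n : ℝ) ≤ t := by
    refine le_trans ?_ htge
    rw [div_le_iff₀ hc₂0] at hn3
    calc √(n : ℝ) = 1 * √n := (one_mul _).symm
      _ ≤ √n * c₂ * √n := by gcongr
      _ = c₂ * n := by rw [mul_right_comm, hsqn, mul_comm]
  have ht4 : 4 ≤ t := by
    have : (4 : ℝ) ≤ t := hn4'.trans htsq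
    exact_mod_cast this
  obtain ⟨hKt, hBt, hbalt⟩ := hn1 p h hcon t htsq htn.le
  have hmean := hn2 p h hcon t hKt htsq htn.le
  have hCt : p.C t = k := by
    rcases h.arm_eq_or hKt with h1 | h1
    · rw [← h1, hIt]
    · exact absurd (by rw [← hIt, h1, hBt]) hk
  have hpos : ∀ j, (0 : ℝ) < p.pulls t j := fun j => by exact_mod_cast h.one_le_pulls hKt j
  set N : ℝ := (p.pulls t s : ℝ) with hN
  have hNpos : 0 < N := hpos s
  have hNmono : N ≤ p.pulls n s := by rw [hN]; exact_mod_cast p.pulls_mono s htn.le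
  have hdiff : ∀ j, |(p.empMean t s - p.empMean t j + ε₀) - (μ s - μ j + ε₀)| ≤ 2 * u := by
    intro j
    have h1 := abs_le.1 (hmean s)
    have h2 := abs_le.1 (hmean j)
    rw [abs_le]
    constructor <;> linarith
  have hxk : (1 + η / 2) * r k ≤ p.pulls t k / N := by
    rw [le_div_iff₀ hNpos]
    rw [div_le_iff₀ (by positivity)] at hn5
    have h1 : (1 + η / 2) * r k * N ≤ (1 + η / 2) * r k * p.pulls n s := by gcongr
    have h2 : η / 2 * r k * (c * n) ≤ η / 2 * r k * p.pulls n s := by gcongr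
    have h3 : η / 2 * r k * (c * n) = n * (η / 2 * c₂) := by rw [hc₂]; ring
    linarith
  have hratio : ∀ j ≠ s, (1 + u) * r j * N ≤ p.pulls t j := by
    intro j hj
    have hch := h.challenger_sq hε₀ hKt (i := j) (by rw [hBt]; exact hj)
    rw [hBt, hCt, sq_div_inv_add_inv hNpos (hpos k), sq_div_inv_add_inv hNpos (hpos j)] at hch
    have hch' := le_of_mul_le_mul_left hch hNpos
    have := hu j hj _ _ _ _ (div_nonneg (hpos j).le hNpos.le) (hdiff k) (hdiff j) hxk hch'
    rwa [le_div_iff₀ hNpos] at this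
  have hsum : (1 + u) * (rule.balance * N ^ q) ≤
      ∑ j ∈ Finset.univ.erase s, (p.pulls t j : ℝ) ^ q := by
    rw [← hr.balance, Finset.sum_mul, Finset.mul_sum]
    refine Finset.sum_le_sum fun j hj => ?_
    have hj' := Finset.ne_of_mem_erase hj
    have hrj := hr.pos j hj'
    refine le_trans ?_ (pow_le_pow_left₀ (by positivity) (hratio j hj') q)
    rw [mul_pow, mul_pow, mul_assoc]
    refine mul_le_mul_of_nonneg_right (le_self_pow₀ (by linarith) hq0) (by positivity)
  have hNt : c * t ≤ N := by
    refine hbal p t ht4 (hbalt.trans ?_)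
    calc ρ * (n : ℝ) ^ q ≤ ρ₁ * c₂ ^ q * (n : ℝ) ^ q := by
          gcongr; exact (min_le_right _ _).trans (min_le_left _ _)
      _ = ρ₁ * (c₂ * n) ^ q := by rw [mul_pow]; ring
      _ ≤ ρ₁ * (t : ℝ) ^ q := by gcongr
  have hNq : (c * c₂) ^ q * (n : ℝ) ^ q ≤ N ^ q := by
    rw [← mul_pow]
    refine pow_le_pow_left₀ (by positivity) (le_trans ?_ hNt) q
    rw [mul_assoc]
    gcongr
  have hρle : ρ * (n : ℝ) ^ q ≤ u * rule.balance * (c * c₂) ^ q / 2 * (n : ℝ) ^ q := by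
    gcongr; exact (min_le_right _ _).trans (min_le_right _ _)
  have hfin := (abs_le.1 hbalt).1
  have h1 : u * rule.balance * ((c * c₂) ^ q * (n : ℝ) ^ q) ≤ u * rule.balance * N ^ q := by
    gcongr
  have h2 : 0 < u * rule.balance * N ^ q := by positivity
  linarith

/-- On concentrated trajectories the allocation is close to the optimal one. -/
lemma eventually_ratio_mem (hv : rule.Valid) (hε₀ : 0 < ε₀) {μ : Fin K → ℝ} {s : Fin K}
    (hs : ∀ j ≠ s, μ j < μ s) {r : Fin K → ℝ} {v₀ : ℝ} (hr : IsOptimalRatio rule ε₀ μ s r v₀)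
    {η : ℝ} (hη : η ∈ Set.Ioo (0 : ℝ) 1) :
    ∀ᶠ n : ℕ in atTop, ∀ p : Trajectory K, p.FollowsEBTC ε₀ rule → p.Concentrated μ n →
      K < n ∧ p.B n = s ∧ (∀ i, |p.empMean n i - μ i| ≤ η) ∧ ∀ j ≠ s,
        (1 - η) * r j * p.pulls n s ≤ p.pulls n j ∧
          (p.pulls n j : ℝ) ≤ (1 + η) * r j * p.pulls n s := by
  set q := rule.exponent with hq
  have hq0 : q ≠ 0 := rule.exponent_ne_zero
  have hb0 := hv.balance_pos
  -- upper bounds on the other ratios turn into lower bounds through the balance equation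
  obtain ⟨u, hu, hu0⟩ : ∃ u, (∀ j, j ≠ s → ((1 - η) * r j) ^ q <
      r j ^ q - rule.balance * ((1 + u) ^ q - 1) - u) ∧ 0 < u := by
    refine ((eventually_all.2 fun j => ?_).and self_mem_nhdsWithin).exists (f := 𝓝[>] (0 : ℝ))
    by_cases hj : j = s
    · simp [hj]
    · have hrj := hr.pos j hj
      have hcont : ContinuousAt (fun u : ℝ =>
        r j ^ q - rule.balance * ((1 + u) ^ q - 1) - u) 0 := by fun_prop
      have h1 := hcont.tendsto.mono_left (nhdsWithin_le_nhds (s := Set.Ioi 0))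
      have h2 : ((1 - η) * r j) ^ q <
          r j ^ q - rule.balance * ((1 + 0) ^ q - 1) - 0 := by
        simp only [add_zero, one_pow, sub_self, mul_zero, sub_zero]
        refine pow_lt_pow_left₀ ?_ (mul_nonneg (by linarith [hη.2]) hrj.le) hq0
        nlinarith [hη.1]
      filter_upwards [h1.eventually_const_lt h2] with u hu _ using hu
  obtain ⟨c, hc, ρ₁, hρ₁, hbal⟩ := exists_le_pulls_of_balance hv s
  set ρ := min ρ₁ (u * c ^ q) with hρ
  have hρ0 : 0 < ρ := by positivity
  have hη' : 0 < min η u := lt_min hη.1 hu0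
  have hupper : ∀ᶠ n : ℕ in atTop, ∀ j, j ≠ s → ∀ p : Trajectory K, p.FollowsEBTC ε₀ rule →
      p.Concentrated μ n → (p.pulls n j : ℝ) ≤ (1 + min η u) * r j * p.pulls n s := by
    refine eventually_all.2 fun j => ?_
    by_cases hj : j = s
    · simp [hj]
    · filter_upwards [eventually_pulls_le hv hε₀ hs hr hη' hj] with n hn _ using hn
  have hcast : Tendsto (fun n : ℕ => (n : ℝ)) atTop atTop := tendsto_natCast_atTop_atTop
  filter_upwards [eventually_leader_and_balance hv hε₀ hs hρ0,
    eventually_abs_empMean_sub_le hv hε₀ μ hη.1, hupper, hcast.eventually_ge_atTop 4]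
    with n hn1 hn2 hn3 hn4 p h hcon
  have hsqle : √(n : ℝ) ≤ n := by
    rw [Real.sqrt_le_left (Nat.cast_nonneg n)]
    nlinarith
  obtain ⟨hKn, hBn, hbaln⟩ := hn1 p h hcon n hsqle le_rfl
  refine ⟨hKn, hBn, hn2 p h hcon n hKn hsqle le_rfl, fun j hj => ?_⟩
  have hrj := hr.pos j hj
  have hNs : c * n ≤ (p.pulls n s : ℝ) := by
    refine hbal p n (by exact_mod_cast hn4) (hbaln.trans ?_)
    gcongr
    exact min_le_left _ _
  set N : ℝ := (p.pulls n s : ℝ) with hN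
  have hNpos : 0 < N := lt_of_lt_of_le (by positivity) hNs
  constructor
  · have hmem : j ∈ Finset.univ.erase s := by simp [hj]
    have h1 := (abs_le.1 hbaln).2
    have h2 : ρ * (n : ℝ) ^ q ≤ u * N ^ q := by
      calc ρ * (n : ℝ) ^ q ≤ u * c ^ q * (n : ℝ) ^ q := by gcongr; exact min_le_right _ _
        _ = u * (c * n) ^ q := by rw [mul_pow]; ring
        _ ≤ u * N ^ q := by gcongr
    have h3 : ∑ k ∈ (Finset.univ.erase s).erase j, (p.pulls n k : ℝ) ^ q ≤
        (1 + u) ^ q * (rule.balance - r j ^ q) * N ^ q := by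
      have hb := Finset.add_sum_erase _ (fun k => r k ^ q) hmem
      rw [hr.balance] at hb
      have : rule.balance - r j ^ q = ∑ k ∈ (Finset.univ.erase s).erase j, r k ^ q := by linarith
      rw [this, Finset.mul_sum, Finset.sum_mul]
      refine Finset.sum_le_sum fun k hk => ?_
      have hks := Finset.ne_of_mem_erase (Finset.mem_of_mem_erase hk)
      have hrk := hr.pos k hks
      rw [← mul_pow, ← mul_pow]
      refine pow_le_pow_left₀ (Nat.cast_nonneg _) ((hn3 k hks p h hcon).trans ?_) q
      gcongr
      exact min_le_right _ _
    have h4 := Finset.add_sum_erase _ (fun k => (p.pulls n k : ℝ) ^ q) hmem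
    have h5 : 1 ≤ (1 + u) ^ q := one_le_pow₀ (by linarith)
    have h6 : (1 + u) ^ q * (rule.balance - r j ^ q) ≤
        rule.balance * (1 + u) ^ q - r j ^ q := by
      nlinarith [pow_pos hrj q]
    have h7 : (1 + u) ^ q * (rule.balance - r j ^ q) * N ^ q ≤
        (rule.balance * (1 + u) ^ q - r j ^ q) * N ^ q := by gcongr
    have h8 : ((1 - η) * r j) ^ q * N ^ q ≤
        (r j ^ q - rule.balance * ((1 + u) ^ q - 1) - u) * N ^ q := by
      gcongr
      exact (hu j hj).le
    have h9 : ((1 - η) * r j * N) ^ q ≤ (p.pulls n j : ℝ) ^ q := by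
      rw [mul_pow]
      linarith
    exact le_of_pow_le_pow_left₀ hq0 (Nat.cast_nonneg _) h9
  · refine (hn3 j hj p h hcon).trans ?_
    gcongr
    exact min_le_left _ _

end Trajectory

section OptimalRatio

variable {K : ℕ} {rule : Proportions} {ε₀ : ℝ}

/-- On concentrated trajectories, all the empirical transportation costs of the best arm grow at
any rate below the one of the optimal allocation. -/
lemma Trajectory.eventually_transportCost_ge (hv : rule.Valid) (hε₀ : 0 < ε₀) {ε : ℝ} (hε : 0 ≤ ε)
    {μ : Fin K → ℝ} {s : Fin K}
    (hs : ∀ j ≠ s, μ j < μ s) {r : Fin K → ℝ} {v₀ : ℝ} (hr : IsOptimalRatio rule ε₀ μ s r v₀)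
    {G : ℝ} (hG : ∀ j ≠ s, G * (1 + ∑ i ∈ Finset.univ.erase s, r i) <
      (μ s - μ j + ε) ^ 2 * (r j / (1 + r j))) :
    ∀ᶠ n : ℕ in atTop, ∀ p : Trajectory K, p.FollowsEBTC ε₀ rule → p.Concentrated μ n →
      K < n ∧ ∀ j ≠ p.B n, √(G * n) ≤ p.transportCost ε n (p.B n) j := by
  set R := ∑ i ∈ Finset.univ.erase s, r i with hR
  have hR0 : 0 ≤ R := Finset.sum_nonneg fun i hi => (hr.pos i (Finset.ne_of_mem_erase hi)).le
  obtain ⟨η, ⟨hη, hηΔ⟩, hη01⟩ : ∃ η, ((∀ j, j ≠ s → G * (1 + (1 + η) * R) <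
      (μ s - μ j + ε - 2 * η) ^ 2 * ((1 - η) * r j / (1 + (1 - η) * r j))) ∧
      (∀ j, j ≠ s → 0 < μ s - μ j + ε - 2 * η)) ∧ η ∈ Set.Ioo (0 : ℝ) 1 := by
    refine (((eventually_all.2 fun j => ?_).and (eventually_all.2 fun j => ?_)).and
      (Ioo_mem_nhdsGT one_pos)).exists (f := 𝓝[>] (0 : ℝ))
    · by_cases hj : j = s
      · simp [hj]
      · have hrj := hr.pos j hj
        have h1 : ContinuousAt (fun η : ℝ => (μ s - μ j + ε - 2 * η) ^ 2 *
            ((1 - η) * r j / (1 + (1 - η) * r j))) 0 := by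
          refine ContinuousAt.mul (by fun_prop) (ContinuousAt.div (by fun_prop) (by fun_prop) ?_)
          simp; positivity
        have h2 : ContinuousAt (fun η : ℝ => G * (1 + (1 + η) * R)) 0 := by fun_prop
        have h1' := h1.tendsto.mono_left (nhdsWithin_le_nhds (s := Set.Ioi 0))
        have h2' := h2.tendsto.mono_left (nhdsWithin_le_nhds (s := Set.Ioi 0))
        filter_upwards [h2'.eventually_lt h1' (by simpa using hG j hj)] with η hη _ using hη
    · by_cases hj : j = s
      · simp [hj]
      · have h1 : ContinuousAt (fun η : ℝ => μ s - μ j + ε - 2 * η) 0 := by fun_prop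
        have h1' := h1.tendsto.mono_left (nhdsWithin_le_nhds (s := Set.Ioi 0))
        filter_upwards [h1'.eventually_const_lt (u := 0) (by have := hs j hj; simp; linarith)]
          with η hη _ using hη
  -- the loss of one round between `n` and the number of pulls is absorbed by the strict inequality
  have hn : ∀ᶠ n : ℕ in atTop, ∀ j, j ≠ s → G * n * (1 + (1 + η) * R) ≤
      (n - 1 : ℝ) * ((μ s - μ j + ε - 2 * η) ^ 2 * ((1 - η) * r j / (1 + (1 - η) * r j))) := by
    refine eventually_all.2 fun j => ?_
    by_cases hj : j = s
    · simp [hj]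
    · set H := (μ s - μ j + ε - 2 * η) ^ 2 * ((1 - η) * r j / (1 + (1 - η) * r j)) with hH
      have hgap := hη j hj
      rw [← hH] at hgap
      filter_upwards [tendsto_natCast_atTop_atTop.eventually_ge_atTop
        (H / (H - G * (1 + (1 + η) * R)))] with n hn _
      rw [div_le_iff₀ (by linarith)] at hn
      linarith
  filter_upwards [eventually_ratio_mem hv hε₀ hs hr hη01, hn] with n hn1 hn2 p h hcon
  obtain ⟨hKn, hB, hmean, hratio⟩ := hn1 p h hcon
  refine ⟨hKn, fun j hj => ?_⟩
  rw [hB] at hj ⊢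
  have hrj := hr.pos j hj
  have hpos : ∀ i, (0 : ℝ) < p.pulls n i := fun i => by exact_mod_cast h.one_le_pulls hKn i
  set N : ℝ := (p.pulls n s : ℝ) with hN
  have hNpos : 0 < N := hpos s
  have hη1 : 0 < 1 - η := by linarith [hη01.2]
  have hη0 : 0 < η := hη01.1
  have hgap : μ s - μ j + ε - 2 * η ≤ p.empMean n s - p.empMean n j + ε := by
    have h1 := abs_le.1 (hmean s)
    have h2 := abs_le.1 (hmean j)
    linarith
  have hgap0 := hηΔ j hj
  have hNge : (n - 1 : ℝ) ≤ N * (1 + (1 + η) * R) := by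
    have h1 := p.sum_pulls_erase (n := n) (by omega) s
    have h2 : ∑ i ∈ Finset.univ.erase s, (p.pulls n i : ℝ) ≤
        ∑ i ∈ Finset.univ.erase s, (1 + η) * r i * N :=
      Finset.sum_le_sum fun i hi => (hratio i (Finset.ne_of_mem_erase hi)).2
    rw [← Finset.sum_mul, ← Finset.mul_sum, ← hR] at h2
    linarith
  unfold transportCost
  refine Real.sqrt_le_iff.2 ⟨div_nonneg (by linarith) (Real.sqrt_nonneg _), ?_⟩
  rw [div_pow, Real.sq_sqrt (by positivity), ← hN, sq_div_inv_add_inv hNpos (hpos j)]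
  have hx : (1 - η) * r j ≤ p.pulls n j / N := by
    rw [le_div_iff₀ hNpos]; exact (hratio j hj).1
  have h1 : (μ s - μ j + ε - 2 * η) ^ 2 * ((1 - η) * r j / (1 + (1 - η) * r j)) ≤
      (p.empMean n s - p.empMean n j + ε) ^ 2 *
        (p.pulls n j / N / (1 + p.pulls n j / N)) := by
    have h2 := div_one_add_le_div_one_add (by positivity) hx
    gcongr
  have h3 := hn2 j hj
  set H := (μ s - μ j + ε - 2 * η) ^ 2 * ((1 - η) * r j / (1 + (1 - η) * r j)) with hH
  have hH0 : 0 ≤ H := by positivity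
  have h4 : (n - 1 : ℝ) * H ≤ N * (1 + (1 + η) * R) * H := by gcongr
  have h5 : G * n ≤ N * H := by
    have h6 : 0 < 1 + (1 + η) * R := by positivity
    refine le_of_mul_le_mul_right ?_ h6
    linarith
  exact h5.trans (by gcongr)

/-! ### Existence of the optimal allocation -/

/-- The optimal ratios exist: in terms of the common value `v` of the costs, `r_j = v / (d_j² - v)`,
and the balance equation has a solution `v < min d_j²` by the intermediate value theorem. -/
lemma exists_isOptimalRatio (hK : 2 ≤ K) (hv : rule.Valid) (hε₀ : 0 < ε₀) {μ : Fin K → ℝ}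
    {s : Fin K} (hs : ∀ j ≠ s, μ j < μ s) : ∃ r v₀, IsOptimalRatio rule ε₀ μ s r v₀ := by
  have hq0 := rule.exponent_ne_zero
  have hb0 := hv.balance_pos
  have hne : (Finset.univ.erase s).Nonempty := by
    rw [← Finset.card_pos, Finset.card_erase_of_mem (Finset.mem_univ s), Finset.card_univ,
      Fintype.card_fin]
    omega
  set g : Fin K → ℝ := fun j => (μ s - μ j + ε₀) ^ 2 with hg
  obtain ⟨j₀, hj₀, hmin⟩ := Finset.exists_min_image (Finset.univ.erase s) g hne
  have hgpos : ∀ j ≠ s, 0 < g j := fun j hj => by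
    have := hs j hj
    simp only [hg]
    have : 0 < μ s - μ j + ε₀ := by linarith
    positivity
  have hm := hgpos j₀ (Finset.ne_of_mem_erase hj₀)
  set m := g j₀ with hm'
  set x := max 1 rule.balance with hx
  have hx1 : 1 ≤ x := le_max_left _ _
  set v₁ := m * (x / (1 + x)) with hv₁
  have hv₁m : v₁ < m := by
    rw [hv₁]
    refine mul_lt_of_lt_one_right hm ?_
    rw [div_lt_one (by linarith)]
    linarith
  have hv₁0 : 0 < v₁ := by positivity
  set F : ℝ → ℝ := fun v => ∑ j ∈ Finset.univ.erase s, (v / (g j - v)) ^ rule.exponent with hF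
  have hcont : ContinuousOn F (Set.Icc 0 v₁) := by
    refine continuousOn_finsetSum _ fun j hj => ContinuousOn.pow (ContinuousOn.div (by fun_prop)
      (by fun_prop) fun v hv => ?_) _
    have := hmin j hj
    have := hv.2
    linarith
  have hF0 : F 0 ≤ rule.balance := by
    simp only [hF, zero_div, zero_pow hq0, Finset.sum_const_zero]
    exact hb0.le
  have hF1 : rule.balance ≤ F v₁ := by
    have hterm : v₁ / (g j₀ - v₁) = x := by
      rw [← hm', hv₁]
      field_simp
      ring
    calc rule.balance ≤ x := le_max_right _ _
      _ ≤ x ^ rule.exponent := le_self_pow₀ hx1 hq0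
      _ = (v₁ / (g j₀ - v₁)) ^ rule.exponent := by rw [hterm]
      _ ≤ F v₁ := Finset.single_le_sum (f := fun j => (v₁ / (g j - v₁)) ^ rule.exponent)
          (fun j hj => pow_nonneg (div_nonneg hv₁0.le (by linarith [hmin j hj])) _) hj₀
  obtain ⟨v, hvmem, hvF⟩ := intermediate_value_Icc hv₁0.le hcont ⟨hF0, hF1⟩
  have hv0 : 0 < v := by
    refine lt_of_le_of_ne hvmem.1 fun h0 => ?_
    rw [← h0] at hvF
    simp only [hF, zero_div, zero_pow hq0, Finset.sum_const_zero] at hvF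
    linarith
  have hgv : ∀ j ≠ s, 0 < g j - v := fun j hj => by
    have := hmin j (by simp [hj])
    have := hvmem.2
    linarith
  refine ⟨fun j => v / (g j - v), v, fun j hj => div_pos hv0 (hgv j hj), hv0, fun j hj => ?_, hvF⟩
  change g j * (v / (g j - v) / (1 + v / (g j - v))) = v
  have h1 := hgv j hj
  have h2 := hgpos j hj
  have h3 : 1 + v / (g j - v) = g j / (g j - v) := by field_simp; ring
  rw [h3, div_div_div_cancel_right₀ h1.ne', mul_div_cancel₀ _ h2.ne']

/-! ### Lower bounds on the characteristic times -/

/-- With the proportion of the best arm fixed at `β`, no allocation has a value above the one of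
the optimal ratios. -/
lemma IsOptimalRatio.exists_cost_le_fixed {β : ℝ} (hβ : β ∈ Set.Ioo (0 : ℝ) 1) {μ : Fin K → ℝ}
    {s : Fin K} {r : Fin K → ℝ} {v₀ : ℝ} (hr : IsOptimalRatio (.fixed β) ε₀ μ s r v₀) (hK : 2 ≤ K)
    {w : Fin K → ℝ} (hw : w ∈ stdSimplex ℝ (Fin K)) (hws : w s = β) :
    ∃ j ≠ s, 0 < w j → (μ s - μ j + ε₀) ^ 2 / (1 / β + 1 / w j) ≤
      v₀ / (1 + ∑ i ∈ Finset.univ.erase s, r i) := by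
  have hbal := hr.balance
  simp only [Proportions.exponent, Proportions.balance, pow_one] at hbal
  have hβ0 : 0 < β := hβ.1
  have hne : (Finset.univ.erase s).Nonempty := by
    rw [← Finset.card_pos, Finset.card_erase_of_mem (Finset.mem_univ s), Finset.card_univ,
      Fintype.card_fin]
    omega
  have hsum : ∑ j ∈ Finset.univ.erase s, w j = ∑ j ∈ Finset.univ.erase s, β * r j := by
    have h1 := Finset.add_sum_erase Finset.univ w (Finset.mem_univ s)
    rw [hw.2, hws] at h1
    rw [← Finset.mul_sum, hbal]
    field_simp
    linarith
  obtain ⟨j, hj, hle⟩ := Finset.exists_le_of_sum_le hne hsum.le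
  have hjs := Finset.ne_of_mem_erase hj
  refine ⟨j, hjs, fun hwj => ?_⟩
  have hrj := hr.pos j hjs
  rw [hbal, ← hr.equal j hjs]
  calc (μ s - μ j + ε₀) ^ 2 / (1 / β + 1 / w j)
      ≤ (μ s - μ j + ε₀) ^ 2 / (1 / β + 1 / (β * r j)) := by gcongr
    _ = (μ s - μ j + ε₀) ^ 2 * (r j / (1 + r j)) / (1 + (1 - β) / β) := by
      have : 1 + (1 - β) / β = 1 / β := by field_simp; ring
      rw [this]
      field_simp
      ring

/-- No allocation has a value above the one of the optimal ratios for IDS. The costs are concave and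
homogeneous in the allocation, and at the optimal ratios a positive combination of their gradients
is constant. -/
lemma IsOptimalRatio.exists_cost_le_ids {μ : Fin K → ℝ}
    {s : Fin K} {r : Fin K → ℝ} {v₀ : ℝ} (hr : IsOptimalRatio .ids ε₀ μ s r v₀) (hK : 2 ≤ K)
    {w : Fin K → ℝ} (hw : w ∈ stdSimplex ℝ (Fin K)) (hws : 0 < w s) :
    ∃ j ≠ s, 0 < w j → (μ s - μ j + ε₀) ^ 2 / (1 / w s + 1 / w j) ≤
      v₀ / (1 + ∑ i ∈ Finset.univ.erase s, r i) := by
  have hbal := hr.balance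
  simp only [Proportions.exponent, Proportions.balance] at hbal
  set R := ∑ i ∈ Finset.univ.erase s, r i with hR
  have hR0 : 0 ≤ R := Finset.sum_nonneg fun i hi => (hr.pos i (Finset.ne_of_mem_erase hi)).le
  have hne : (Finset.univ.erase s).Nonempty := by
    rw [← Finset.card_pos, Finset.card_erase_of_mem (Finset.mem_univ s), Finset.card_univ,
      Fintype.card_fin]
    omega
  have hsum : ∑ j ∈ Finset.univ.erase s, (w s * r j ^ 2 + w j) ≤
      ∑ j ∈ Finset.univ.erase s, (r j + r j ^ 2) / (1 + R) := by
    have h1 := Finset.add_sum_erase Finset.univ w (Finset.mem_univ s)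
    rw [hw.2] at h1
    rw [Finset.sum_add_distrib, ← Finset.mul_sum, hbal, ← Finset.sum_div, Finset.sum_add_distrib,
      hbal, ← hR, add_comm R 1, div_self (by positivity)]
    linarith
  obtain ⟨j, hj, hle⟩ := Finset.exists_le_of_sum_le hne hsum
  have hjs := Finset.ne_of_mem_erase hj
  refine ⟨j, hjs, fun hwj => ?_⟩
  have hrj := hr.pos j hjs
  rw [← hr.equal j hjs, mul_div_assoc, div_eq_mul_inv]
  refine mul_le_mul_of_nonneg_left ?_ (sq_nonneg _)
  have hinv : (1 / w s + 1 / w j)⁻¹ = w s * w j / (w s + w j) := by field_simp; ring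
  have htangent : w s * w j / (w s + w j) ≤ (w s * r j ^ 2 + w j) / (1 + r j) ^ 2 := by
    rw [div_le_div_iff₀ (by positivity) (by positivity)]
    nlinarith [sq_nonneg (w s * r j - w j)]
  rw [hinv]
  refine htangent.trans ?_
  calc (w s * r j ^ 2 + w j) / (1 + r j) ^ 2 ≤ (r j + r j ^ 2) / (1 + R) / (1 + r j) ^ 2 := by
        gcongr
    _ = r j / (1 + r j) / (1 + R) := by field_simp

/-- A lower bound on the characteristic times of all the good arms, from an upper bound on the
value of the allocations for the best arm: exchanging the roles of an arm and of the best arm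
increases the value. -/
lemma le_charTimeArm {μ : Fin K → ℝ} {s i : Fin K} {β v : ℝ} (hs : ∀ j, μ j ≤ μ s)
    (hi : μ s - ε₀ ≤ μ i) (hβ : 0 < β) (hv : 0 < v)
    (hcost : ∀ w ∈ stdSimplex ℝ (Fin K), w s = β → ∃ j ≠ s, 0 < w j →
      (μ s - μ j + ε₀) ^ 2 / (1 / β + 1 / w j) ≤ v) :
    ENNReal.ofReal (2 / v) ≤ charTimeArm ε₀ β μ i := by
  unfold charTimeArm
  rw [← inv_inv (ENNReal.ofReal (2 / v)), ENNReal.inv_le_inv,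
    ← ENNReal.ofReal_inv_of_pos (by positivity), inv_div]
  refine iSup₂_le fun w hw => ?_
  obtain ⟨hw, hwi⟩ := hw
  set σ := Equiv.swap s i with hσ
  have hw' : w ∘ σ ∈ stdSimplex ℝ (Fin K) :=
    ⟨fun k => hw.1 _, by rw [← hw.2]; exact Equiv.sum_comp σ w⟩
  obtain ⟨j, hjs, hj⟩ := hcost (w ∘ σ) hw' (by simp [hσ, hwi])
  have hσj : σ j ≠ i := by
    intro h
    apply hjs
    rw [← σ.symm_apply_apply j, h]
    simp [hσ]
  refine (iInf₂_le (σ j) hσj).trans ?_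
  rcases (hw.1 (σ j)).eq_or_lt' with h0 | hpos
  · rw [h0]
    simp
  · have hle := hj hpos
    have hgap : (μ i - μ (σ j) + ε₀) ^ 2 ≤ (μ s - μ j + ε₀) ^ 2 := by
      by_cases hji : j = i
      · have : σ j = s := by rw [hji]; simp [hσ]
        rw [this, hji]
        refine pow_le_pow_left₀ (by linarith) (by linarith [hs i]) 2
      · have : σ j = j := Equiv.swap_apply_of_ne_of_ne hjs hji
        rw [this]
        refine pow_le_pow_left₀ (by linarith [hs j]) (by linarith [hs i]) 2
    have hden : 1 / ENNReal.ofReal β + 1 / ENNReal.ofReal (w (σ j)) =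
        ENNReal.ofReal (1 / β + 1 / w (σ j)) := by
      rw [ENNReal.ofReal_add (by positivity) (by positivity), ENNReal.ofReal_div_of_pos hβ,
        ENNReal.ofReal_div_of_pos hpos, ENNReal.ofReal_one]
    have hhalf : (1 / 2 : ℝ≥0∞) = ENNReal.ofReal (1 / 2) := by
      rw [ENNReal.ofReal_div_of_pos (by norm_num)]; simp
    rw [hden, ← ENNReal.ofReal_div_of_pos (by positivity), hhalf,
      ← ENNReal.ofReal_mul (by norm_num)]
    refine ENNReal.ofReal_le_ofReal ?_
    have : (μ i - μ (σ j) + ε₀) ^ 2 / (1 / β + 1 / w (σ j)) ≤ v := by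
      refine le_trans ?_ hle
      simp only [Function.comp_apply]
      gcongr
    linarith

end OptimalRatio

/-! ### Bounds on the threshold -/

lemma gaussC_le {l : ℝ} (hl : l ∈ Set.Ioo (1 / 2 : ℝ) 1) (x : ℝ) :
    gaussC x ≤ (gaussG l + x) / l := by
  refine ciInf_le (f := fun l : Set.Ioo (1 / 2 : ℝ) 1 => (gaussG l + x) / l) ?_ ⟨l, hl⟩
  refine ⟨-(2 * |x - 2|), ?_⟩
  rintro _ ⟨⟨y, hy1, hy2⟩, rfl⟩
  have hy0 : 0 < y := by linarith
  have h1 : 0 ≤ Real.log (riemannZeta ((2 * y : ℝ) : ℂ)).re :=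
    Real.log_nonneg (one_le_riemannZeta_re (by linarith))
  have h2 : Real.log (1 - y) ≤ 0 := Real.log_nonpos (by linarith) (by linarith)
  have h3 : Real.log (4 * y) ≤ 2 := by
    have : Real.log (4 * y) = 2 * Real.log 2 + Real.log y := by
      rw [Real.log_mul (by norm_num) hy0.ne', ← Real.log_rpow (by norm_num)]; norm_num
    rw [this]
    have := Real.log_two_lt_d9
    have := Real.log_nonpos hy0.le hy2.le
    linarith
  have h4 : -2 ≤ gaussG y := by
    unfold gaussG
    nlinarith
  simp only
  rw [le_div_iff₀ hy0]
  have h5 : -|x - 2| ≤ x - 2 := neg_abs_le _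
  nlinarith [abs_nonneg (x - 2)]

/-- For small `δ` the threshold is essentially `log (1 / δ)`. -/
lemma threshold_le {K : ℕ} (hK : 2 ≤ K) {l : ℝ} (hl : l ∈ Set.Ioo (1 / 2 : ℝ) 1) {n : ℕ}
    (hn : K < n) {δ : ℝ} (hδ : 0 < δ) :
    threshold K ((n : ℝ) - 1) δ ≤ Real.log (1 / δ) / l +
      ((2 * gaussG l + Real.log ((K : ℝ) - 1)) / l + 4 * (4 + Real.log n)) := by
  have hK' : (2 : ℝ) ≤ K := by exact_mod_cast hK
  have hn' : (3 : ℝ) ≤ n := by exact_mod_cast (by omega : 3 ≤ n)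
  have h1 := gaussC_le hl (Real.log (((K : ℝ) - 1) / δ) / 2)
  have h2 : Real.log (((K : ℝ) - 1) / δ) = Real.log ((K : ℝ) - 1) + Real.log (1 / δ) := by
    rw [← Real.log_mul (by linarith) (by positivity)]
    ring_nf
  have h3 : Real.log (((n : ℝ) - 1) / 2) ≤ Real.log n :=
    Real.log_le_log (by linarith) (by linarith)
  have h4 : 0 ≤ Real.log (((n : ℝ) - 1) / 2) := Real.log_nonneg (by linarith)
  have h5 := Real.log_le_self (show 0 ≤ 4 + Real.log (((n : ℝ) - 1) / 2) by linarith)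
  unfold threshold
  have h6 : 2 * ((gaussG l + Real.log (((K : ℝ) - 1) / δ) / 2) / l) =
      Real.log (1 / δ) / l + (2 * gaussG l + Real.log ((K : ℝ) - 1)) / l := by
    rw [h2]; ring
  linarith

lemma eventually_const_add_log_le {a b c e : ℝ} (hc : 0 < c) (he : 0 < e) :
    ∀ᶠ n : ℕ in atTop, a + b * Real.log n ≤ c * (n : ℝ) ^ e := by
  have hcast : Tendsto (fun n : ℕ => (n : ℝ)) atTop atTop := tendsto_natCast_atTop_atTop
  have h1 : (fun x : ℝ => a + b * Real.log x) =o[atTop] fun x : ℝ => x ^ e :=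
    ((Asymptotics.isLittleO_const_left.2 (Or.inr
      (tendsto_norm_atTop_atTop.comp (tendsto_rpow_atTop he))))).add
      ((isLittleO_log_rpow_atTop he).const_mul_left b)
  filter_upwards [hcast.eventually (h1.bound hc)] with n hn
  refine (le_abs_self _).trans ?_
  simpa [Real.norm_eq_abs, abs_of_nonneg (Real.rpow_nonneg (Nat.cast_nonneg n) e)] using hn

/-! ### Probability of concentration -/

lemma IsInteraction.eventually_measure_not_concentrated_le {Ω : Type*} {mΩ : MeasurableSpace Ω}
    {K : ℕ} (hK : 2 ≤ K) {P : Measure Ω} [IsProbabilityMeasure P] {ν : Fin K → Measure ℝ}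
    {ℱ : Filtration ℕ mΩ} {p : Ω → Trajectory K} (h : IsInteraction P ν ℱ p)
    (hν : ∀ i, IsOneSubGaussian (ν i)) {ε₀ : ℝ} {rule : Proportions}
    (hA : ∀ ω, (p ω).FollowsEBTC ε₀ rule) :
    ∀ᶠ n : ℕ in atTop, P {ω | ¬ (p ω).Concentrated (means ν) n} ≤
      ENNReal.ofReal (K * (1 / (n : ℝ) ^ 2)) := by
  have hl : (3 / 4 : ℝ) ∈ Set.Ioo (1 / 2 : ℝ) 1 := ⟨by norm_num, by norm_num⟩
  filter_upwards [eventually_const_add_log_le (a := 16 + 2 * gaussG (3 / 4) / (3 / 4))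
    (b := 4 + 2 / (3 / 4)) one_pos (show (0 : ℝ) < 1 / 8 by norm_num), eventually_ge_atTop 1]
    with n hn hn1
  rw [one_mul] at hn
  have hother : ∀ i : Fin K, ∃ j, i ≠ j := by
    intro i
    have : Nontrivial (Fin K) := Fin.nontrivial_iff_two_le.2 hK
    obtain ⟨j, hj⟩ := exists_ne i
    exact ⟨j, hj.symm⟩
  choose o ho using hother
  have hn0 : (0 : ℝ) < n := by exact_mod_cast hn1
  have hsub : {ω | ¬ (p ω).Concentrated (means ν) n} ⊆ ⋃ i ∈ (Finset.univ : Finset (Fin K)),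
      {ω | ∃ n' ≥ 1, 1 ≤ (p ω).pulls n' i ∧ 1 ≤ (p ω).pulls n' (o i) ∧
      2 * Real.log (4 + Real.log ((p ω).pulls n' i)) +
        2 * Real.log (4 + Real.log ((p ω).pulls n' (o i))) +
          (2 * gaussG (3 / 4) + 2 * Real.log n) / (3 / 4) ≤
      (p ω).selfNorm (means ν) n' i + (p ω).selfNorm (means ν) n' (o i)} := by
    intro ω hω
    simp only [Set.mem_ofPred_eq, Trajectory.Concentrated] at hω
    push Not at hω
    obtain ⟨t, hKt, htn, i, hi⟩ := hω
    refine Set.mem_biUnion (Finset.mem_univ i) ⟨t, by omega, (hA ω).one_le_pulls hKt i,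
      (hA ω).one_le_pulls hKt (o i), ?_⟩
    have hlog : ∀ j, 2 * Real.log (4 + Real.log ((p ω).pulls t j)) ≤ 2 * (4 + Real.log n) := by
      intro j
      have h1 : (1 : ℝ) ≤ (p ω).pulls t j := by exact_mod_cast (hA ω).one_le_pulls hKt j
      have h2 : ((p ω).pulls t j : ℝ) ≤ n := by
        exact_mod_cast ((p ω).pulls_le t j).trans (by omega)
      have h3 := Real.log_nonneg h1
      have h4 := Real.log_le_log (by linarith) h2
      have h5 := Real.log_le_self (show 0 ≤ 4 + Real.log ((p ω).pulls t j) by linarith)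
      linarith
    have h1 := hlog i
    have h2 := hlog (o i)
    have h3 := (p ω).selfNorm_nonneg (means ν) t (o i)
    have h4 : (2 * gaussG (3 / 4) + 2 * Real.log n) / (3 / 4) =
      2 * gaussG (3 / 4) / (3 / 4) + 2 / (3 / 4) * Real.log n := by ring
    rw [h4]
    linarith
  calc P {ω | ¬ (p ω).Concentrated (means ν) n}
      ≤ ∑ i : Fin K, ENNReal.ofReal (Real.exp (-(2 * Real.log n))) :=
        (measure_mono hsub).trans ((measure_biUnion_finset_le _ _).trans
          (Finset.sum_le_sum fun i _ => h.pair_deviation hν (ho i) hl (2 * Real.log n)))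
    _ = ENNReal.ofReal (K * (1 / (n : ℝ) ^ 2)) := by
        rw [Finset.sum_const, Finset.card_univ, Fintype.card_fin, nsmul_eq_mul,
          ENNReal.ofReal_mul (Nat.cast_nonneg K), ENNReal.ofReal_natCast]
        congr 2
        rw [Real.exp_neg, one_div, two_mul, Real.exp_add, Real.exp_log hn0, sq]

/-! ### Expected stopping time -/

/-- If `τ ≤ n` whenever `n ≥ N` and `E n` holds, then `τ` exceeds `N` at most by the number of
times at which `E` fails. -/
lemma enat_le_add_tsum {τ : ℕ∞} {E : ℕ → Prop} {N : ℕ} (h : ∀ n ≥ N, E n → τ ≤ n) :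
    (τ : ℝ≥0∞) ≤ N + ∑' k : ℕ, {k | ¬ E (N + k)}.indicator 1 k := by
  classical
  by_cases hE : ∃ k, E (N + k)
  · have h1 : (τ : ℝ≥0∞) ≤ ((N + Nat.find hE : ℕ) : ℝ≥0∞) := by
      have := h (N + Nat.find hE) (by omega) (Nat.find_spec hE)
      exact_mod_cast ENat.toENNReal_le.2 this
    refine h1.trans ?_
    push_cast
    gcongr
    calc ((Nat.find hE : ℕ) : ℝ≥0∞) =
          ∑ k ∈ Finset.range (Nat.find hE), {k | ¬ E (N + k)}.indicator (1 : ℕ → ℝ≥0∞) k := by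
          rw [Finset.sum_congr rfl (g := fun _ => 1) fun k hk => ?_]
          · simp
          · have := Nat.find_min hE (Finset.mem_range.1 hk)
            simp [this]
      _ ≤ _ := ENNReal.sum_le_tsum _
  · push Not at hE
    have : ∑' k : ℕ, {k | ¬ E (N + k)}.indicator (1 : ℕ → ℝ≥0∞) k = ⊤ := by
      simp [hE]
    rw [this]
    simp

lemma lintegral_enat_le {Ω : Type*} [MeasurableSpace Ω] {P : Measure Ω} [IsProbabilityMeasure P]
    {τ : Ω → ℕ∞} {E : ℕ → Ω → Prop} {N : ℕ} (h : ∀ n ≥ N, ∀ ω, E n ω → τ ω ≤ n) :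
    ∫⁻ ω, (τ ω : ℝ≥0∞) ∂P ≤ N + ∑' k : ℕ, P {ω | ¬ E (N + k) ω} := by
  have hpt : ∀ ω, (τ ω : ℝ≥0∞) ≤
      N + ∑' k : ℕ, (toMeasurable P {ω | ¬ E (N + k) ω}).indicator 1 ω := by
    intro ω
    refine (enat_le_add_tsum fun n hn => h n hn ω).trans ?_
    gcongr with k
    by_cases hk : E (N + k) ω
    · simp [hk]
    · have : ω ∈ toMeasurable P {ω | ¬ E (N + k) ω} := subset_toMeasurable _ _ hk
      simp [hk, this]
  refine (lintegral_mono hpt).trans ?_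
  rw [lintegral_add_left measurable_const, lintegral_const, measure_univ, mul_one,
    lintegral_tsum fun k => (measurable_one.indicator (measurableSet_toMeasurable _ _)).aemeasurable]
  gcongr with k
  rw [lintegral_indicator_one (measurableSet_toMeasurable _ _), measure_toMeasurable]

/-! ### Asymptotic bounds -/

lemma lt_of_bestArms_eq {K : ℕ} {μ : Fin K → ℝ} {s : Fin K} (h : bestArms μ = {s}) :
    bestMean μ = μ s ∧ ∀ j ≠ s, μ j < μ s := by
  have hs : s ∈ bestArms μ := by rw [h]; rfl
  have h1 : bestMean μ - 0 ≤ μ s := hs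
  have h2 : μ s ≤ bestMean μ := le_ciSup (Finite.bddAbove_range μ) s
  refine ⟨by linarith, fun j hj => ?_⟩
  by_contra hlt
  push Not at hlt
  have : j ∈ bestArms μ := by
    change bestMean μ - 0 ≤ μ j
    linarith
  rw [h] at this
  exact hj this

lemma sq_le_slackFactor {K : ℕ} {ε ε₀ : ℝ} (hε : 0 ≤ ε) (hε₀ : 0 < ε₀) {μ : Fin K → ℝ} {s : Fin K}
    (hbest : bestMean μ = μ s) (hs : ∀ j ≠ s, μ j < μ s) {j : Fin K} (hj : j ≠ s) :
    ((μ s - μ j + ε₀) / (μ s - μ j + ε)) ^ 2 ≤ slackFactor ε ε₀ μ s := by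
  have h1 := hs j hj
  have h2 : (ε₀ - ε) / (bestMean μ - μ j + ε) ≤
      ⨆ i : {i : Fin K // i ≠ s}, (ε₀ - ε) / (bestMean μ - μ i + ε) :=
    le_ciSup (f := fun i : {i : Fin K // i ≠ s} => (ε₀ - ε) / (bestMean μ - μ i + ε))
      (Set.finite_range _).bddAbove ⟨j, hj⟩
  unfold slackFactor
  have h3 : 0 < μ s - μ j + ε := by linarith
  refine pow_le_pow_left₀ (div_nonneg (by linarith) h3.le) ?_ 2
  have h4 : (μ s - μ j + ε₀) / (μ s - μ j + ε) = 1 + (ε₀ - ε) / (bestMean μ - μ j + ε) := by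
    rw [hbest]; field_simp; ring
  linarith

/-- The asymptotic bound in terms of a rate `G` below which the transportation costs of the best arm
grow on concentrated trajectories. -/
lemma limsup_lintegral_glrTime_le {K : ℕ} (hK : 2 ≤ K) {ε ε₀ : ℝ} {rule : Proportions}
    {ν : Fin K → Measure ℝ} (hν : ∀ i, IsOneSubGaussian (ν i)) {G₀ : ℝ} (hG₀ : 0 < G₀)
    (hcost : ∀ G < G₀, ∀ᶠ n : ℕ in atTop, ∀ p : Trajectory K, p.FollowsEBTC ε₀ rule →
      p.Concentrated (means ν) n → K < n ∧ ∀ j ≠ p.B n, √(G * n) ≤ p.transportCost ε n (p.B n) j) :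
    AsymptoticBound.{u} (ebtc K ε₀ rule) (fun δ p => p.glrTime ε δ) ν
      (ENNReal.ofReal (2 / G₀)) := by
  intro Ω mΩ P _ ℱ p h hA
  have hlim : ∀ a > 2 / G₀, limsup (fun δ : ℝ => (∫⁻ ω, ((p ω).glrTime ε δ : ℝ≥0∞) ∂P) /
      ENNReal.ofReal (Real.log (1 / δ))) (𝓝[>] 0) ≤ ENNReal.ofReal a := by
    intro a ha
    have ha0 : 0 < a := lt_trans (by positivity) ha
    -- room for the growth rate of the costs and for the parameter of the threshold
    obtain ⟨u, ⟨hua, huG⟩, hu0, hu1⟩ : ∃ u : ℝ, (2 / ((1 - u) * (G₀ - 2 * u)) < a ∧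
        0 < G₀ - 2 * u) ∧ u ∈ Set.Ioo (0 : ℝ) (1 / 2) := by
      have h1 : ContinuousAt (fun u : ℝ => 2 / ((1 - u) * (G₀ - 2 * u))) 0 :=
        ContinuousAt.div (by fun_prop) (by fun_prop) (by simp; exact hG₀.ne')
      have h2 : ContinuousAt (fun u : ℝ => G₀ - 2 * u) 0 := by fun_prop
      have h1' := h1.tendsto.mono_left (nhdsWithin_le_nhds (s := Set.Ioi 0))
      have h2' := h2.tendsto.mono_left (nhdsWithin_le_nhds (s := Set.Ioi 0))
      exact (((h1'.eventually_lt_const (by simpa using ha)).and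
        (h2'.eventually_const_lt (by simpa using hG₀))).and
        (Ioo_mem_nhdsGT (by norm_num))).exists
    have hl : 1 - u ∈ Set.Ioo (1 / 2 : ℝ) 1 := ⟨by linarith, by linarith⟩
    have hl0 : 0 < 1 - u := by linarith
    set A := (2 * gaussG (1 - u) + Real.log ((K : ℝ) - 1)) / (1 - u) with hAdef
    have hsumm : Summable fun k : ℕ => (K : ℝ) * (1 / ((k : ℝ) + 1) ^ 2) := by
      have := (summable_zeta_real (s := 2) one_lt_two).mul_left (K : ℝ)
      simpa using this
    set C := ∑' k : ℕ, (K : ℝ) * (1 / ((k : ℝ) + 1) ^ 2) with hC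
    have hC0 : 0 ≤ C := tsum_nonneg fun k => by positivity
    obtain ⟨n₀, hn₀⟩ := eventually_atTop.1 ((hcost (G₀ - u) (by linarith)).and
      ((h.eventually_measure_not_concentrated_le hK hν hA).and
        ((eventually_const_add_log_le (a := 2 * (A + 16)) (b := 8) hu0 one_pos).and
          (eventually_ge_atTop 1))))
    set M := 2 / ((1 - u) * (G₀ - 2 * u)) with hM
    have hM0 : 0 < M := by positivity
    have hbound : ∀ δ : ℝ, 0 < δ → 0 ≤ Real.log (1 / δ) →
        ∫⁻ ω, ((p ω).glrTime ε δ : ℝ≥0∞) ∂P ≤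
          ENNReal.ofReal (M * Real.log (1 / δ) + 1 + n₀ + C) := by
      intro δ hδ hL
      set L := Real.log (1 / δ) with hLdef
      set N := max n₀ ⌈M * L⌉₊ with hN
      have hglr : ∀ n ≥ N, ∀ ω, (p ω).Concentrated (means ν) n → (p ω).glrTime ε δ ≤ n := by
        intro n hn ω hc
        obtain ⟨h1, -, h3, -⟩ := hn₀ n ((le_max_left _ _).trans hn)
        obtain ⟨hKn, hZ⟩ := h1 (p ω) (hA ω) hc
        refine iInf₂_le n ⟨hKn, fun i hi => (Real.sqrt_le_sqrt ?_).trans (hZ i hi)⟩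
        have h4 := threshold_le hK hl hKn hδ
        rw [← hAdef, ← hLdef] at h4
        rw [Real.rpow_one] at h3
        have h5 : M * L ≤ n := (Nat.le_ceil _).trans
          (by exact_mod_cast (le_max_right n₀ ⌈M * L⌉₊).trans hn)
        have h6 : 2 * (L / (1 - u)) = M * L * (G₀ - 2 * u) := by
          rw [hM]; field_simp
        have h7 : M * L * (G₀ - 2 * u) ≤ n * (G₀ - 2 * u) := by gcongr
        linarith
      refine (lintegral_enat_le (E := fun n ω => (p ω).Concentrated (means ν) n) hglr).trans ?_
      have htail : ∑' k : ℕ, P {ω | ¬ (p ω).Concentrated (means ν) (N + k)} ≤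
          ENNReal.ofReal C := by
        rw [hC, ENNReal.ofReal_tsum_of_nonneg (fun k => by positivity) hsumm]
        refine ENNReal.tsum_le_tsum fun k => ?_
        obtain ⟨-, h2, -, -⟩ := hn₀ (N + k) ((le_max_left n₀ _).trans (Nat.le_add_right N k))
        have hN1 : 1 ≤ N := (hn₀ n₀ le_rfl).2.2.2.trans (le_max_left n₀ _)
        refine h2.trans (ENNReal.ofReal_le_ofReal ?_)
        have : (k : ℝ) + 1 ≤ ((N + k : ℕ) : ℝ) := by exact_mod_cast (by omega : k + 1 ≤ N + k)
        gcongr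
      refine (add_le_add_right htail _).trans ?_
      rw [← ENNReal.ofReal_natCast, ← ENNReal.ofReal_add (Nat.cast_nonneg _) hC0]
      refine ENNReal.ofReal_le_ofReal ?_
      have h8 : (N : ℝ) ≤ n₀ + ⌈M * L⌉₊ := by
        exact_mod_cast max_le_add_of_nonneg (Nat.zero_le _) (Nat.zero_le _)
      have h9 := (Nat.ceil_lt_add_one (mul_nonneg hM0.le hL)).le
      linarith
    refine limsup_le_of_le (by isBoundedDefault) ?_
    have hLlim : Tendsto (fun δ : ℝ => Real.log (1 / δ)) (𝓝[>] 0) atTop := by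
      have := tendsto_neg_atBot_atTop.comp Real.tendsto_log_nhdsGT_zero
      refine this.congr fun δ => ?_
      simp
    filter_upwards [hLlim.eventually_ge_atTop ((1 + n₀ + C) / (a - M)),
      hLlim.eventually_gt_atTop 0, self_mem_nhdsWithin] with δ h1 h2 hδ
    refine ENNReal.div_le_of_le_mul ?_
    rw [← ENNReal.ofReal_mul ha0.le]
    refine (hbound δ hδ h2.le).trans (ENNReal.ofReal_le_ofReal ?_)
    rw [div_le_iff₀ (by linarith)] at h1
    linarith
  have hcont : Tendsto (fun a : ℝ => ENNReal.ofReal a) (𝓝[>] (2 / G₀))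
      (𝓝 (ENNReal.ofReal (2 / G₀))) :=
    (ENNReal.continuous_ofReal.tendsto _).mono_left nhdsWithin_le_nhds
  exact ge_of_tendsto hcont (eventually_mem_nhdsWithin.mono fun a ha => hlim a ha)

/-- The asymptotic bound for the optimal ratios `r`, whose allocation has the value
`v₀ / (1 + ∑ r)`. -/
lemma asymptoticBound_of_isOptimalRatio {K : ℕ} (hK : 2 ≤ K) {ε ε₀ : ℝ} (hε : 0 ≤ ε)
    (hε₀ : 0 < ε₀) {rule : Proportions} (hv : rule.Valid) {ν : Fin K → Measure ℝ}
    (hν : ∀ i, IsOneSubGaussian (ν i)) {s : Fin K} (hbest : bestArms (means ν) = {s})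
    {r : Fin K → ℝ} {v₀ : ℝ} (hr : IsOptimalRatio rule ε₀ (means ν) s r v₀) {T : ℝ≥0∞}
    (hT : ENNReal.ofReal (2 / (v₀ / (1 + ∑ i ∈ Finset.univ.erase s, r i))) ≤ T) :
    AsymptoticBound.{u} (ebtc K ε₀ rule) (fun δ p => p.glrTime ε δ) ν
      (T * ENNReal.ofReal (slackFactor ε ε₀ (means ν) s)) := by
  obtain ⟨hbm, hs⟩ := lt_of_bestArms_eq hbest
  set μ := means ν with hμ
  set D := slackFactor ε ε₀ μ s with hD
  set R := ∑ i ∈ Finset.univ.erase s, r i with hR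
  have hR0 : 0 ≤ R := Finset.sum_nonneg fun i hi => (hr.pos i (Finset.ne_of_mem_erase hi)).le
  have hv₀ := hr.value_pos
  obtain ⟨j₀, hj₀⟩ : ∃ j, j ≠ s := by
    have : Nontrivial (Fin K) := Fin.nontrivial_iff_two_le.2 hK
    exact exists_ne s
  have hgap : ∀ j ≠ s, 0 < μ s - μ j + ε ∧ 0 < μ s - μ j + ε₀ := fun j hj =>
    ⟨by linarith [hs j hj], by linarith [hs j hj]⟩
  have hD0 : 0 < D := lt_of_lt_of_le (pow_pos (div_pos (hgap j₀ hj₀).2 (hgap j₀ hj₀).1) 2)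
    (sq_le_slackFactor hε hε₀ hbm hs hj₀)
  have hG₀ : 0 < v₀ / (1 + R) / D := by positivity
  have hbound := limsup_lintegral_glrTime_le.{u} (ε := ε) hK hν hG₀ fun G hG =>
    Trajectory.eventually_transportCost_ge hv hε₀ hε hs hr fun j hj => by
      have h1 := sq_le_slackFactor hε hε₀ hbm hs hj
      rw [← hD, div_pow, div_le_iff₀ (pow_pos (hgap j hj).1 2)] at h1
      have hrj := hr.pos j hj
      rw [← hR]
      rw [div_div, lt_div_iff₀ (by positivity)] at hG
      have h2 : v₀ ≤ D * ((μ s - μ j + ε) ^ 2 * (r j / (1 + r j))) := by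
        rw [← hr.equal j hj, ← mul_assoc]
        gcongr
      refine lt_of_mul_lt_mul_left ?_ hD0.le
      linarith
  intro Ω mΩ P _ ℱ p h hA
  refine (hbound Ω P ℱ p h hA).trans ?_
  have : 2 / (v₀ / (1 + R) / D) = 2 / (v₀ / (1 + R)) * D := by field_simp
  rw [this, ENNReal.ofReal_mul (by positivity)]
  gcongr

lemma isOneSubGaussian_gaussianReal (m : ℝ) : IsOneSubGaussian (gaussianReal m 1) := by
  refine ⟨inferInstance, ?_, ?_⟩
  · intro t
    simp only [mul_sub, Real.exp_sub]
    exact (integrable_exp_mul_gaussianReal t).div_const _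
  · intro t
    rw [integral_id_gaussianReal, mgf]
    simp only [mul_sub, Real.exp_sub]
    rw [integral_div]
    have := congrFun (mgf_fun_id_gaussianReal (μ := m) (v := 1)) t
    rw [mgf] at this
    rw [this, ← Real.exp_sub]
    refine Real.exp_le_exp.2 (le_of_eq ?_)
    ring

lemma means_gaussianInstance {K : ℕ} (μ : Fin K → ℝ) : means (gaussianInstance μ) = μ := by
  ext i
  exact integral_id_gaussianReal

lemma slackFactor_self {K : ℕ} (ε : ℝ) (μ : Fin K → ℝ) (s : Fin K) : slackFactor ε ε μ s = 1 := by
  simp [slackFactor]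

/-- The asymptotic bounds of the two algorithms. -/
theorem asymptoticBound_ebtc {K : ℕ} (hK : 2 ≤ K) {ε ε₀ : ℝ} (hε : 0 ≤ ε)
    (hε₀ : 0 < ε₀) {ν : Fin K → Measure ℝ}
    (hν : ∀ i, IsOneSubGaussian (ν i)) {s : Fin K} (hbest : bestArms (means ν) = {s}) :
    AsymptoticBound.{u} (ebtc K ε₀ .ids) (fun δ p => p.glrTime ε δ) ν
        (charTime ε₀ (means ν) * ENNReal.ofReal (slackFactor ε ε₀ (means ν) s)) ∧
      ∀ β ∈ Set.Ioo (0 : ℝ) 1,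
        AsymptoticBound.{u} (ebtc K ε₀ (.fixed β)) (fun δ p => p.glrTime ε δ) ν
          (charTimeBeta ε₀ β (means ν) * ENNReal.ofReal (slackFactor ε ε₀ (means ν) s)) := by
  obtain ⟨hbm, hs⟩ := lt_of_bestArms_eq hbest
  have hle : ∀ j, means ν j ≤ means ν s := fun j => by
    by_cases hj : j = s
    · rw [hj]
    · exact (hs j hj).le
  have hvalue : ∀ {rule : Proportions} {r : Fin K → ℝ} {v₀ : ℝ},
      IsOptimalRatio rule ε₀ (means ν) s r v₀ → 0 < v₀ / (1 + ∑ i ∈ Finset.univ.erase s, r i) := by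
    intro rule r v₀ hr
    have h1 : 0 ≤ ∑ i ∈ Finset.univ.erase s, r i :=
      Finset.sum_nonneg fun i hi => (hr.pos i (Finset.ne_of_mem_erase hi)).le
    have h2 := hr.value_pos
    positivity
  constructor
  · obtain ⟨r, v₀, hr⟩ := exists_isOptimalRatio hK (rule := .ids) trivial hε₀ hs
    refine asymptoticBound_of_isOptimalRatio (rule := .ids) hK hε hε₀ trivial hν hbest hr ?_
    refine le_iInf₂ fun i hi => le_iInf₂ fun β hβ => ?_
    have hi' : means ν s - ε₀ ≤ means ν i := by rw [← hbm]; exact hi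
    refine le_charTimeArm hle hi' hβ.1 (hvalue hr) fun w hw hws => ?_
    rw [← hws]
    exact hr.exists_cost_le_ids hK hw (hws ▸ hβ.1)
  · intro β hβ
    obtain ⟨r, v₀, hr⟩ := exists_isOptimalRatio hK (rule := .fixed β) hβ hε₀ hs
    refine asymptoticBound_of_isOptimalRatio (rule := .fixed β) hK hε hε₀ hβ hν hbest hr ?_
    refine le_iInf₂ fun i hi => ?_
    have hi' : means ν s - ε₀ ≤ means ν i := by rw [← hbm]; exact hi
    exact le_charTimeArm hle hi' hβ.1 (hvalue hr) fun w hw hws =>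
      hr.exists_cost_le_fixed hβ hK hw hws

end EBTC

theorem theorem1 {K : ℕ} (hK : 2 ≤ K) (ε ε₀ : ℝ) (hε : 0 ≤ ε) (hε₀ : 0 < ε₀) :
    -- the stopped algorithm is PAC, with either choice of the proportions
    (∀ δ ∈ Set.Ioo (0 : ℝ) 1,
      EBTC.IsPAC.{u} (EBTC.ebtc K ε₀ .ids) (fun p => p.glrTime ε δ) ε δ ∧
      ∀ β ∈ Set.Ioo (0 : ℝ) 1,
        EBTC.IsPAC.{u} (EBTC.ebtc K ε₀ (.fixed β)) (fun p => p.glrTime ε δ) ε δ) ∧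
    -- asymptotic upper bounds on the expected sample complexity
    (∀ ν : Fin K → Measure ℝ, (∀ i, EBTC.IsOneSubGaussian (ν i)) →
      ∀ iStar : Fin K, EBTC.bestArms (EBTC.means ν) = {iStar} →
        EBTC.AsymptoticBound.{u} (EBTC.ebtc K ε₀ .ids) (fun δ p => p.glrTime ε δ) ν
          (EBTC.charTime ε₀ (EBTC.means ν) *
            ENNReal.ofReal (EBTC.slackFactor ε ε₀ (EBTC.means ν) iStar)) ∧
        ∀ β ∈ Set.Ioo (0 : ℝ) 1,
          EBTC.AsymptoticBound.{u} (EBTC.ebtc K ε₀ (.fixed β)) (fun δ p => p.glrTime ε δ) ν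
            (EBTC.charTimeBeta ε₀ β (EBTC.means ν) *
              ENNReal.ofReal (EBTC.slackFactor ε ε₀ (EBTC.means ν) iStar))) ∧
    -- optimality for Gaussian arms when the slack of the stopping rule is `ε₀`
    (∀ (μ : Fin K → ℝ) (iStar : Fin K), EBTC.bestArms μ = {iStar} →
      EBTC.AsymptoticallyOptimal.{u} (EBTC.ebtc K ε₀ .ids) (fun δ p => p.glrTime ε₀ δ) ε₀ μ ∧
      ∀ β ∈ Set.Ioo (0 : ℝ) 1,
        EBTC.AsymptoticallyBetaOptimal.{u} (EBTC.ebtc K ε₀ (.fixed β))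
          (fun δ p => p.glrTime ε₀ δ) ε₀ β μ) := by
  refine ⟨fun δ hδ => ⟨EBTC.isPAC_glrTime hK hε hδ.1 _, fun β _ =>
    EBTC.isPAC_glrTime hK hε hδ.1 _⟩, fun ν hν s hs =>
    EBTC.asymptoticBound_ebtc hK hε hε₀ hν hs, fun μ s hs => ?_⟩
  have h := EBTC.asymptoticBound_ebtc.{u} hK hε₀.le hε₀
    (ν := EBTC.gaussianInstance μ) (fun i => EBTC.isOneSubGaussian_gaussianReal (μ i))
    (s := s) (by rw [EBTC.means_gaussianInstance]; exact hs)
  simp only [EBTC.means_gaussianInstance, EBTC.slackFactor_self, ENNReal.ofReal_one, mul_one] at h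
  exact h
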